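/- **Setting.** Let $d\ge 1$ and let $\Omega\subset\mathbb R^d$ be a bounded open set with $\Omega=\operatorname{int}\overline\Omega$ (for example a bounded Lipschitz domain). Let $\mathcal T_h$ be a conforming partition of $\overline\Omega$ into finitely many nondegenerate simplices, or into finitely many parallelepipeds (affine images of the unit cube): two distinct elements meet in a common face or not at all. Let $\mu\ge0$ be constant, and let $\beta$ be a vector field, continuous on $\overline\Omega$ and $C^1$ in $\Omega$, with $\nabla\cdot\beta=0$ in $\Omega$. $V_h$ is the space of functions, discontinuous across elements, that are $\mathbb P_1$ (simplices) or $\mathbb Q_1$ in the affine coordinates of the element (parallelepipeds) on each element. The nodes $a\in\mathcal N_h$ are the pairs (vertex, element), with coordinates $x_a$, nodal values $v_a$ and shape functions $\varphi_a$ (supported on one element). $\Omega_a$ is the union of the elements that contain $x_a$; $\mathcal N_h(a)=\{b: x_b\in\Omega_a\}$; $\mathcal N_h^\partial=\{b: x_b\in\partial\Omega\}$; $\mathcal N_h^\partial(a)=\mathcal N_h(a)\cap\mathcal N_h^\partial$. The boundary values $\bar u$ enter through the nodal interpolant $\bar u_h=\sum_{b\in\mathcal N_h^\partial}\bar u_b\varphi_b$,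 $\bar u_b=\bar u(x_b)$. $\mathcal E^0$, $\mathcal E^-$, $\mathcal E^+$ are the interior, inflow ($\beta\cdot n<0$) and outflow (the other boundary) facets, $\mathcal E=\mathcal E^0\cup\mathcal E^-\cup\mathcal E^+$, $\mathcal E^\partial=\mathcal E^-\cup\mathcal E^+$; $h_F>0$ are given facet lengths and $c^{\rm ip}=10$. With the usual averages $\{v\}=\frac12(v^++v^-)$ and jumps $[\![v]\!]=v^+n^++v^-n^-$ (on boundary facets $\{v\}=v$, $[\![v]\!]=vn$), put $$\begin{aligned}K_h(u,v)=&\sum_K\int_K(\mu\nabla u\cdot\nabla v-u\,\beta\cdot\nabla v)+\sum_{F\in\mathcal E}\int_F\mu\big(-[\![u]\!]\cdot\{\nabla v\}-\{\nabla u\}\cdot[\![v]\!]+c^{\rm ip}h_F^{-1}[\![u]\!]\cdot[\![v]\!]\big)\\&+\sum_{F\in\mathcal E^+\cup\mathcal E^0}\int_F\{\beta u\}\cdot[\![v]\!]+\sum_{F\in\mathcal E^0}\int_F\tfrac{|\beta\cdot n_F|}2[\![u]\!]\cdot[\![v]\!],\\ B_h(w;v)=&-\sum_{F\in\mathcal E^-}\int_F\beta\cdot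 n\,wv-\sum_{F\in\mathcal E^\partial}\int_F\mu w\nabla v\cdot n+\sum_{F\in\mathcal E^\partial}\int_Fc^{\rm ip}\mu h_F^{-1}wv .\end{aligned}$$ **Discrete extrema and detectors.** $u_h\in V_h$ has a discrete maximum (minimum) on $a$ if $u_a\ge$ (resp. $\le$) every value of $u_h$, from any element, at points of $\Omega_a$, and $u_a\ge\bar u$ (resp. $\le\bar u$) on $\partial\Omega_a\cap\partial\Omega$. A family $\alpha_a(u_h,\bar u_h)$ has the *shock detector property* if $\alpha_a\in[0,1]$ always and $\alpha_a(u_h,\bar u_h)=1$ whenever $u_h$ has a discrete extremum on $a$. The *jump-based shock detector*, with $q>0$ and given lengths $h_{ab}>0$, is $$\alpha_a=\left(\frac{\big|\sum_{b\in\mathcal N_h(a)}J_{ab}\big|}{\sum_{b\in\mathcal N_h(a)}2A_{ab}}\right)^q\ \text{ if }\ \sum_{b\in\mathcal N_h(a)} A_{ab}\ne0,\qquad \alpha_a=0\ \text{ otherwise}.$$ If $x_a=x_b$, then $J_{ab}=\frac{u_b-u_a}{h_{ab}}$ and $A_{ab}=\frac12\frac{|u_b-u_a|}{h_{ab}}$.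 If $x_a\neq x_b$, then $$J_{ab}=\frac{u_b-u_a}{|r_{ab}|}+\frac{u^{\rm sym}_{ab}-u_a}{|r_{ab}^{\rm sym}|},\qquad A_{ab}=\frac12\Big(\frac{|u_b-u_a|}{|r_{ab}|}+\frac{|u_{ab}^{\rm sym}-u_a|}{|r_{ab}^{\rm sym}|}\Big),$$ where $r_{ab}=x_b-x_a$; $x_{ab}^{\rm sym}$ is the last point of $\Omega_a$ on the ray from $x_a$ in direction $-r_{ab}$; $r^{\rm sym}_{ab}=x^{\rm sym}_{ab}-x_a$; $u_{ab}^{\rm sym}=u_h(x_{ab}^{\rm sym})$. The values from all elements of $\Omega_a$ containing $x_{ab}^{\rm sym}$ are used, their contributions being summed. If $x_{ab}^{\rm sym}=x_a$, one takes instead $u_{ab}^{\rm sym}=\bar u_a+(u_b-u_a)\operatorname{sgn}((\bar u_a-u_a)(u_b-u_a))$ and $|r_{ab}^{\rm sym}|=|r_{ab}|$. **Scheme.** For a family $\alpha$ let $\nu^\partial_{ab}=\max\{-\alpha_aB_h(\varphi_b;\varphi_a),0\}$ for $b\in\mathcal N_h^\partial(a)$, let $\nu_{ab}=\max\{\alpha_aK_h(\varphi_b,\varphi_a),0,\alpha_bK_h(\varphi_a,\varphi_b)\}$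 for $b\in\mathcal N_h(a)$, $b\ne a$, and let $\nu_{aa}=\sum_{b\in\mathcal N_h(a)\setminus\{a\}}\nu_{ab}+\sum_{b\in\mathcal N_h^\partial(a)}\nu^\partial_{ab}$, all evaluated at $(w,\bar w)$. With $\ell(a,b)=2\delta_{ab}-1$ and $Q>0$ put $$\tilde K_h(w,\bar w;u,v)=K_h(u,v)+\sum_a\sum_{b\in\mathcal N_h(a)}\nu_{ab}\,v_au_b\,\ell(a,b),\qquad \tilde B_h(w,\bar w,z;v)=B_h(z;v)+\sum_a\sum_{b\in\mathcal N^\partial_h(a)}\nu^\partial_{ab}\,v_az_b,$$ $$M_h^L(w,\bar w;z,v)=\sum_av_a\big(1-\alpha_a^Q(w,\bar w)\big)(z,\varphi_a)+\alpha_a^Q(w,\bar w)\,z_av_a(1,\varphi_a).$$ The semi-discrete scheme is: for $t\in(0,T]$ and all $v_h\in V_h$, $$M_h^L(u_h,\bar u_h;\partial_tu_h,v_h)+\tilde K_h(u_h,\bar u_h;u_h,v_h)=(g,v_h)+\tilde B_h(u_h,\bar u_h,\bar u_h;v_h).$$ It is *local extremum diminishing* (LED) if, for $g=0$, every solution and every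 $t\in(0,T]$, one has $\mathrm d_tu_a\le0$ at each node $a$ with a discrete maximum of $u_h(t)$ and $\mathrm d_tu_a\ge0$ at each node with a discrete minimum. Write $\tilde M_{ab}=M_h^L(u_h,\bar u_h;\varphi_b,\varphi_a)$, $\tilde K_{ab}=\tilde K_h(u_h,\bar u_h;\varphi_b,\varphi_a)$, $\tilde B_{ab}=\tilde B_h(u_h,\bar u_h,\varphi_b;\varphi_a)$. **Lemma.** (i) If $\alpha$ has the shock detector property, then the scheme is LED. Moreover, whenever $u_h$ has a discrete extremum on $a$, $$\tilde M_{ab}=m_a\delta_{ab}\ \ (m_a=\textstyle\int_\Omega\varphi_a>0),\qquad \tilde K_{ab}\le0\ (b\ne a),\qquad \tilde B_{ab}\ge0\ (b\in\mathcal N_h^\partial),$$ $$\sum_{b\in\mathcal N_h(a)}\tilde K_{ab}-\sum_{b\in\mathcal N_h^\partial(a)}\tilde B_{ab}=0. \qquad (\ast)$$ (ii) The jump-based shock detector takes values in $[0,1]$. If $u_h$ has a discrete extremum on $a$ and $\sum_{b\in\mathcal N_h(a)}A_{ab}\neq0$ (that is, the detector is not in its degenerate branch), then $\alpha_a=1$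 and all the conditions of (i) up to and including $(\ast)$ hold for the scheme driven by this detector; and for $g=0$ every solution satisfies $\mathrm d_tu_a\le0$ (resp. $\ge0$) at each such discrete maximum (resp. minimum). -/

import Mathlib

noncomputable section

namespace DGLED

open MeasureTheory Set
open scoped Classical RealInnerProductSpace

/-- The Euclidean space `ℝ^d`. -/
abbrev E (d : ℕ) : Type := EuclideanSpace ℝ (Fin d)

/-! ### Reference elements -/

/-- Simplicial (triangles, tetrahedra, …) or hexahedral (quadrilaterals, hexahedra, …) meshes. -/
inductive Shape : Type
  | simplex : Shape
  | cube : Shape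

/-- Local vertices. Simplex: `none` is the origin and `some j` the `j`-th unit vector. Cube:
`σ` is the vertex whose `j`-th coordinate is `1` if `σ j = true` and `0` otherwise. -/
abbrev Shape.Vtx (s : Shape) (d : ℕ) : Type :=
  match s with
  | .simplex => Option (Fin d)
  | .cube => Fin d → Bool

/-- Local facets. Simplex: the facet opposite to the given vertex. Cube: `(j, false)` is the facet
`x_j = 0` and `(j, true)` the facet `x_j = 1`. -/
abbrev Shape.Fct (s : Shape) (d : ℕ) : Type :=
  match s with
  | .simplex => Option (Fin d)
  | .cube => Fin d × Bool

instance Shape.instFintypeVtx (s : Shape) (d : ℕ) : Fintype (s.Vtx d) :=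
  match s with
  | .simplex => inferInstanceAs (Fintype (Option (Fin d)))
  | .cube => inferInstanceAs (Fintype (Fin d → Bool))

instance Shape.instFintypeFct (s : Shape) (d : ℕ) : Fintype (s.Fct d) :=
  match s with
  | .simplex => inferInstanceAs (Fintype (Option (Fin d)))
  | .cube => inferInstanceAs (Fintype (Fin d × Bool))

/-- Position of a local vertex in the reference element. -/
def Shape.refVtx {d : ℕ} (s : Shape) (v : s.Vtx d) : E d :=
  match s, v with
  | .simplex, (v : Option (Fin d)) => v.elim 0 (fun j => EuclideanSpace.single j 1)
  | .cube, (σ : Fin d → Bool) => WithLp.toLp 2 (fun j => if σ j then 1 else 0)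

/-- Nodal basis of `P₁` (barycentric coordinates), respectively of `Q₁` (tensor products of linear
one-dimensional polynomials), on the reference element. -/
def Shape.refBasis {d : ℕ} (s : Shape) (v : s.Vtx d) (x : E d) : ℝ :=
  match s, v with
  | .simplex, (v : Option (Fin d)) => v.elim (1 - ∑ j, x j) (fun j => x j)
  | .cube, (σ : Fin d → Bool) => ∏ j, if σ j then x j else 1 - x j

/-- The affine function which is nonnegative on the reference element and vanishes exactly on the
given facet. -/
def Shape.refFct {d : ℕ} (s : Shape) (f : s.Fct d) (x : E d) : ℝ :=
  match s, f with
  | .simplex, (f : Option (Fin d)) => f.elim (1 - ∑ j, x j) (fun j => x j)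
  | .cube, (f : Fin d × Bool) => if f.2 then 1 - x f.1 else x f.1

/-- The reference element: the unit simplex, respectively the unit cube. -/
def Shape.refElem (s : Shape) (d : ℕ) : Set (E d) :=
  {x | ∀ f : s.Fct d, 0 ≤ s.refFct f x}

/-- The element that is the image of the reference element under `A`. -/
def Shape.elem {d : ℕ} (s : Shape) (A : E d ≃ᵃ[ℝ] E d) : Set (E d) :=
  A '' s.refElem d

/-- The facets of an element. -/
def Shape.facet {d : ℕ} (s : Shape) (A : E d ≃ᵃ[ℝ] E d) (f : s.Fct d) : Set (E d) :=
  A '' {x ∈ s.refElem d | s.refFct f x = 0}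

/-! ### Meshes -/

/-- A conforming partition of `closure Ω` into `n` elements, all of them (nondegenerate) simplices
or all of them parallelepipeds. Two distinct elements meet in a common face, possibly empty; a
proper face of an element is an intersection of some of its facets. -/
structure Mesh (d : ℕ) (Ω : Set (E d)) where
  shape : Shape
  n : ℕ
  map : Fin n → (E d ≃ᵃ[ℝ] E d)
  cover : (⋃ i, shape.elem (map i)) = closure Ω
  conforming : ∀ i j, i ≠ j → ∃ S S' : Set (shape.Fct d), S.Nonempty ∧ S'.Nonempty ∧
    shape.elem (map i) ∩ shape.elem (map j) = ⋂ f ∈ S, shape.facet (map i) f ∧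
    shape.elem (map i) ∩ shape.elem (map j) = ⋂ f ∈ S', shape.facet (map j) f

namespace Mesh

variable {d : ℕ} {Ω : Set (E d)} (𝒯 : Mesh d Ω)

/-- The `i`-th element `K`. -/
def elem (i : Fin 𝒯.n) : Set (E d) := 𝒯.shape.elem (𝒯.map i)

/-- Facets seen from an element: an element together with one of its local facets. -/
abbrev LFct : Type := Fin 𝒯.n × 𝒯.shape.Fct d

/-- The point set of a facet. -/
def fct (p : 𝒯.LFct) : Set (E d) := 𝒯.shape.facet (𝒯.map p.1) p.2

/-- The nodes: pairs of an element and one of its vertices. -/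
abbrev Node : Type := Fin 𝒯.n × 𝒯.shape.Vtx d

/-- The coordinates `x_a` of a node. -/
def pos (a : 𝒯.Node) : E d := 𝒯.map a.1 (𝒯.shape.refVtx a.2)

/-- Boundary nodes. -/
abbrev BNode : Type := {a : 𝒯.Node // 𝒯.pos a ∈ frontier Ω}

/-- The dG space `V_h`; a function is given by its nodal values. -/
abbrev V : Type := 𝒯.Node → ℝ

/-- The space of boundary data `∑_{b ∈ N^∂} z_b φ_b`, given by its nodal values. -/
abbrev VB : Type := 𝒯.BNode → ℝ

/-- The support `Ω_a`, as a set of elements. -/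
def patchElems (a : 𝒯.Node) : Finset (Fin 𝒯.n) :=
  Finset.univ.filter fun i => 𝒯.pos a ∈ 𝒯.elem i

/-- The support `Ω_a`, as a set of points. -/
def patch (a : 𝒯.Node) : Set (E d) := ⋃ i ∈ 𝒯.patchElems a, 𝒯.elem i

/-- The nodes `N_h(a)` connected to `a` (including `a`). -/
def nbrs (a : 𝒯.Node) : Finset 𝒯.Node :=
  Finset.univ.filter fun b => 𝒯.pos b ∈ 𝒯.patch a

/-- The boundary nodes `N_h^∂(a)` connected to `a`. -/
def bnbrs (a : 𝒯.Node) : Finset 𝒯.BNode :=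
  Finset.univ.filter fun b => 𝒯.pos b.1 ∈ 𝒯.patch a

/-- The polynomial which agrees with the shape function `φ_a` on the element of the node `a`. -/
def shapeFn (a : 𝒯.Node) (x : E d) : ℝ := 𝒯.shape.refBasis a.2 ((𝒯.map a.1).symm x)

/-- `v_h^K`: the restriction of `v` to the `i`-th element (as a polynomial). -/
def onElem (v : 𝒯.V) (i : Fin 𝒯.n) (x : E d) : ℝ := ∑ k, v (i, k) * 𝒯.shapeFn (i, k) x

/-- The gradient of `v_h^K`. -/
def gradOn (v : 𝒯.V) (i : Fin 𝒯.n) (x : E d) : E d := gradient (𝒯.onElem v i) x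

/-- The shape function `φ_a` as an element of `V_h`. -/
def φ (a : 𝒯.Node) : 𝒯.V := Pi.single a 1

/-- The shape function `φ_b` of a boundary node as boundary datum. -/
def φB (b : 𝒯.BNode) : 𝒯.VB := Pi.single b 1

/-- Boundary data as elements of `V_h`. -/
def lift (z : 𝒯.VB) : 𝒯.V := fun a => if h : 𝒯.pos a ∈ frontier Ω then z ⟨a, h⟩ else 0

/-- Nodal interpolation of the boundary values. -/
def interp (ubar : E d → ℝ) : 𝒯.VB := fun b => ubar (𝒯.pos b.1)

/-! ### Facets, jumps and averages -/

/-- The constant outward unit normal on a facet of an element. -/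
def normal (p : 𝒯.LFct) : E d :=
  let g : E d := gradient (fun x => 𝒯.shape.refFct p.2 ((𝒯.map p.1).symm x)) 0;
  (-‖g‖⁻¹) • g

/-- The surface integral over a facet. -/
def fctInt (p : 𝒯.LFct) (f : E d → ℝ) : ℝ := ∫ x in 𝒯.fct p, f x ∂(μHE[d - 1] : Measure (E d))

/-- The interior facets: `F` is seen as a facet of its two elements `K_F^+` and `K_F^-` (numbered
such that `K_F^+` comes first), so that every interior facet appears once. -/
def intFcts : Finset (𝒯.LFct × 𝒯.LFct) :=
  Finset.univ.filter fun F => F.1.1 < F.2.1 ∧ 𝒯.fct F.1 = 𝒯.fct F.2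

/-- The boundary facets. -/
def bdryFcts : Finset 𝒯.LFct := Finset.univ.filter fun p => 𝒯.fct p ⊆ frontier Ω

/-- The inflow boundary facets: `β · n < 0` (almost everywhere) on the facet. -/
def inFcts (β : E d → E d) : Finset 𝒯.LFct :=
  𝒯.bdryFcts.filter fun p =>
    ∀ᵐ x ∂((μHE[d - 1] : Measure (E d)).restrict (𝒯.fct p)), ⟪β x, 𝒯.normal p⟫ < 0

/-- The outflow boundary facets: the remaining boundary facets. -/
def outFcts (β : E d → E d) : Finset 𝒯.LFct := 𝒯.bdryFcts \ 𝒯.inFcts β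

/-- The jump of `v` on an interior facet. -/
def jump (v : 𝒯.V) (F : 𝒯.LFct × 𝒯.LFct) (x : E d) : E d :=
  𝒯.onElem v F.1.1 x • 𝒯.normal F.1 + 𝒯.onElem v F.2.1 x • 𝒯.normal F.2

/-- The average of `v` on an interior facet. -/
def mean (v : 𝒯.V) (F : 𝒯.LFct × 𝒯.LFct) (x : E d) : ℝ :=
  (1 / 2) * (𝒯.onElem v F.1.1 x + 𝒯.onElem v F.2.1 x)

/-- The average of `∇v` on an interior facet. -/
def meanGrad (v : 𝒯.V) (F : 𝒯.LFct × 𝒯.LFct) (x : E d) : E d :=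
  (1 / 2 : ℝ) • (𝒯.gradOn v F.1.1 x + 𝒯.gradOn v F.2.1 x)

/-- The jump of `v` on a boundary facet. -/
def bjump (v : 𝒯.V) (p : 𝒯.LFct) (x : E d) : E d := 𝒯.onElem v p.1 x • 𝒯.normal p

/-! ### The interior penalty dG forms -/

/-- The interior penalty constant `c^ip`. -/
def cip : ℝ := 10

/-- `(u, v)`. -/
def massForm (u v : 𝒯.V) : ℝ := ∑ i, ∫ x in 𝒯.elem i, 𝒯.onElem u i x * 𝒯.onElem v i x

/-- `(𝟙, v)`, the integral of `v` over `Ω`. -/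
def integral (v : 𝒯.V) : ℝ := ∑ i, ∫ x in 𝒯.elem i, 𝒯.onElem v i x

/-- The source term `G_h(v)`. -/
def Gh (g : E d → ℝ) (v : 𝒯.V) : ℝ := ∑ i, ∫ x in 𝒯.elem i, g x * 𝒯.onElem v i x

/-- The interior penalty dG bilinear form `K_h(u, v)`. -/
def Kh (μ : ℝ) (β : E d → E d) (hF : Set (E d) → ℝ) (u v : 𝒯.V) : ℝ :=
  (∑ i, ∫ x in 𝒯.elem i,
      (μ * ⟪𝒯.gradOn u i x, 𝒯.gradOn v i x⟫ - 𝒯.onElem u i x * ⟪β x, 𝒯.gradOn v i x⟫))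
  + (∑ F ∈ 𝒯.intFcts, 𝒯.fctInt F.1 fun x => μ *
      (-⟪𝒯.jump u F x, 𝒯.meanGrad v F x⟫ - ⟪𝒯.meanGrad u F x, 𝒯.jump v F x⟫
        + cip * (hF (𝒯.fct F.1))⁻¹ * ⟪𝒯.jump u F x, 𝒯.jump v F x⟫))
  + (∑ p ∈ 𝒯.bdryFcts, 𝒯.fctInt p fun x => μ *
      (-⟪𝒯.bjump u p x, 𝒯.gradOn v p.1 x⟫ - ⟪𝒯.gradOn u p.1 x, 𝒯.bjump v p x⟫
        + cip * (hF (𝒯.fct p))⁻¹ * ⟪𝒯.bjump u p x, 𝒯.bjump v p x⟫))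
  + (∑ F ∈ 𝒯.intFcts, 𝒯.fctInt F.1 fun x => ⟪𝒯.mean u F x • β x, 𝒯.jump v F x⟫)
  + (∑ p ∈ 𝒯.outFcts β, 𝒯.fctInt p fun x => ⟪𝒯.onElem u p.1 x • β x, 𝒯.bjump v p x⟫)
  + (∑ F ∈ 𝒯.intFcts, 𝒯.fctInt F.1 fun x =>
      |⟪β x, 𝒯.normal F.1⟫| / 2 * ⟪𝒯.jump u F x, 𝒯.jump v F x⟫)

/-- The form `B_h(w; v)` of the weak boundary conditions. -/
def Bh (μ : ℝ) (β : E d → E d) (hF : Set (E d) → ℝ) (w : 𝒯.VB) (v : 𝒯.V) : ℝ :=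
  -(∑ p ∈ 𝒯.inFcts β, 𝒯.fctInt p fun x =>
      ⟪β x, 𝒯.normal p⟫ * 𝒯.onElem (𝒯.lift w) p.1 x * 𝒯.onElem v p.1 x)
  - (∑ p ∈ 𝒯.bdryFcts, 𝒯.fctInt p fun x =>
      μ * 𝒯.onElem (𝒯.lift w) p.1 x * ⟪𝒯.gradOn v p.1 x, 𝒯.normal p⟫)
  + (∑ p ∈ 𝒯.bdryFcts, 𝒯.fctInt p fun x =>
      cip * μ * (hF (𝒯.fct p))⁻¹ * 𝒯.onElem (𝒯.lift w) p.1 x * 𝒯.onElem v p.1 x)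

/-! ### Discrete extrema and shock detectors -/

/-- `v` has a local discrete maximum on the node `a`: `v_a` bounds every value of `v` (from any
element) at the points of `Ω_a`, and the boundary values on `∂Ω_a ∩ ∂Ω`. -/
def IsDiscreteMax (v : 𝒯.V) (ubar : E d → ℝ) (a : 𝒯.Node) : Prop :=
  (∀ i, ∀ x ∈ 𝒯.elem i, x ∈ 𝒯.patch a → 𝒯.onElem v i x ≤ v a) ∧
    ∀ x ∈ frontier (𝒯.patch a) ∩ frontier Ω, ubar x ≤ v a

/-- `v` has a local discrete minimum on the node `a`. -/
def IsDiscreteMin (v : 𝒯.V) (ubar : E d → ℝ) (a : 𝒯.Node) : Prop :=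
  (∀ i, ∀ x ∈ 𝒯.elem i, x ∈ 𝒯.patch a → v a ≤ 𝒯.onElem v i x) ∧
    ∀ x ∈ frontier (𝒯.patch a) ∩ frontier Ω, v a ≤ ubar x

/-- `v` has a local discrete extremum on the node `a`. -/
def IsDiscreteExtremum (v : 𝒯.V) (ubar : E d → ℝ) (a : 𝒯.Node) : Prop :=
  𝒯.IsDiscreteMax v ubar a ∨ 𝒯.IsDiscreteMin v ubar a

/-- Families `α_a(u_h, ū_h)`. -/
abbrev Detector : Type := 𝒯.V → 𝒯.VB → 𝒯.Node → ℝ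

/-- The shock detector property. -/
def HasShockDetectorProperty (α : 𝒯.Detector) : Prop :=
  (∀ u w a, α u w a ∈ Icc (0 : ℝ) 1) ∧
    ∀ u ubar a, 𝒯.IsDiscreteExtremum u ubar a → α u (𝒯.interp ubar) a = 1

/-- `r_ab = x_b - x_a`. -/
def r (a b : 𝒯.Node) : E d := 𝒯.pos b - 𝒯.pos a

/-- The symmetric point `x_ab^sym`: the point where the line through `x_b` and `x_a`, prolonged
beyond `x_a`, leaves `Ω_a` (it is `x_a` if the line leaves `Ω_a` at `x_a`). -/
def symPt (a b : 𝒯.Node) : E d :=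
  𝒯.pos a - sSup {t : ℝ | 0 ≤ t ∧ 𝒯.pos a - t • 𝒯.r a b ∈ 𝒯.patch a} • 𝒯.r a b

/-- The elements of `Ω_a` that contain `x_ab^sym`. -/
def symElems (a b : 𝒯.Node) : Finset (Fin 𝒯.n) :=
  (𝒯.patchElems a).filter fun i => 𝒯.symPt a b ∈ 𝒯.elem i

/-- The value `ū_a` (only used for boundary nodes). -/
def bval (u : 𝒯.V) (w : 𝒯.VB) (a : 𝒯.Node) : ℝ :=
  if h : 𝒯.pos a ∈ frontier Ω then w ⟨a, h⟩ else u a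

/-- The extrapolated value of `u_ab^sym` that is used when `x_ab^sym = x_a`. -/
def extrap (u : 𝒯.V) (w : 𝒯.VB) (a b : 𝒯.Node) : ℝ :=
  𝒯.bval u w a + (u b - u a) * Real.sign ((𝒯.bval u w a - u a) * (u b - u a))

/-- The contribution of `b` to the sum of the jumps `⟦∇u⟧_ab`; all values of `u` at `x_ab^sym` in
`Ω_a` contribute. -/
def gradJump (hab : 𝒯.Node → 𝒯.Node → ℝ) (u : 𝒯.V) (w : 𝒯.VB) (a b : 𝒯.Node) : ℝ :=
  if 𝒯.pos a = 𝒯.pos b then (u b - u a) / hab a b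
  else if 𝒯.symPt a b = 𝒯.pos a then
    (u b - u a) / ‖𝒯.r a b‖ + (𝒯.extrap u w a b - u a) / ‖𝒯.r a b‖
  else ∑ i ∈ 𝒯.symElems a b, ((u b - u a) / ‖𝒯.r a b‖
    + (𝒯.onElem u i (𝒯.symPt a b) - u a) / ‖𝒯.symPt a b - 𝒯.pos a‖)

/-- The contribution of `b` to the sum of the means `{|∇u · r̂_ab|}_ab`. -/
def gradMean (hab : 𝒯.Node → 𝒯.Node → ℝ) (u : 𝒯.V) (w : 𝒯.VB) (a b : 𝒯.Node) : ℝ :=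
  if 𝒯.pos a = 𝒯.pos b then (1 / 2) * (|u b - u a| / hab a b)
  else if 𝒯.symPt a b = 𝒯.pos a then
    (1 / 2) * (|u b - u a| / ‖𝒯.r a b‖ + |𝒯.extrap u w a b - u a| / ‖𝒯.r a b‖)
  else ∑ i ∈ 𝒯.symElems a b, (1 / 2) * (|u b - u a| / ‖𝒯.r a b‖
    + |𝒯.onElem u i (𝒯.symPt a b) - u a| / ‖𝒯.symPt a b - 𝒯.pos a‖)

/-- The sum of the means, which appears in the denominator of the shock detector. -/
def sumMean (hab : 𝒯.Node → 𝒯.Node → ℝ) (u : 𝒯.V) (w : 𝒯.VB) (a : 𝒯.Node) : ℝ :=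
  ∑ b ∈ 𝒯.nbrs a, 𝒯.gradMean hab u w a b

/-- The jump-based shock detector with exponent `q`. -/
def shockDetector (hab : 𝒯.Node → 𝒯.Node → ℝ) (q : ℝ) : 𝒯.Detector := fun u w a =>
  if 𝒯.sumMean hab u w a ≠ 0 then
    (|∑ b ∈ 𝒯.nbrs a, 𝒯.gradJump hab u w a b|
      / ∑ b ∈ 𝒯.nbrs a, 2 * 𝒯.gradMean hab u w a b) ^ q
  else 0

/-! ### The stabilized scheme -/

/-- The boundary graph viscosity `ν^∂_ab(u, w)`, for `b ∈ N_h^∂(a)`. -/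
def nuB (μ : ℝ) (β : E d → E d) (hF : Set (E d) → ℝ) (α : 𝒯.Detector)
    (u : 𝒯.V) (w : 𝒯.VB) (a : 𝒯.Node) (b : 𝒯.BNode) : ℝ :=
  max (-(α u w a * 𝒯.Bh μ β hF (𝒯.φB b) (𝒯.φ a))) 0

/-- The graph viscosity `ν_ab(u, w)` for `b ≠ a`. -/
def nuOff (μ : ℝ) (β : E d → E d) (hF : Set (E d) → ℝ) (α : 𝒯.Detector)
    (u : 𝒯.V) (w : 𝒯.VB) (a b : 𝒯.Node) : ℝ :=
  max (max (α u w a * 𝒯.Kh μ β hF (𝒯.φ b) (𝒯.φ a)) 0)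
    (α u w b * 𝒯.Kh μ β hF (𝒯.φ a) (𝒯.φ b))

/-- The graph viscosity `ν_ab(u, w)`, for `b ∈ N_h(a)`. -/
def nu (μ : ℝ) (β : E d → E d) (hF : Set (E d) → ℝ) (α : 𝒯.Detector)
    (u : 𝒯.V) (w : 𝒯.VB) (a b : 𝒯.Node) : ℝ :=
  if b ≠ a then 𝒯.nuOff μ β hF α u w a b
  else (∑ c ∈ (𝒯.nbrs a).erase a, 𝒯.nuOff μ β hF α u w a c)
    + ∑ c ∈ 𝒯.bnbrs a, 𝒯.nuB μ β hF α u w a c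

/-- The graph Laplacian `ℓ(a, b) = 2 δ_ab - 1`. -/
def ell (a b : 𝒯.Node) : ℝ := 2 * (if a = b then 1 else 0) - 1

/-- The perturbed form `K̃_h(w, w̄; u, v)`. -/
def Kt (μ : ℝ) (β : E d → E d) (hF : Set (E d) → ℝ) (α : 𝒯.Detector)
    (w : 𝒯.V) (wb : 𝒯.VB) (u v : 𝒯.V) : ℝ :=
  𝒯.Kh μ β hF u v
    + ∑ a, ∑ b ∈ 𝒯.nbrs a, 𝒯.nu μ β hF α w wb a b * v a * u b * 𝒯.ell a b

/-- The perturbed form `B̃_h(w, w̄, z; v)`. -/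
def Bt (μ : ℝ) (β : E d → E d) (hF : Set (E d) → ℝ) (α : 𝒯.Detector)
    (w : 𝒯.V) (wb z : 𝒯.VB) (v : 𝒯.V) : ℝ :=
  𝒯.Bh μ β hF z v + ∑ a, ∑ b ∈ 𝒯.bnbrs a, 𝒯.nuB μ β hF α w wb a b * v a * z b

/-- The mass form with selective lumping, `M_h^L(w, w̄; z, v)`. -/
def Mt (Q : ℝ) (α : 𝒯.Detector) (w : 𝒯.V) (wb : 𝒯.VB) (z v : 𝒯.V) : ℝ :=
  ∑ a, (v a * (1 - α w wb a ^ Q) * 𝒯.massForm z (𝒯.φ a)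
    + α w wb a ^ Q * z a * v a * 𝒯.integral (𝒯.φ a))

/-- `u : [0,T] → V_h` solves the semi-discrete scheme with source `g` and boundary values `ubar`
on `(0, T]`. -/
def IsSolution (μ : ℝ) (β : E d → E d) (hF : Set (E d) → ℝ) (Q : ℝ) (α : 𝒯.Detector)
    (g : ℝ → E d → ℝ) (ubar : ℝ → E d → ℝ) (T : ℝ) (u : ℝ → 𝒯.V) : Prop :=
  ∀ t ∈ Ioc 0 T,
    (∀ a, DifferentiableWithinAt ℝ (fun s => u s a) (Icc 0 T) t) ∧
    ∀ v : 𝒯.V,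
      𝒯.Mt Q α (u t) (𝒯.interp (ubar t)) (fun a => derivWithin (fun s => u s a) (Icc 0 T) t) v
        + 𝒯.Kt μ β hF α (u t) (𝒯.interp (ubar t)) (u t) v
      = 𝒯.Gh (g t) v
        + 𝒯.Bt μ β hF α (u t) (𝒯.interp (ubar t)) (𝒯.interp (ubar t)) v

/-- Local extremum diminishing on the nodes at which `P` holds: for `g = 0`, at any time in
`(0, T]`, `d_t u_a ≤ 0` if `u_a` is a maximum and `d_t u_a ≥ 0` if `u_a` is a minimum. -/
def IsLEDOn (P : 𝒯.V → 𝒯.VB → 𝒯.Node → Prop) (μ : ℝ) (β : E d → E d) (hF : Set (E d) → ℝ)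
    (Q : ℝ) (α : 𝒯.Detector) : Prop :=
  ∀ (T : ℝ) (ubar : ℝ → E d → ℝ) (u : ℝ → 𝒯.V),
    𝒯.IsSolution μ β hF Q α (fun _ _ => 0) ubar T u →
    ∀ t ∈ Ioc 0 T, ∀ a, P (u t) (𝒯.interp (ubar t)) a →
      (𝒯.IsDiscreteMax (u t) (ubar t) a → derivWithin (fun s => u s a) (Icc 0 T) t ≤ 0) ∧
      (𝒯.IsDiscreteMin (u t) (ubar t) a → 0 ≤ derivWithin (fun s => u s a) (Icc 0 T) t)

/-- The scheme is local extremum diminishing. -/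
def IsLED (μ : ℝ) (β : E d → E d) (hF : Set (E d) → ℝ) (Q : ℝ) (α : 𝒯.Detector) : Prop :=
  𝒯.IsLEDOn (fun _ _ _ => True) μ β hF Q α

/-- The matrix conditions for the row `a`: lumped mass row `δ_ab m_a` with `m_a = ∫ φ_a > 0`,
signs of the entries of `K̃` and `B̃`, and vanishing row sum. -/
def RowConditions (μ : ℝ) (β : E d → E d) (hF : Set (E d) → ℝ) (Q : ℝ) (α : 𝒯.Detector)
    (u : 𝒯.V) (w : 𝒯.VB) (a : 𝒯.Node) : Prop :=
  (0 < 𝒯.integral (𝒯.φ a) ∧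
    ∀ b, 𝒯.Mt Q α u w (𝒯.φ b) (𝒯.φ a) = if a = b then 𝒯.integral (𝒯.φ a) else 0) ∧
  (∀ b, b ≠ a → 𝒯.Kt μ β hF α u w (𝒯.φ b) (𝒯.φ a) ≤ 0) ∧
  (∀ b, 0 ≤ 𝒯.Bt μ β hF α u w (𝒯.φB b) (𝒯.φ a)) ∧
  (∑ b ∈ 𝒯.nbrs a, 𝒯.Kt μ β hF α u w (𝒯.φ b) (𝒯.φ a))
    - (∑ b ∈ 𝒯.bnbrs a, 𝒯.Bt μ β hF α u w (𝒯.φB b) (𝒯.φ a)) = 0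

end Mesh

/-- The divergence of a vector field. -/
def divergence {d : ℕ} (β : E d → E d) (x : E d) : ℝ :=
  ∑ j, fderiv ℝ β x (EuclideanSpace.single j 1) j

end DGLED

end

/-!
Let `a` be a node with `α_a = 1`; by the detector property, or for the jump-based detector because
all differences entering `J_ab` and `A_ab` have the same sign, this is the case at a discrete
extremum. The viscosity `ν_ab` then dominates the positive off-diagonal entries of the row `a`, the
boundary viscosity dominates the negative entries of `B`, and the mass row is lumped. Two structural
facts about the unperturbed forms remain.

* Nodes `b ∉ N_h(a)` are not coupled with `a` (`Mesh.Kh_eq_zero`): a coupling across a common facet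
  of the two elements would need one of the two nodes to lie on that facet, hence in both elements.
* The row sums vanish, that is `K_h(1, v) = B_h(1, v)` (`Mesh.Kh_one_eq_Bh_one`). All penalty and
  consistency terms cancel, and what is left is the identity `∫_K β · ∇v = ∫_∂K (β · n) v` on every
  element, summed over the elements. This needs every facet to be a boundary facet or to be shared
  by exactly two elements on opposite sides of it (`Mesh.sum_lfct`), which follows from conformity
  and from `Ω = int (closure Ω)`.

The field `β` is `C¹` only in the open set `Ω`, while elements may touch `∂Ω`. The divergence
theorem is therefore proved (`integral_divergence_polytope`) for fields that are only continuous up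
to the boundary, on bounded polytopes `{x | ∀ f, 0 ≤ λ_f x}` with affine `λ_f`, which covers
simplices and parallelepipeds alike. The field is multiplied by the cutoff function
`∏_f η (λ_f / ε)` with a smooth step `η`; the integral of the divergence of the product vanishes,
and as `ε → 0` the gradient of the cutoff function concentrates on the facets. In orthogonal
coordinates adapted to the hyperplane `λ_f = 0`, rescaled by `ε` in the normal direction, this limit
is an instance of dominated convergence.

Given the row conditions, the equation of the scheme at `a` reads
`m_a u_a' = ∑_b K_ab (u_a - u_b) + ∑_b B_ab (ū_b - u_a)`, in which every term has the right sign
at an extremum.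
-/

namespace DGLED

open MeasureTheory Set Filter Topology
open scoped RealInnerProductSpace

/-! ### Hyperplane coordinates and the surface measure -/

/-- The coordinate embedding `y ↦ (0, y)` of `ℝ^k` into `ℝ^(k+1)`. -/
def consZero (k : ℕ) : E k →ₗᵢ[ℝ] E (k + 1) where
  toFun y := WithLp.toLp 2 (Fin.cons 0 (fun i => y i))
  map_add' x y := by
    ext i
    refine Fin.cases ?_ (fun i => ?_) i <;> simp
  map_smul' c y := by
    ext i
    refine Fin.cases ?_ (fun i => ?_) i <;> simp
  norm_map' y := by
    simp [EuclideanSpace.norm_eq, Fin.sum_univ_succ]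

/-- Orthogonal coordinates adapted to the hyperplane through `p` with unit normal `n`. -/
lemma exists_hyperplane_coords {k : ℕ} (n : E (k + 1)) (hn : ‖n‖ = 1) (p : E (k + 1)) :
    ∃ U : E k →ₗᵢ[ℝ] E (k + 1), (∀ y, ⟪n, U y⟫ = 0) ∧ (∀ x, ⟪n, x⟫ = 0 → ∃ y, U y = x) ∧
      MeasurePreserving (fun q : ℝ × E k => p + q.1 • n + U q.2) := by
  have hv : Orthonormal ℝ (({0} : Set (Fin (k + 1))).domRestrict fun _ => n) := by
    constructor
    · exact fun _ => hn
    · intro i j hij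
      exact absurd (Subsingleton.elim i j) hij
  obtain ⟨b, hb⟩ := hv.exists_orthonormalBasis_extension_of_card_eq (by simp)
  have hb0 : b 0 = n := hb 0 rfl
  have hrepr : ∀ x, ⟪n, x⟫ = b.repr x 0 := fun x => by rw [b.repr_apply_apply, hb0]
  refine ⟨b.repr.symm.toLinearIsometry.comp (consZero k), ?_, ?_, ?_⟩
  · intro y
    rw [hrepr]
    simp [consZero]
  · intro x hx
    refine ⟨WithLp.toLp 2 fun i => b.repr x i.succ, ?_⟩
    apply b.repr.injective
    ext i
    refine Fin.cases ?_ (fun i => ?_) i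
    · rw [hrepr] at hx
      simp [consZero, hx]
    · simp [consZero]
  · have h1 : MeasurePreserving (Prod.map (id : ℝ → ℝ) (WithLp.ofLp : E k → (Fin k → ℝ))) :=
      (MeasurePreserving.id (volume : Measure ℝ)).prod (PiLp.volume_preserving_ofLp (Fin k))
    have h2 := (volume_preserving_piFinSuccAbove (fun _ : Fin (k + 1) => ℝ) 0).symm
    have h3 := PiLp.volume_preserving_toLp (Fin (k + 1))
    have h4 := b.measurePreserving_repr_symm
    have h5 := measurePreserving_add_left (volume : Measure (E (k + 1))) p
    convert! h5.comp (h4.comp (h3.comp (h2.comp h1))) using 1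
    funext q
    simp only [Function.comp, add_assoc]
    congr 1
    apply b.repr.injective
    ext i
    have : b.repr n = EuclideanSpace.single 0 1 := by rw [← hb0, b.repr_self]
    refine Fin.cases ?_ (fun i => ?_) i <;>
    simp [consZero, this, MeasurableEquiv.piFinSuccAbove]

/-- Hausdorff integrals over subsets of a hyperplane in orthogonal coordinates. -/
lemma setIntegral_hausdorff_eq {k : ℕ} {X : Type*} [MetricSpace X] [MeasurableSpace X]
    [BorelSpace X] {V : E k → X} (hV : Isometry V) {F : Set X} (hF : F ⊆ range V) (f : X → ℝ) :
    ∫ x in F, f x ∂(μHE[k] : Measure X) = ∫ y in V ⁻¹' F, f (V y) := by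
  have h := hV.map_euclideanHausdorffMeasure (d := k)
  rw [EuclideanSpace.euclideanHausdorffMeasure_eq_volume] at h
  rw [← hV.isClosedEmbedding.measurableEmbedding.setIntegral_map, h,
    Measure.restrict_restrict_of_subset hF]

/-- Bounded subsets of a hyperplane have finite surface measure. -/
lemma hausdorff_lt_top {k : ℕ} {X : Type*} [MetricSpace X] [MeasurableSpace X]
    [BorelSpace X] {V : E k → X} (hV : Isometry V) {F : Set X} (hF : F ⊆ range V)
    (hb : Bornology.IsBounded F) : (μHE[k] : Measure X) F < ⊤ := by
  have hVF : V '' (V ⁻¹' F) = F := image_preimage_eq_of_subset hF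
  rw [← hVF, hV.euclideanHausdorffMeasure_image, EuclideanSpace.euclideanHausdorffMeasure_eq_volume]
  exact (hV.antilipschitz.isBounded_preimage hb).measure_lt_top

/-- The zero set of a nonzero affine function is a null set. -/
lemma volume_affine_zero {V : Type*} [NormedAddCommGroup V] [InnerProductSpace ℝ V]
    [FiniteDimensional ℝ V] [MeasurableSpace V] [BorelSpace V] (g : V) (c : ℝ)
    (h : ∃ x, ⟪g, x⟫ + c ≠ 0) : volume {x : V | ⟪g, x⟫ + c = 0} = 0 := by
  obtain ⟨x, hx⟩ := h
  let S : AffineSubspace ℝ V :=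
    { carrier := {x : V | ⟪g, x⟫ + c = 0}
      smul_vsub_vadd_mem' := by
        intro t a b e ha hb he
        simp only [mem_ofPred_eq, vsub_eq_sub, vadd_eq_add, inner_add_right, inner_smul_right,
          inner_sub_right] at *
        linear_combination t * ha - t * hb + he }
  refine Measure.addHaar_affineSubspace volume S fun hS => hx ?_
  have : x ∈ S := by rw [hS]; trivial
  exact this

/-! ### The divergence theorem on polytopes -/

/-- A smooth step: it vanishes on `(-∞, 1]` and equals `1` on `[2, ∞)`. -/
noncomputable def step (s : ℝ) : ℝ := Real.smoothTransition (s - 1)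

lemma contDiff_step : ContDiff ℝ 1 step :=
  Real.smoothTransition.contDiff.comp (contDiff_id.sub contDiff_const)

lemma step_of_le {s : ℝ} (h : s ≤ 1) : step s = 0 :=
  Real.smoothTransition.zero_of_nonpos (by linarith)

lemma step_of_ge {s : ℝ} (h : 2 ≤ s) : step s = 1 :=
  Real.smoothTransition.one_of_one_le (by linarith)

lemma abs_step_le (s : ℝ) : |step s| ≤ 1 := by
  rw [abs_of_nonneg (show 0 ≤ step s from Real.smoothTransition.nonneg _)]
  exact Real.smoothTransition.le_one _

lemma continuous_deriv_step : Continuous (deriv step) := contDiff_step.continuous_deriv le_rfl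

lemma hasDerivAt_step (s : ℝ) : HasDerivAt step (deriv step s) s :=
  (contDiff_step.differentiable one_ne_zero s).hasDerivAt

lemma deriv_step_of_lt {s : ℝ} (h : s < 1) : deriv step s = 0 := by
  have : step =ᶠ[𝓝 s] fun _ => 0 := by
    filter_upwards [Iio_mem_nhds h] with t ht using step_of_le (le_of_lt ht)
  rw [this.deriv_eq]; simp

lemma deriv_step_of_gt {s : ℝ} (h : 2 < s) : deriv step s = 0 := by
  have : step =ᶠ[𝓝 s] fun _ => 1 := by
    filter_upwards [Ioi_mem_nhds h] with t ht using step_of_ge (le_of_lt ht)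
  rw [this.deriv_eq]; simp

lemma exists_abs_deriv_step_le : ∃ C, ∀ s, |deriv step s| ≤ C := by
  obtain ⟨C, hC⟩ := isCompact_Icc.exists_bound_of_continuousOn
    (continuous_deriv_step.continuousOn (s := Icc (1 : ℝ) 2))
  refine ⟨max C 0, fun s => ?_⟩
  by_cases hs : s ∈ Icc (1 : ℝ) 2
  · exact (hC s hs).trans (le_max_left _ _)
  · have : deriv step s = 0 := by
      by_cases h1 : s < 1
      · exact deriv_step_of_lt h1
      · exact deriv_step_of_gt (by by_contra h; exact hs ⟨not_lt.1 h1, not_lt.1 h⟩)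
    simp [this]

lemma integral_deriv_step_mul {a : ℝ} (ha : 0 < a) : ∫ τ, deriv step (a * τ) = a⁻¹ := by
  rw [Measure.integral_comp_mul_left (fun s => deriv step s) a, abs_of_pos (inv_pos.2 ha)]
  have h1 : ∫ s, deriv step s = ∫ s in Ioc (0 : ℝ) 3, deriv step s := by
    rw [setIntegral_eq_integral_of_forall_compl_eq_zero]
    intro s hs
    by_cases h : s < 1
    · exact deriv_step_of_lt h
    · exact deriv_step_of_gt (by by_contra h'; exact hs ⟨by linarith, by linarith⟩)
  rw [h1, ← intervalIntegral.integral_of_le (by norm_num),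
    intervalIntegral.integral_deriv_eq_sub (fun x _ => (hasDerivAt_step x).differentiableAt)
      (continuous_deriv_step.intervalIntegrable _ _), step_of_ge (by norm_num),
    step_of_le (by norm_num)]
  simp

/-- The integral of the divergence of a compactly supported `C¹` field vanishes. -/
lemma integral_divergence_eq_zero {d : ℕ} {G : E d → E d} (hG : ContDiff ℝ 1 G)
    (hc : HasCompactSupport G) : ∫ x, divergence G x = 0 := by
  have hcont : Continuous (fderiv ℝ G) := hG.continuous_fderiv one_ne_zero
  have hint : ∀ v, Integrable (fun x => fderiv ℝ G x v) := fun v =>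
    (hcont.clm_apply continuous_const).integrable_of_hasCompactSupport (hc.fderiv_apply ℝ v)
  have hzero : ∀ v, ∫ x, fderiv ℝ G x v = 0 := by
    intro v
    have h := integral_smul_fderiv_eq_neg_fderiv_smul_of_integrable (μ := volume)
      (f := fun _ : E d => (1 : ℝ)) (g := G) (v := v) (by simp) (by simpa using hint v)
      (by simpa using hG.continuous.integrable_of_hasCompactSupport hc)
      (fun _ _ => differentiableAt_const _) (fun x _ => hG.differentiable one_ne_zero x)
    simpa using h
  have hcoord : ∀ j v, Integrable (fun x => fderiv ℝ G x v j) ∧ ∫ x, fderiv ℝ G x v j = 0 := by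
    intro j v
    refine ⟨(EuclideanSpace.proj j : E d →L[ℝ] ℝ).integrable_comp (hint v), ?_⟩
    have h := (EuclideanSpace.proj j : E d →L[ℝ] ℝ).integral_comp_comm (hint v)
    rw [hzero] at h
    simpa using h
  unfold divergence
  rw [integral_finsetSum _ fun j _ => (hcoord j _).1]
  exact Finset.sum_eq_zero fun j _ => (hcoord j _).2

lemma clm_apply_eq_sum {d : ℕ} (L : E d →L[ℝ] ℝ) (x : E d) :
    L x = ∑ j, L (EuclideanSpace.single j 1) * x j := by
  conv_lhs => rw [← (EuclideanSpace.basisFun (Fin d) ℝ).sum_repr x]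
  simp [mul_comm]

lemma divergence_smul {d : ℕ} {χ : E d → ℝ} {L : E d →L[ℝ] ℝ} {G : E d → E d} {x : E d}
    (hχ : HasFDerivAt χ L x) (hG : DifferentiableAt ℝ G x) :
    divergence (fun y => χ y • G y) x = χ x * divergence G x + L (G x) := by
  have h := (hχ.smul hG.hasFDerivAt).fderiv
  unfold divergence
  rw [clm_apply_eq_sum L, Finset.mul_sum, ← Finset.sum_add_distrib]
  refine Finset.sum_congr rfl fun j _ => ?_
  have h' : fderiv ℝ (fun y => χ y • G y) x = χ x • fderiv ℝ G x + L.smulRight (G x) := h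
  rw [h']
  simp

section Polytope

variable {d : ℕ} {ι : Type*} (g : ι → E d) (c : ι → ℝ)

/-- The affine functions `x ↦ ⟪g f, x⟫ + c f`, whose superlevel sets cut out the polytope. -/
noncomputable def aff (f : ι) (x : E d) : ℝ := ⟪g f, x⟫ + c f

/-- The polyhedron on which all the affine functions are nonnegative. -/
def polytope : Set (E d) := {x | ∀ f, 0 ≤ aff g c f x}

/-- The points at which all the affine functions are positive. -/
def polytopeInt : Set (E d) := {x | ∀ f, 0 < aff g c f x}

lemma continuous_aff (f : ι) : Continuous (aff g c f) := by unfold aff; fun_prop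

lemma hasFDerivAt_aff (f : ι) (x : E d) : HasFDerivAt (aff g c f) (innerSL ℝ (g f)) x := by
  unfold aff
  exact (innerSL ℝ (g f)).hasFDerivAt.add_const _

lemma polytopeInt_subset : polytopeInt g c ⊆ polytope g c := fun _ hx f => (hx f).le

lemma isClosed_polytope : IsClosed (polytope g c) := by
  have : polytope g c = ⋂ f, aff g c f ⁻¹' Ici 0 := by ext x; simp [polytope]
  rw [this]
  exact isClosed_iInter fun f => isClosed_Ici.preimage (continuous_aff g c f)

lemma hasCompactSupport_mul_of_vanish {g : ι → E d} {c : ι → ℝ}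
    (hb : Bornology.IsBounded (polytope g c)) {ε : ℝ}
    (hε : 0 < ε) {w h : E d → ℝ} (hw0 : ∀ x f, aff g c f x < ε → w x = 0) :
    HasCompactSupport fun x => w x * h x := by
  refine HasCompactSupport.of_support_subset_isCompact
    (Metric.isCompact_of_isClosed_isBounded (isClosed_polytope g c) hb) fun x hx f => ?_
  by_contra hlt
  exact hx (by simp only [hw0 x f ((not_le.1 hlt).trans hε), zero_mul])

variable [Fintype ι]

lemma isOpen_polytopeInt : IsOpen (polytopeInt g c) := by
  have : polytopeInt g c = ⋂ f, aff g c f ⁻¹' Ioi 0 := by ext x; simp [polytopeInt]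
  rw [this]
  exact isOpen_iInter_of_finite fun f => isOpen_Ioi.preimage (continuous_aff g c f)

/-- A cutoff function for the polytope: it vanishes where some affine function is at most `ε`. -/
noncomputable def cutoff (ε : ℝ) (x : E d) : ℝ := ∏ f, step (aff g c f x / ε)

open scoped Classical in
/-- The part of the gradient of the cutoff function, up to the factor `ε⁻¹`, which is concentrated
along the facet `f`. -/
noncomputable def layer (ε : ℝ) (f : ι) (x : E d) : ℝ :=
  deriv step (aff g c f x / ε) * ∏ f' ∈ Finset.univ.erase f, step (aff g c f' x / ε)

variable {g c}

lemma cutoff_eq_zero {ε : ℝ} (hε : 0 < ε) {x : E d} {f : ι} (h : aff g c f x < ε) :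
    cutoff g c ε x = 0 :=
  Finset.prod_eq_zero (Finset.mem_univ f) (step_of_le ((div_le_one hε).2 h.le))

lemma layer_eq_zero {ε : ℝ} (hε : 0 < ε) {x : E d} (f : ι) {f' : ι} (h : aff g c f' x < ε) :
    layer g c ε f x = 0 := by
  classical
  have h1 : aff g c f' x / ε < 1 := (div_lt_one hε).2 h
  by_cases hf : f' = f
  · subst hf
    simp [layer, deriv_step_of_lt h1]
  · unfold layer
    rw [Finset.prod_eq_zero (Finset.mem_erase.2 ⟨hf, Finset.mem_univ f'⟩) (step_of_le h1.le),
      mul_zero]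

lemma abs_cutoff_le (ε : ℝ) (x : E d) : |cutoff g c ε x| ≤ 1 := by
  unfold cutoff
  rw [Finset.abs_prod]
  exact Finset.prod_le_one (fun _ _ => abs_nonneg _) fun _ _ => abs_step_le _

lemma abs_layer_le (ε : ℝ) (f : ι) (x : E d) :
    |layer g c ε f x| ≤ |deriv step (aff g c f x / ε)| := by
  unfold layer
  rw [abs_mul, Finset.abs_prod]
  exact mul_le_of_le_one_right (abs_nonneg _)
    (Finset.prod_le_one (fun _ _ => abs_nonneg _) fun _ _ => abs_step_le _)

lemma contDiff_cutoff (ε : ℝ) : ContDiff ℝ 1 (cutoff g c ε) := by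
  unfold cutoff
  refine contDiff_prod fun f _ => contDiff_step.comp ?_
  exact ((contDiff_const.inner ℝ contDiff_id).add contDiff_const).div_const _

lemma continuous_layer (ε : ℝ) (f : ι) : Continuous (layer g c ε f) := by
  unfold layer
  refine (continuous_deriv_step.comp ((continuous_aff g c f).div_const ε)).mul ?_
  exact continuous_finsetProd _ fun f' _ =>
    contDiff_step.continuous.comp ((continuous_aff g c f').div_const ε)

lemma hasFDerivAt_cutoff (ε : ℝ) (x : E d) :
    HasFDerivAt (cutoff g c ε) (∑ f, (ε⁻¹ * layer g c ε f x) • innerSL ℝ (g f)) x := by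
  classical
  have h : ∀ f ∈ (Finset.univ : Finset ι), HasFDerivAt (fun y => step (aff g c f y / ε))
      ((deriv step (aff g c f x / ε) * ε⁻¹) • innerSL ℝ (g f)) x := by
    intro f _
    have h1 : HasFDerivAt (fun y => aff g c f y / ε) (ε⁻¹ • innerSL ℝ (g f)) x := by
      simpa [div_eq_mul_inv] using (hasFDerivAt_aff g c f x).mul_const ε⁻¹
    rw [← smul_smul]
    exact (hasDerivAt_step _).comp_hasFDerivAt x h1
  have h2 := HasFDerivAt.finsetProd h
  unfold cutoff
  convert! h2 using 1
  refine Finset.sum_congr rfl fun f _ => ?_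
  rw [smul_smul]
  congr 1
  unfold layer
  ring

/-- Multiplying by a function that vanishes near the boundary extends continuity from the
interior of the polytope to the whole space. -/
lemma continuous_mul_of_vanish {ε : ℝ} (hε : 0 < ε) {w h : E d → ℝ} (hw : Continuous w)
    (hw0 : ∀ x f, aff g c f x < ε → w x = 0) (hh : ContinuousOn h (polytopeInt g c)) :
    Continuous fun x => w x * h x := by
  rw [continuous_iff_continuousAt]
  intro x
  by_cases hx : x ∈ polytopeInt g c
  · exact hw.continuousAt.mul (hh.continuousAt ((isOpen_polytopeInt g c).mem_nhds hx))
  · obtain ⟨f, hf⟩ : ∃ f, aff g c f x ≤ 0 := by simpa [polytopeInt] using hx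
    have : (fun x => w x * h x) =ᶠ[𝓝 x] fun _ => 0 := by
      filter_upwards [(continuous_aff g c f).continuousAt.eventually_lt_const
        (hf.trans_lt hε)] with y hy
      rw [hw0 y f hy, zero_mul]
    exact this.continuousAt

/-- The divergence theorem for a field multiplied by the cutoff function. -/
lemma integral_cutoff_mul (hb : Bornology.IsBounded (polytope g c)) {G : E d → E d}
    (hG : ContDiffOn ℝ 1 G (polytopeInt g c)) {D : E d → ℝ}
    (hD : ContinuousOn D (polytopeInt g c)) (hdiv : ∀ x ∈ polytopeInt g c, divergence G x = D x)
    {ε : ℝ} (hε : 0 < ε) :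
    ∫ x, cutoff g c ε x * D x = - ∑ f, ∫ x, ε⁻¹ * (layer g c ε f x * ⟪g f, G x⟫) := by
  have hGi : ∀ f, ContinuousOn (fun x => ⟪g f, G x⟫) (polytopeInt g c) := fun f =>
    continuousOn_const.inner hG.continuousOn
  have hL : ∀ f, Integrable fun x => ε⁻¹ * (layer g c ε f x * ⟪g f, G x⟫) := fun f =>
    ((continuous_mul_of_vanish hε (continuous_layer ε f) (fun x f' h => layer_eq_zero hε f h)
      (hGi f)).integrable_of_hasCompactSupport (hasCompactSupport_mul_of_vanish hb hε
        (fun x f' h => layer_eq_zero hε f h))).const_mul _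
  have hC : Integrable fun x => cutoff g c ε x * D x :=
    (continuous_mul_of_vanish hε (contDiff_cutoff ε).continuous (fun x f h => cutoff_eq_zero hε h)
      hD).integrable_of_hasCompactSupport (hasCompactSupport_mul_of_vanish hb hε
        (fun x f h => cutoff_eq_zero hε h))
  have hcd : ContDiff ℝ 1 fun x => cutoff g c ε x • G x := by
    rw [contDiff_iff_contDiffAt]
    intro x
    by_cases hx : x ∈ polytopeInt g c
    · exact (contDiff_cutoff ε).contDiffAt.smul
        (hG.contDiffAt ((isOpen_polytopeInt g c).mem_nhds hx))
    · obtain ⟨f, hf⟩ : ∃ f, aff g c f x ≤ 0 := by simpa [polytopeInt] using hx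
      have : (fun x => cutoff g c ε x • G x) =ᶠ[𝓝 x] fun _ => 0 := by
        filter_upwards [(continuous_aff g c f).continuousAt.eventually_lt_const
          (hf.trans_lt hε)] with y hy
        rw [cutoff_eq_zero hε hy, zero_smul]
      exact contDiffAt_const.congr_of_eventuallyEq this
  have hcs : HasCompactSupport fun x => cutoff g c ε x • G x := by
    refine HasCompactSupport.of_support_subset_isCompact
      (Metric.isCompact_of_isClosed_isBounded (isClosed_polytope g c) hb) fun x hx f => ?_
    by_contra hlt
    exact hx (by simp only [cutoff_eq_zero hε ((not_le.1 hlt).trans hε), zero_smul])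
  have hpt : ∀ x, divergence (fun x => cutoff g c ε x • G x) x =
      cutoff g c ε x * D x + ∑ f, ε⁻¹ * (layer g c ε f x * ⟪g f, G x⟫) := by
    intro x
    by_cases hx : x ∈ polytopeInt g c
    · rw [divergence_smul (hasFDerivAt_cutoff ε x) ((hG.contDiffAt
        ((isOpen_polytopeInt g c).mem_nhds hx)).differentiableAt one_ne_zero), hdiv x hx]
      simp [mul_assoc]
    · obtain ⟨f, hf⟩ : ∃ f, aff g c f x ≤ 0 := by simpa [polytopeInt] using hx
      have : (fun x => cutoff g c ε x • G x) =ᶠ[𝓝 x] fun _ => 0 := by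
        filter_upwards [(continuous_aff g c f).continuousAt.eventually_lt_const
          (hf.trans_lt hε)] with y hy
        rw [cutoff_eq_zero hε hy, zero_smul]
      unfold divergence
      rw [this.fderiv_eq, cutoff_eq_zero hε (hf.trans_lt hε)]
      simp [layer_eq_zero hε _ (hf.trans_lt hε)]
  have h0 := integral_divergence_eq_zero hcd hcs
  simp_rw [hpt] at h0
  rw [integral_add hC (integrable_finsetSum _ fun f _ => hL f),
    integral_finsetSum _ fun f _ => hL f] at h0
  linarith

end Polytope

section Polytope

variable {ι : Type*}

/-- Orthogonal coordinates on the hyperplane on which an affine function vanishes. -/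
lemma exists_facet_coords {k : ℕ} (g : ι → E (k + 1)) (c : ι → ℝ) (f : ι) (hg : g f ≠ 0) :
    ∃ (p n : E (k + 1)) (U : E k →ₗᵢ[ℝ] E (k + 1)),
      MeasurePreserving (fun q : ℝ × E k => p + q.1 • n + U q.2) ∧
      (∀ s y, aff g c f (p + s • n + U y) = ‖g f‖ * s) ∧
      ∀ x, aff g c f x = 0 → ∃ y, p + U y = x := by
  have hpos : ‖g f‖ ≠ 0 := norm_ne_zero_iff.2 hg
  set n : E (k + 1) := ‖g f‖⁻¹ • g f with hn
  set p : E (k + 1) := -(c f * ‖g f‖⁻¹ ^ 2) • g f with hp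
  have hn1 : ‖n‖ = 1 := by rw [hn, norm_smul, norm_inv, norm_norm, inv_mul_cancel₀ hpos]
  have hgn : ∀ x, ⟪g f, x⟫ = ‖g f‖ * ⟪n, x⟫ := fun x => by
    rw [hn, real_inner_smul_left]; field_simp
  have hp0 : ⟪g f, p⟫ = - c f := by
    rw [hp, real_inner_smul_right, real_inner_self_eq_norm_sq]; field_simp
  obtain ⟨U, hU, hU', hT⟩ := exists_hyperplane_coords n hn1 p
  refine ⟨p, n, U, hT, fun s y => ?_, fun x hx => ?_⟩
  · have : ⟪n, n⟫ = (1 : ℝ) := by rw [real_inner_self_eq_norm_sq, hn1]; norm_num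
    rw [aff, inner_add_right, inner_add_right, hp0, hgn, hgn, hU, inner_smul_right, this]
    ring
  · obtain ⟨y, hy⟩ := hU' (x - p) (by
      have h := hgn (x - p)
      rw [inner_sub_right, hp0] at h
      have h2 : ⟪g f, x⟫ = - c f := by unfold aff at hx; linarith
      rw [h2] at h
      have : ‖g f‖ * ⟪n, x - p⟫ = 0 := by linarith
      exact (mul_eq_zero.1 this).resolve_left hpos)
    exact ⟨y, by rw [hy]; abel⟩

lemma isometry_const_add {V W : Type*} [NormedAddCommGroup V] [NormedSpace ℝ V]
    [NormedAddCommGroup W] [NormedSpace ℝ W] (p : W) (U : V →ₗᵢ[ℝ] W) :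
    Isometry fun y => p + U y :=
  (IsometryEquiv.addLeft p).isometry.comp U.isometry

/-- Scaling of the first coordinate in an integral over `ℝ × E k`. -/
lemma integral_scale_fst {k : ℕ} {Φ : ℝ × E k → ℝ} (hΦ : Continuous Φ) {ε : ℝ} (hε : 0 < ε) :
    ∫ q : ℝ × E k, Φ (ε * q.1, q.2) = ε⁻¹ * ∫ q, Φ q := by
  have hS : Measurable (Prod.map (fun s : ℝ => ε * s) (id : E k → E k)) := by fun_prop
  have h1 : Measure.map (Prod.map (fun s : ℝ => ε * s) (id : E k → E k)) volume
      = ENNReal.ofReal |ε⁻¹| • volume := by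
    rw [Measure.volume_eq_prod, ← Measure.map_prod_map _ _ (by fun_prop) (by fun_prop),
      Real.map_volume_mul_left hε.ne', Measure.map_id, Measure.prod_smul_left]
  have h2 := integral_map (μ := (volume : Measure (ℝ × E k))) hS.aemeasurable (f := Φ)
    hΦ.aestronglyMeasurable
  rw [h1, integral_smul_measure] at h2
  rw [abs_of_pos (inv_pos.2 hε), ENNReal.toReal_ofReal (inv_pos.2 hε).le] at h2
  rw [← smul_eq_mul, h2]
  rfl

variable [Fintype ι]

/-- As `ε → 0`, the layer of the facet `f`, scaled by `ε⁻¹`, converges to the surface measure of the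
facet up to the factor `‖g f‖⁻¹`. -/
lemma tendsto_integral_layer {k : ℕ} {g : ι → E (k + 1)} {c : ι → ℝ} {f : ι} (hg : g f ≠ 0)
    (hb : Bornology.IsBounded (polytope g c))
    (hdist : ∀ f', f' ≠ f → ∃ x, aff g c f x = 0 ∧ aff g c f' x ≠ 0)
    {h : E (k + 1) → ℝ} (hh : ContinuousOn h (polytope g c)) :
    Tendsto (fun ε => ∫ x, ε⁻¹ * (layer g c ε f x * h x)) (𝓝[>] 0)
      (𝓝 (‖g f‖⁻¹ * ∫ x in {x ∈ polytope g c | aff g c f x = 0}, h x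
        ∂(μHE[k] : Measure (E (k + 1))))) := by
  classical
  obtain ⟨p, n, U, hT, haff, hsurj⟩ := exists_facet_coords g c f hg
  have hgpos : 0 < ‖g f‖ := norm_pos_iff.2 hg
  have hV := isometry_const_add p U
  set F := {x ∈ polytope g c | aff g c f x = 0} with hF
  have hFr : F ⊆ range fun y => p + U y := fun x hx => hsurj x hx.2
  have hFclosed : IsClosed F := (isClosed_polytope g c).inter
    (isClosed_singleton.preimage (continuous_aff g c f) : IsClosed (aff g c f ⁻¹' {0}))
  have hVcont : Continuous fun y => p + U y := hV.continuous
  let T : ℝ → ℝ × E k → E (k + 1) := fun ε q => p + (ε * q.1) • n + U q.2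
  have hTcont : ∀ ε, Continuous (T ε) := fun ε => by
    have := U.continuous
    fun_prop
  -- the layer integral in coordinates rescaled by `ε` in the normal direction
  have hrescale : ∀ ε > 0, ∫ x, ε⁻¹ * (layer g c ε f x * h x) =
      ∫ q, layer g c ε f (T ε q) * h (T ε q) := by
    intro ε hε
    have hcont : Continuous fun x => layer g c ε f x * h x :=
      continuous_mul_of_vanish hε (continuous_layer ε f) (fun x f' h => layer_eq_zero hε f h)
        (hh.mono (polytopeInt_subset g c))
    have hT1 : Continuous fun q : ℝ × E k => p + q.1 • n + U q.2 := by
      have := U.continuous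
      fun_prop
    rw [integral_const_mul]
    conv_lhs => rw [← hT.map_eq]
    rw [integral_map hT.aemeasurable hcont.aestronglyMeasurable]
    exact (integral_scale_fst (hcont.comp hT1) hε).symm
  have hlim : (‖g f‖⁻¹ * ∫ x in F, h x ∂(μHE[k] : Measure (E (k + 1)))) =
      ∫ q : ℝ × E k, deriv step (‖g f‖ * q.1) *
        ((fun y => p + U y) ⁻¹' F).indicator (fun y => h (p + U y)) q.2 := by
    rw [setIntegral_hausdorff_eq hV hFr, Measure.volume_eq_prod,
      integral_prod_mul (fun s => deriv step (‖g f‖ * s))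
        (((fun y => p + U y) ⁻¹' F).indicator fun y => h (p + U y)),
      integral_deriv_step_mul hgpos, integral_indicator (hFclosed.preimage hVcont).measurableSet]
  rw [hlim]
  refine Tendsto.congr' (f₁ := fun ε => ∫ q, layer g c ε f (T ε q) * h (T ε q))
    (by filter_upwards [self_mem_nhdsWithin] with ε hε using (hrescale ε hε).symm) ?_
  obtain ⟨C, hC⟩ := exists_abs_deriv_step_le
  obtain ⟨Ch, hCh⟩ := (Metric.isCompact_of_isClosed_isBounded (isClosed_polytope g c)
    hb).exists_bound_of_continuousOn hh
  -- the coordinates of all points that matter lie in a fixed bounded set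
  obtain ⟨R, hR⟩ : ∃ R, ∀ x ∈ polytope g c, ‖x‖ ≤ R := hb.exists_norm_le
  set R' := R + ‖p‖ + 2 / ‖g f‖ * ‖n‖ with hR'
  set B : Set (ℝ × E k) := Icc 0 (2 / ‖g f‖) ×ˢ Metric.closedBall 0 R' with hB
  have hBfin : volume B ≠ ⊤ := (isCompact_Icc.prod (isCompact_closedBall _ _)).measure_ne_top
  have hBmeas : MeasurableSet B := measurableSet_Icc.prod Metric.isClosed_closedBall.measurableSet
  refine tendsto_integral_filter_of_dominated_convergence (B.indicator fun _ => C * max Ch 0) ?_ ?_ ?_ ?_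
  · filter_upwards [self_mem_nhdsWithin] with ε hε
    exact ((continuous_mul_of_vanish hε (continuous_layer ε f)
      (fun x f' h => layer_eq_zero hε f h) (hh.mono (polytopeInt_subset g c))).comp
      (hTcont ε)).aestronglyMeasurable
  · filter_upwards [Ioo_mem_nhdsGT (zero_lt_one' ℝ)] with ε hε
    refine Eventually.of_forall fun q => ?_
    by_cases hl : layer g c ε f (T ε q) = 0
    · rw [hl, zero_mul, norm_zero]
      refine indicator_nonneg (fun x _ => ?_) _
      exact mul_nonneg ((abs_nonneg _).trans (hC 0)) (le_max_right _ _)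
    · have hK : T ε q ∈ polytope g c := fun f' => by
        by_contra hlt
        exact hl (layer_eq_zero hε.1 f ((not_le.1 hlt).trans hε.1))
      have hdf : deriv step (‖g f‖ * q.1) ≠ 0 := by
        intro h0
        apply hl
        have : aff g c f (T ε q) / ε = ‖g f‖ * q.1 := by
          rw [haff]; have := hε.1.ne'; field_simp
        rw [layer, this, h0, zero_mul]
      have hq1 : 1 ≤ ‖g f‖ * q.1 := by
        by_contra hlt; exact hdf (deriv_step_of_lt (not_le.1 hlt))
      have hq2 : ‖g f‖ * q.1 ≤ 2 := by
        by_contra hlt; exact hdf (deriv_step_of_gt (not_le.1 hlt))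
      have hq0 : 0 ≤ q.1 := by
        by_contra hlt
        have := mul_neg_of_pos_of_neg hgpos (not_le.1 hlt)
        linarith
      have hq3 : q.1 ≤ 2 / ‖g f‖ := by rw [le_div_iff₀ hgpos]; linarith
      have hqB : q ∈ B := by
        refine ⟨⟨hq0, hq3⟩, ?_⟩
        rw [mem_closedBall_zero_iff, ← U.norm_map]
        have : U q.2 = T ε q - p - (ε * q.1) • n := by simp only [T]; abel
        rw [this]
        refine (norm_sub_le _ _).trans ?_
        have h1 : ‖(ε * q.1) • n‖ ≤ 2 / ‖g f‖ * ‖n‖ := by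
          rw [norm_smul, Real.norm_of_nonneg (mul_nonneg hε.1.le hq0)]
          gcongr
          calc ε * q.1 ≤ 1 * q.1 := by gcongr; exact hε.2.le
            _ ≤ _ := by linarith
        have h2 := (norm_sub_le (T ε q) p).trans (add_le_add_left (hR _ hK) _)
        linarith
      rw [indicator_of_mem hqB, norm_mul]
      have h1 : ‖layer g c ε f (T ε q)‖ ≤ C := (abs_layer_le ε f _).trans (hC _)
      exact mul_le_mul h1 ((hCh _ hK).trans (le_max_left _ _)) (norm_nonneg _) ((norm_nonneg _).trans h1)
  · exact (integrable_indicator_iff hBmeas).2 (integrableOn_const hBfin)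
  · -- almost every point of the hyperplane lies on no other facet hyperplane
    have hae : ∀ᵐ y : E k, ∀ f', f' ≠ f → aff g c f' (p + U y) ≠ 0 := by
      rw [ae_all_iff]
      intro f'
      by_cases hff : f' = f
      · simp [hff]
      · obtain ⟨x, hx, hx'⟩ := hdist f' hff
        obtain ⟨y, rfl⟩ := hsurj x hx
        have hEq : ∀ y, aff g c f' (p + U y) =
            ⟪(U.toContinuousLinearMap).adjoint (g f'), y⟫ + aff g c f' p := fun y => by
          rw [ContinuousLinearMap.adjoint_inner_left]
          simp only [aff, inner_add_right, LinearIsometry.coe_toContinuousLinearMap]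
          ring
        have := volume_affine_zero ((U.toContinuousLinearMap).adjoint (g f')) (aff g c f' p)
          ⟨y, by rwa [← hEq]⟩
        rw [ae_iff]
        simpa [hff, hEq] using this
    have hae' : ∀ᵐ q : ℝ × E k, ∀ f', f' ≠ f → aff g c f' (p + U q.2) ≠ 0 :=
      (Measure.quasiMeasurePreserving_snd (μ := (volume : Measure ℝ))
        (ν := (volume : Measure (E k)))).ae hae
    filter_upwards [hae'] with q hq
    have hT0 : Tendsto (fun ε => T ε q) (𝓝[>] 0) (𝓝 (p + U q.2)) := by
      have : Continuous fun ε => T ε q := by fun_prop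
      simpa [T] using (this.tendsto 0).mono_left nhdsWithin_le_nhds
    have hafft : ∀ f', Tendsto (fun ε => aff g c f' (T ε q)) (𝓝[>] 0)
        (𝓝 (aff g c f' (p + U q.2))) := fun f' =>
      ((continuous_aff g c f').tendsto _).comp hT0
    have hrat : ∀ ε > 0, aff g c f (T ε q) / ε = ‖g f‖ * q.1 := fun ε hε => by
      rw [haff]; field_simp
    by_cases hd0 : deriv step (‖g f‖ * q.1) = 0
    · rw [hd0, zero_mul]
      refine Tendsto.congr' ?_ tendsto_const_nhds
      filter_upwards [self_mem_nhdsWithin] with ε hε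
      rw [layer, hrat ε hε, hd0, zero_mul, zero_mul]
    have hq0 : 0 ≤ q.1 := by
      by_contra hlt
      have := mul_neg_of_pos_of_neg hgpos (not_le.1 hlt)
      exact hd0 (deriv_step_of_lt (by linarith))
    have h0 : aff g c f (p + U q.2) = 0 := by simpa using haff 0 q.2
    by_cases hneg : ∃ f', f' ≠ f ∧ aff g c f' (p + U q.2) < 0
    · obtain ⟨f', hf', hlt⟩ := hneg
      rw [indicator_of_notMem (fun hm => absurd (hm.1 f') (not_le.2 hlt)), mul_zero]
      refine Tendsto.congr' ?_ tendsto_const_nhds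
      filter_upwards [self_mem_nhdsWithin, (hafft f').eventually_lt_const hlt] with ε hε hε'
      rw [layer_eq_zero hε f (hε'.trans hε), zero_mul]
    · push Not at hneg
      have hposi : ∀ f', f' ≠ f → 0 < aff g c f' (p + U q.2) := fun f' hf' =>
        lt_of_le_of_ne (hneg f' hf') (hq f' hf').symm
      have hmem : p + U q.2 ∈ F := ⟨fun f' => by
        by_cases hf' : f' = f
        · rw [hf', h0]
        · exact (hposi f' hf').le, h0⟩
      have hm2 : q.2 ∈ (fun y => p + U y) ⁻¹' F := hmem
      rw [indicator_of_mem hm2]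
      have hev : ∀ᶠ ε in 𝓝[>] (0 : ℝ), ∀ f', f' ≠ f → 2 ≤ aff g c f' (T ε q) / ε := by
        rw [eventually_all]
        intro f'
        by_cases hf' : f' = f
        · simp [hf']
        · have h1 := (hafft f').eventually_const_lt (half_lt_self (hposi f' hf'))
          have h2 : ∀ᶠ ε in 𝓝[>] (0 : ℝ), ε < aff g c f' (p + U q.2) / 4 :=
            (eventually_lt_nhds (by linarith [hposi f' hf'])).filter_mono nhdsWithin_le_nhds
          filter_upwards [h1, h2, self_mem_nhdsWithin] with ε h1 h2 hε _
          rw [le_div_iff₀ hε]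
          linarith
      have hK : ∀ᶠ ε in 𝓝[>] (0 : ℝ), T ε q ∈ polytope g c := by
        filter_upwards [hev, self_mem_nhdsWithin] with ε h1 hε f'
        by_cases hf' : f' = f
        · rw [hf', haff]
          exact mul_nonneg hgpos.le (mul_nonneg (le_of_lt hε) hq0)
        · have := h1 f' hf'
          rw [le_div_iff₀ hε] at this
          linarith [mem_Ioi.1 hε]
      have hht : Tendsto (fun ε => h (T ε q)) (𝓝[>] 0) (𝓝 (h (p + U q.2))) :=
        (hh _ hmem.1).tendsto.comp (tendsto_nhdsWithin_iff.2 ⟨hT0, hK⟩)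
      refine Tendsto.mul (Tendsto.congr' ?_ tendsto_const_nhds) hht
      filter_upwards [hev, self_mem_nhdsWithin] with ε h1 hε
      rw [layer, hrat ε hε, Finset.prod_eq_one fun f' hf' => step_of_ge (h1 f'
        (Finset.ne_of_mem_erase hf')), mul_one]

/-- The cutoff functions converge to the indicator function of the polytope, whose boundary is a
null set. -/
lemma tendsto_integral_cutoff {d : ℕ} {g : ι → E d} {c : ι → ℝ} (hg : ∀ f, g f ≠ 0)
    (hb : Bornology.IsBounded (polytope g c)) {D : E d → ℝ} (hD : ContinuousOn D (polytope g c)) :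
    Tendsto (fun ε => ∫ x, cutoff g c ε x * D x) (𝓝[>] 0) (𝓝 (∫ x in polytope g c, D x)) := by
  have hcomp := Metric.isCompact_of_isClosed_isBounded (isClosed_polytope g c) hb
  have hDi : IntegrableOn D (polytope g c) := hD.integrableOn_compact hcomp
  have hmeas := (isClosed_polytope g c).measurableSet
  rw [← integral_indicator hmeas]
  have hae : ∀ᵐ x : E d, ∀ f, aff g c f x ≠ 0 := by
    rw [ae_all_iff]
    intro f
    have hpos : ‖g f‖ ^ 2 ≠ 0 := pow_ne_zero _ (norm_ne_zero_iff.2 (hg f))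
    have := volume_affine_zero (g f) (c f) ⟨((1 - c f) * (‖g f‖ ^ 2)⁻¹) • g f, by
      rw [inner_smul_right, real_inner_self_eq_norm_sq, mul_assoc, inv_mul_cancel₀ hpos]; simp⟩
    rw [ae_iff]
    simpa [aff] using this
  refine tendsto_integral_filter_of_dominated_convergence
    ((polytope g c).indicator fun x => ‖D x‖) ?_ ?_ ?_ ?_
  · filter_upwards [self_mem_nhdsWithin] with ε hε
    exact (continuous_mul_of_vanish hε (contDiff_cutoff ε).continuous
      (fun x f h => cutoff_eq_zero hε h) (hD.mono (polytopeInt_subset g c))).aestronglyMeasurable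
  · filter_upwards [self_mem_nhdsWithin] with ε hε
    refine Eventually.of_forall fun x => ?_
    by_cases hx : x ∈ polytope g c
    · rw [indicator_of_mem hx, norm_mul]
      exact mul_le_of_le_one_left (norm_nonneg _) (abs_cutoff_le ε x)
    · obtain ⟨f, hf⟩ : ∃ f, aff g c f x < 0 := by simpa [polytope] using hx
      rw [indicator_of_notMem hx, cutoff_eq_zero hε (hf.trans hε), zero_mul, norm_zero]
  · exact (integrable_indicator_iff hmeas).2 hDi.norm
  · filter_upwards [hae] with x hx0
    by_cases hx : x ∈ polytope g c
    · rw [indicator_of_mem hx]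
      refine Tendsto.congr' ?_ tendsto_const_nhds
      have hev : ∀ᶠ ε in 𝓝[>] (0 : ℝ), ∀ f, 2 ≤ aff g c f x / ε := by
        rw [eventually_all]
        intro f
        have hp : 0 < aff g c f x := lt_of_le_of_ne (hx f) (hx0 f).symm
        have h2 : ∀ᶠ ε in 𝓝[>] (0 : ℝ), ε < aff g c f x / 2 :=
          (eventually_lt_nhds (by linarith)).filter_mono nhdsWithin_le_nhds
        filter_upwards [h2, self_mem_nhdsWithin] with ε h2 hε
        rw [le_div_iff₀ hε]
        linarith
      filter_upwards [hev] with ε h1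
      rw [cutoff, Finset.prod_eq_one fun f _ => step_of_ge (h1 f), one_mul]
    · obtain ⟨f, hf⟩ : ∃ f, aff g c f x < 0 := by simpa [polytope] using hx
      rw [indicator_of_notMem hx]
      refine Tendsto.congr' ?_ tendsto_const_nhds
      filter_upwards [self_mem_nhdsWithin] with ε hε
      rw [cutoff_eq_zero hε (hf.trans hε), zero_mul]

/-- The divergence theorem on a bounded polytope, for a field that is continuous up to the boundary
and `C¹` in the interior, with a divergence that extends continuously to the boundary. -/
theorem integral_divergence_polytope {d : ℕ} (hd : 0 < d) {g : ι → E d} {c : ι → ℝ}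
    (hg : ∀ f, g f ≠ 0) (hb : Bornology.IsBounded (polytope g c))
    (hdist : ∀ f f', f' ≠ f → ∃ x, aff g c f x = 0 ∧ aff g c f' x ≠ 0)
    {G : E d → E d} (hGc : ContinuousOn G (polytope g c)) (hG : ContDiffOn ℝ 1 G (polytopeInt g c))
    {D : E d → ℝ} (hD : ContinuousOn D (polytope g c))
    (hdiv : ∀ x ∈ polytopeInt g c, divergence G x = D x) :
    ∫ x in polytope g c, D x = - ∑ f, ‖g f‖⁻¹ * ∫ x in {x ∈ polytope g c | aff g c f x = 0},
      ⟪g f, G x⟫ ∂(μHE[d - 1] : Measure (E d)) := by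
  obtain ⟨k, rfl⟩ : ∃ k, d = k + 1 := ⟨d - 1, by omega⟩
  refine tendsto_nhds_unique (tendsto_integral_cutoff hg hb hD) ?_
  refine Tendsto.congr' (f₁ := fun ε => - ∑ f, ∫ x, ε⁻¹ * (layer g c ε f x * ⟪g f, G x⟫)) ?_ ?_
  · filter_upwards [self_mem_nhdsWithin] with ε hε
    exact (integral_cutoff_mul hb hG (hD.mono (polytopeInt_subset g c)) hdiv hε).symm
  · exact (tendsto_finsetSum _ fun f _ => tendsto_integral_layer (hg f) hb (hdist f)
      (continuousOn_const.inner hGc)).neg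

end Polytope

/-! ### Reference elements -/

namespace Shape

variable {d : ℕ} (s : Shape)

lemma refFct_affine (f : s.Fct d) : ∃ (γ : E d) (c : ℝ), ∀ x, s.refFct f x = ⟪γ, x⟫ + c := by
  match s, f with
  | .simplex, none =>
    exact ⟨-(WithLp.toLp 2 fun _ => 1), 1, fun x => by
      simp [refFct, PiLp.inner_apply, sub_eq_neg_add]⟩
  | .simplex, some j =>
    exact ⟨EuclideanSpace.single j 1, 0, fun x => by
      simp [refFct, EuclideanSpace.inner_single_left]⟩
  | .cube, (j, true) =>
    exact ⟨-EuclideanSpace.single j 1, 1, fun x => by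
      simp [refFct, sub_eq_neg_add, EuclideanSpace.inner_single_left]⟩
  | .cube, (j, false) =>
    exact ⟨EuclideanSpace.single j 1, 0, fun x => by
      simp [refFct, EuclideanSpace.inner_single_left]⟩

/-- Every facet of the reference element has a point that lies on no other facet. -/
lemma exists_relint (hd : 0 < d) (f : s.Fct d) :
    ∃ x : E d, s.refFct f x = 0 ∧ ∀ f', f' ≠ f → 0 < s.refFct f' x := by
  have hd' : (0 : ℝ) < d := by exact_mod_cast hd
  match s, f with
  | .simplex, none =>
    refine ⟨WithLp.toLp 2 fun _ => (d : ℝ)⁻¹, by simp [refFct, hd'.ne'], fun f' hf' => ?_⟩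
    match f' with
    | none => exact absurd rfl hf'
    | some j => simpa [refFct] using hd
  | .simplex, some j =>
    refine ⟨WithLp.toLp 2 fun i => if i = j then 0 else (d : ℝ)⁻¹, by simp [refFct],
      fun f' hf' => ?_⟩
    match f' with
    | none =>
      have h : ∑ i, (if i = j then 0 else (d : ℝ)⁻¹) < ∑ i : Fin d, (d : ℝ)⁻¹ := by
        refine Finset.sum_lt_sum (fun i _ => ?_) ⟨j, Finset.mem_univ j, ?_⟩
        · split_ifs
          · positivity
          · exact le_rfl
        · simpa using hd
      have h1 : ∑ i : Fin d, (d : ℝ)⁻¹ = 1 := by simp [hd'.ne']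
      simp only [refFct, Option.elim_none]
      linarith
    | some i =>
      have hij : i ≠ j := fun h => hf' (by rw [h])
      simpa [refFct, hij] using hd
  | .cube, (j, b) =>
    refine ⟨WithLp.toLp 2 fun i => if i = j then (if b then 1 else 0) else 1 / 2,
      by cases b <;> simp [refFct], fun f' hf' => ?_⟩
    obtain ⟨i, b'⟩ := f'
    by_cases hij : i = j
    · subst hij
      have hb : b' ≠ b := fun h => hf' (by rw [h])
      cases b <;> cases b' <;> simp_all [refFct]
    · cases b' <;> norm_num [refFct, hij]

lemma coord_mem_Icc {x : E d} (hx : x ∈ s.refElem d) (j : Fin d) : x j ∈ Icc (0 : ℝ) 1 := by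
  match s with
  | .simplex =>
    have h0 : ∀ i, 0 ≤ x i := fun i => hx (some i)
    have h1 : 0 ≤ 1 - ∑ i, x i := hx none
    exact ⟨h0 j, (Finset.single_le_sum (fun i _ => h0 i) (Finset.mem_univ j)).trans
      (by linarith)⟩
  | .cube =>
    have h0 : 0 ≤ x j := by simpa [refFct] using hx (j, false)
    have h1 : 0 ≤ 1 - x j := by simpa [refFct] using hx (j, true)
    exact ⟨h0, by linarith⟩

lemma isCompact_refElem : IsCompact (s.refElem d) := by
  refine Metric.isCompact_of_isClosed_isBounded ?_ ?_
  · have : s.refElem d = ⋂ f : s.Fct d, s.refFct f ⁻¹' Ici 0 := by ext x; simp [refElem]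
    rw [this]
    refine isClosed_iInter fun f => isClosed_Ici.preimage ?_
    obtain ⟨γ, c, h⟩ := s.refFct_affine f
    rw [show s.refFct f = fun x => ⟪γ, x⟫ + c from funext h]
    fun_prop
  · refine (Metric.isBounded_iff_subset_closedBall (0 : E d)).2 ⟨√d, fun x hx => ?_⟩
    rw [mem_closedBall_zero_iff, EuclideanSpace.norm_eq]
    refine Real.sqrt_le_sqrt ?_
    calc ∑ i, ‖x i‖ ^ 2 ≤ ∑ _i : Fin d, (1 : ℝ) := by
          refine Finset.sum_le_sum fun i _ => ?_
          have := s.coord_mem_Icc hx i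
          rw [Real.norm_of_nonneg this.1]
          exact pow_le_one₀ this.1 this.2
      _ = d := by simp

lemma refVtx_mem (v : s.Vtx d) : s.refVtx v ∈ s.refElem d := by
  intro f
  match s, v, f with
  | .simplex, none, none => simp [refFct, refVtx]
  | .simplex, none, some j => simp [refFct, refVtx]
  | .simplex, some i, none => simp [refFct, refVtx]
  | .simplex, some i, some j =>
    by_cases h : j = i <;> simp [refFct, refVtx, h]
  | .cube, σ, (j, b) =>
    cases b <;> cases h : σ j <;> simp [refFct, refVtx, h]

lemma refBasis_refVtx_self (v : s.Vtx d) : s.refBasis v (s.refVtx v) = 1 := by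
  match s, v with
  | .simplex, none => simp [refBasis, refVtx]
  | .simplex, some i => simp [refBasis, refVtx]
  | .cube, σ =>
    refine Finset.prod_eq_one fun j _ => ?_
    cases h : σ j <;> simp [refVtx, h]

lemma refBasis_refVtx_of_ne {v w : s.Vtx d} (h : v ≠ w) : s.refBasis v (s.refVtx w) = 0 := by
  match s, v, w with
  | .simplex, none, none => exact absurd rfl h
  | .simplex, none, some i => simp [refBasis, refVtx]
  | .simplex, some i, none => simp [refBasis, refVtx]
  | .simplex, some i, some j =>
    have : i ≠ j := fun e => h (by rw [e])
    simp [refBasis, refVtx, this]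
  | .cube, (σ : Fin d → Bool), (τ : Fin d → Bool) =>
    obtain ⟨j, hj⟩ := Function.ne_iff.1 h
    refine Finset.prod_eq_zero (Finset.mem_univ j) ?_
    cases h1 : σ j <;> cases h2 : τ j <;> simp_all [refVtx]

/-- The nodal basis is a partition of unity. -/
lemma sum_refBasis (x : E d) : ∑ v : s.Vtx d, s.refBasis v x = 1 := by
  match s with
  | .simplex =>
    change ∑ v : Option (Fin d), v.elim (1 - ∑ j, x j) (fun j => x j) = 1
    rw [Fintype.sum_option]
    simp
  | .cube =>
    change ∑ σ : Fin d → Bool, ∏ j, (if σ j then x j else 1 - x j) = 1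
    have := Finset.prod_univ_sum (fun _ : Fin d => (Finset.univ : Finset Bool))
      (fun j b => if b then x j else 1 - x j)
    rw [Fintype.piFinset_univ] at this
    rw [← this]
    simp

/-- A nodal basis function vanishes on the facets that do not contain its vertex. -/
lemma refBasis_eq_zero {f : s.Fct d} {v : s.Vtx d} {x : E d} (hv : s.refFct f (s.refVtx v) ≠ 0)
    (hx : s.refFct f x = 0) : s.refBasis v x = 0 := by
  match s, v, f with
  | .simplex, none, none => simpa [refBasis, refFct] using hx
  | .simplex, none, some j => simp [refFct, refVtx] at hv
  | .simplex, some i, none => simp [refFct, refVtx] at hv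
  | .simplex, some i, some j =>
    obtain rfl : j = i := by
      by_contra h
      simp [refFct, refVtx, h] at hv
    simpa [refBasis, refFct] using hx
  | .cube, σ, (j, b) =>
    refine Finset.prod_eq_zero (Finset.mem_univ j) ?_
    cases b <;> cases h : σ j <;> simp_all [refFct, refVtx]

lemma refBasis_nonneg {x : E d} (hx : x ∈ s.refElem d) (v : s.Vtx d) : 0 ≤ s.refBasis v x := by
  match s, v with
  | .simplex, v => exact hx v
  | .cube, σ =>
    refine Finset.prod_nonneg fun j _ => ?_
    have := Shape.cube.coord_mem_Icc hx j
    split_ifs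
    · exact this.1
    · linarith [this.2]

lemma refBasis_pos {x : E d} (hx : ∀ f : s.Fct d, 0 < s.refFct f x) (v : s.Vtx d) :
    0 < s.refBasis v x := by
  match s, v with
  | .simplex, v => exact hx v
  | .cube, σ =>
    refine Finset.prod_pos fun j _ => ?_
    split_ifs
    · simpa [refFct] using hx (j, false)
    · simpa [refFct] using hx (j, true)

lemma contDiff_refBasis (v : s.Vtx d) : ContDiff ℝ 1 (s.refBasis v) := by
  have hc : ∀ j : Fin d, ContDiff ℝ 1 fun x : E d => x j := fun j =>
    (EuclideanSpace.proj j : E d →L[ℝ] ℝ).contDiff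
  match s, v with
  | .simplex, none => exact contDiff_const.sub (ContDiff.sum fun j _ => hc j)
  | .simplex, some j => exact hc j
  | .cube, (σ : Fin d → Bool) =>
    refine contDiff_prod fun j _ => ?_
    by_cases h : σ j
    · simpa [h] using hc j
    · simpa [h] using contDiff_const.sub (hc j)

lemma exists_refFct_ne_zero (f : s.Fct d) : ∃ x : E d, s.refFct f x ≠ 0 := by
  match s, f with
  | .simplex, none => exact ⟨0, by simp [refFct]⟩
  | .simplex, some j => exact ⟨EuclideanSpace.single j 1, by simp [refFct]⟩
  | .cube, (j, true) => exact ⟨0, by simp [refFct]⟩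
  | .cube, (j, false) => exact ⟨EuclideanSpace.single j 1, by simp [refFct]⟩

lemma nonempty_fct (hd : 0 < d) : Nonempty (s.Fct d) := by
  match s with
  | .simplex => exact ⟨(none : Option (Fin d))⟩
  | .cube => exact ⟨((⟨0, hd⟩, true) : Fin d × Bool)⟩

end Shape

/-! ### The elements of a mesh as polytopes -/

namespace Mesh

variable {d : ℕ} {Ω : Set (E d)} (𝒯 : Mesh d Ω)

/-- The (constant) inward gradient of the affine function that defines the facet `p`. -/
noncomputable def grd (p : 𝒯.LFct) : E d :=
  gradient (fun x => 𝒯.shape.refFct p.2 ((𝒯.map p.1).symm x)) 0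

/-- The constant term of the affine function that defines the facet `p`. -/
noncomputable def cst (p : 𝒯.LFct) : ℝ := 𝒯.shape.refFct p.2 ((𝒯.map p.1).symm 0)

/-- The affine function that is nonnegative on the element and vanishes on the facet `p`. -/
noncomputable def fn (p : 𝒯.LFct) (x : E d) : ℝ := ⟪𝒯.grd p, x⟫ + 𝒯.cst p

/-- Pulled back to the element, the reference facet function is the affine function given by its
gradient and its value at the origin. -/
lemma refFct_symm (p : 𝒯.LFct) (x : E d) :
    𝒯.shape.refFct p.2 ((𝒯.map p.1).symm x) = 𝒯.fn p x := by
  obtain ⟨γ, c, h⟩ := 𝒯.shape.refFct_affine p.2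
  set L : E d →L[ℝ] ℝ := (innerSL ℝ γ).comp
    (LinearMap.toContinuousLinearMap ((𝒯.map p.1).symm.linear : E d →ₗ[ℝ] E d)) with hL
  have hA : ∀ y, 𝒯.shape.refFct p.2 ((𝒯.map p.1).symm y) = L y + 𝒯.cst p := by
    intro y
    have h1 : (𝒯.map p.1).symm y = (𝒯.map p.1).symm.linear y + (𝒯.map p.1).symm 0 := by
      simpa using (𝒯.map p.1).symm.map_vadd 0 y
    rw [cst, h, h, h1, inner_add_right, hL]
    simp [add_assoc]
  have hg : 𝒯.grd p = (InnerProductSpace.toDual ℝ (E d)).symm L := by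
    rw [grd, gradient, funext hA, fderiv_add_const, ContinuousLinearMap.fderiv]
  rw [hA, fn, hg, InnerProductSpace.toDual_symm_apply]

lemma normal_eq (p : 𝒯.LFct) : 𝒯.normal p = (-‖𝒯.grd p‖⁻¹) • 𝒯.grd p := rfl

lemma mem_elem {i : Fin 𝒯.n} {x : E d} : x ∈ 𝒯.elem i ↔ ∀ f, 0 ≤ 𝒯.fn (i, f) x := by
  simp only [← refFct_symm]
  constructor
  · rintro ⟨y, hy, rfl⟩ f
    simpa using hy f
  · intro h
    exact ⟨(𝒯.map i).symm x, h, by simp⟩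

lemma mem_fct {p : 𝒯.LFct} {x : E d} : x ∈ 𝒯.fct p ↔ x ∈ 𝒯.elem p.1 ∧ 𝒯.fn p x = 0 := by
  simp only [← refFct_symm]
  constructor
  · rintro ⟨y, ⟨hy, hy0⟩, rfl⟩
    exact ⟨⟨y, hy, rfl⟩, by simpa using hy0⟩
  · rintro ⟨⟨y, hy, rfl⟩, h⟩
    exact ⟨y, ⟨hy, by simpa using h⟩, rfl⟩

lemma elem_eq_polytope (i : Fin 𝒯.n) :
    𝒯.elem i = polytope (fun f => 𝒯.grd (i, f)) (fun f => 𝒯.cst (i, f)) := by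
  ext x; rw [mem_elem]; rfl

lemma isCompact_elem (i : Fin 𝒯.n) : IsCompact (𝒯.elem i) :=
  𝒯.shape.isCompact_refElem.image
    (AffineMap.continuous_of_finiteDimensional ((𝒯.map i : E d ≃ᵃ[ℝ] E d) : E d →ᵃ[ℝ] E d))

lemma continuous_fn (p : 𝒯.LFct) : Continuous (𝒯.fn p) := by unfold fn; fun_prop

lemma exists_relint (hd : 0 < d) (p : 𝒯.LFct) :
    ∃ x, 𝒯.fn p x = 0 ∧ ∀ f, f ≠ p.2 → 0 < 𝒯.fn (p.1, f) x := by
  obtain ⟨y, hy, hy'⟩ := 𝒯.shape.exists_relint hd p.2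
  refine ⟨𝒯.map p.1 y, by rw [← refFct_symm]; simpa using hy, fun f hf => ?_⟩
  rw [← refFct_symm]
  simpa using hy' f hf

lemma fn_add_smul (p : 𝒯.LFct) (x v : E d) (t : ℝ) :
    𝒯.fn p (x + t • v) = 𝒯.fn p x + t * ⟪𝒯.grd p, v⟫ := by
  rw [fn, fn, inner_add_right, inner_smul_right]; ring

end Mesh

/-! ### Facets in a conforming mesh -/

namespace Mesh

variable {d : ℕ} {Ω : Set (E d)} (𝒯 : Mesh d Ω)

lemma exists_fn_ne_zero (p : 𝒯.LFct) : ∃ x, 𝒯.fn p x ≠ 0 := by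
  obtain ⟨y, hy⟩ := 𝒯.shape.exists_refFct_ne_zero p.2
  exact ⟨𝒯.map p.1 y, by rw [← refFct_symm]; simpa using hy⟩

lemma fn_eq_add (p : 𝒯.LFct) (x y : E d) : 𝒯.fn p x = 𝒯.fn p y + ⟪𝒯.grd p, x - y⟫ := by
  rw [fn, fn, inner_sub_right]; ring

lemma grd_ne_zero (hd : 0 < d) (p : 𝒯.LFct) : 𝒯.grd p ≠ 0 := by
  intro h
  obtain ⟨x, hx, -⟩ := 𝒯.exists_relint hd p
  obtain ⟨y, hy⟩ := 𝒯.exists_fn_ne_zero p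
  rw [𝒯.fn_eq_add p y x, hx, h] at hy
  simp at hy

lemma inner_grd_self_pos (hd : 0 < d) (p : 𝒯.LFct) : 0 < ⟪𝒯.grd p, 𝒯.grd p⟫ :=
  real_inner_self_pos.2 (𝒯.grd_ne_zero hd p)

lemma elem_subset_closure (i : Fin 𝒯.n) : 𝒯.elem i ⊆ closure Ω := by
  rw [← 𝒯.cover]
  exact subset_iUnion (fun i => 𝒯.shape.elem (𝒯.map i)) i

/-- Points at which all facet functions of an element are positive lie in no other element. -/
lemma exists_fn_eq_zero_of_mem {i j : Fin 𝒯.n} (hij : i ≠ j) {x : E d} (hi : x ∈ 𝒯.elem i)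
    (hj : x ∈ 𝒯.elem j) : ∃ f, 𝒯.fn (i, f) x = 0 := by
  obtain ⟨S, S', ⟨f, hf⟩, -, h, -⟩ := 𝒯.conforming i j hij
  have hx : x ∈ ⋂ f ∈ S, 𝒯.shape.facet (𝒯.map i) f := by
    rw [← h]
    exact ⟨hi, hj⟩
  exact ⟨f, ((𝒯.mem_fct (p := (i, f))).1 (mem_iInter₂.1 hx f hf)).2⟩

lemma eventually_fn_pos {p : 𝒯.LFct} {x : E d} (hx : 0 < 𝒯.fn p x) :
    ∀ᶠ y in 𝓝 x, 0 < 𝒯.fn p y :=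
  (𝒯.continuous_fn p).continuousAt.eventually_const_lt hx

lemma eventually_other_pos {p : 𝒯.LFct} {x : E d} (hx : ∀ f, f ≠ p.2 → 0 < 𝒯.fn (p.1, f) x) :
    ∀ᶠ y in 𝓝 x, ∀ f, f ≠ p.2 → 0 < 𝒯.fn (p.1, f) y := by
  rw [eventually_all]
  intro f
  by_cases hf : f = p.2
  · simp [hf]
  · filter_upwards [𝒯.eventually_fn_pos (hx f hf)] with y hy _ using hy

lemma mem_elem_of_other_pos {p : 𝒯.LFct} {x : E d} (h0 : 0 ≤ 𝒯.fn p x)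
    (hx : ∀ f, f ≠ p.2 → 0 < 𝒯.fn (p.1, f) x) : x ∈ 𝒯.elem p.1 := by
  rw [mem_elem]
  intro f
  by_cases hf : f = p.2
  · subst hf; exact h0
  · exact (hx f hf).le

lemma tendsto_add_smul (x v : E d) : Tendsto (fun t : ℝ => x + t • v) (𝓝 0) (𝓝 x) := by
  have : Continuous fun t : ℝ => x + t • v := by fun_prop
  simpa using this.tendsto 0

/-- A facet determines its defining affine function up to a factor. -/
lemma fn_proportional (hd : 0 < d) {p p' : 𝒯.LFct} (h : 𝒯.fct p ⊆ 𝒯.fct p') :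
    ∃ c : ℝ, c ≠ 0 ∧ 𝒯.grd p' = c • 𝒯.grd p ∧ ∀ x, 𝒯.fn p' x = c * 𝒯.fn p x := by
  obtain ⟨x, hx0, hx⟩ := 𝒯.exists_relint hd p
  have hxp' : 𝒯.fn p' x = 0 :=
    ((𝒯.mem_fct).1 (h ((𝒯.mem_fct).2 ⟨𝒯.mem_elem_of_other_pos hx0.ge hx, hx0⟩))).2
  have horth : ∀ v, ⟪𝒯.grd p, v⟫ = 0 → ⟪𝒯.grd p', v⟫ = 0 := by
    intro v hv
    have hev : ∀ᶠ t in 𝓝[≠] (0 : ℝ), ∀ f, f ≠ p.2 → 0 < 𝒯.fn (p.1, f) (x + t • v) :=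
      ((tendsto_add_smul x v).eventually (𝒯.eventually_other_pos hx)).filter_mono
        nhdsWithin_le_nhds
    obtain ⟨t, ht, ht0⟩ := (hev.and self_mem_nhdsWithin).exists
    have h0 : 𝒯.fn p (x + t • v) = 0 := by rw [fn_add_smul, hx0, hv]; ring
    have h1 := ((𝒯.mem_fct).1 (h ((𝒯.mem_fct).2 ⟨𝒯.mem_elem_of_other_pos h0.ge ht, h0⟩))).2
    rw [fn_add_smul, hxp', zero_add] at h1
    exact (mul_eq_zero.1 h1).resolve_left ht0
  have hgg := 𝒯.inner_grd_self_pos hd p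
  set c := ⟪𝒯.grd p, 𝒯.grd p'⟫ / ⟪𝒯.grd p, 𝒯.grd p⟫ with hc
  set v := 𝒯.grd p' - c • 𝒯.grd p with hv
  have hgv : ⟪𝒯.grd p, v⟫ = 0 := by
    rw [hv, inner_sub_right, inner_smul_right, hc]; field_simp; ring
  have hv0 : v = 0 := by
    have h1 : ⟪v, v⟫ = 0 := by
      conv_lhs => rw [hv]
      rw [← hv, inner_sub_left, real_inner_smul_left, horth v hgv, hgv]; ring
    exact inner_self_eq_zero.1 h1
  have hgrd : 𝒯.grd p' = c • 𝒯.grd p := sub_eq_zero.1 hv0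
  refine ⟨c, fun h0 => 𝒯.grd_ne_zero hd p' (by rw [hgrd, h0, zero_smul]), hgrd, fun y => ?_⟩
  rw [𝒯.fn_eq_add p' y x, 𝒯.fn_eq_add p y x, hxp', hx0, hgrd, real_inner_smul_left]
  ring

/-- Different facets of an element are not contained in each other. -/
lemma fct_injective (hd : 0 < d) {i : Fin 𝒯.n} {f f' : 𝒯.shape.Fct d}
    (h : 𝒯.fct (i, f) ⊆ 𝒯.fct (i, f')) : f = f' := by
  by_contra hne
  obtain ⟨x, hx0, hx⟩ := 𝒯.exists_relint hd (i, f)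
  have h1 := ((𝒯.mem_fct).1 (h ((𝒯.mem_fct).2 ⟨𝒯.mem_elem_of_other_pos hx0.ge hx, hx0⟩))).2
  exact (hx f' (Ne.symm hne)).ne' h1

/-- A common facet of two elements has a point in the relative interior of the facet, as seen from
both elements. -/
lemma exists_common_relint (hd : 0 < d) {p p' : 𝒯.LFct} (h : 𝒯.fct p = 𝒯.fct p') :
    ∃ x, 𝒯.fn p x = 0 ∧ 𝒯.fn p' x = 0 ∧ (∀ f, f ≠ p.2 → 0 < 𝒯.fn (p.1, f) x) ∧
      ∀ f, f ≠ p'.2 → 0 < 𝒯.fn (p'.1, f) x := by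
  obtain ⟨x, hx0, hx⟩ := 𝒯.exists_relint hd p
  obtain ⟨y, hy0, hy⟩ := 𝒯.exists_relint hd p'
  have hxm : x ∈ 𝒯.fct p := (𝒯.mem_fct).2 ⟨𝒯.mem_elem_of_other_pos hx0.ge hx, hx0⟩
  have hym : y ∈ 𝒯.fct p' := (𝒯.mem_fct).2 ⟨𝒯.mem_elem_of_other_pos hy0.ge hy, hy0⟩
  have hxm' := h ▸ hxm
  have hym' := h ▸ hym
  have hmid : ∀ q, 𝒯.fn q (x + (1 / 2 : ℝ) • (y - x)) = (𝒯.fn q x + 𝒯.fn q y) / 2 := by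
    intro q
    rw [fn_add_smul, 𝒯.fn_eq_add q y x]; ring
  refine ⟨x + (1 / 2 : ℝ) • (y - x), ?_, ?_, fun f hf => ?_, fun f hf => ?_⟩
  · rw [hmid, hx0, ((𝒯.mem_fct).1 hym').2]; norm_num
  · rw [hmid, hy0, ((𝒯.mem_fct).1 hxm').2]; norm_num
  · rw [hmid]
    have := (𝒯.mem_elem).1 ((𝒯.mem_fct).1 hym').1 f
    linarith [hx f hf]
  · rw [hmid]
    have := (𝒯.mem_elem).1 ((𝒯.mem_fct).1 hxm').1 f
    linarith [hy f hf]

/-- Two elements that share a facet lie on opposite sides of it. -/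
lemma fn_opposite (hd : 0 < d) {p p' : 𝒯.LFct} (hne : p.1 ≠ p'.1) (h : 𝒯.fct p = 𝒯.fct p') :
    ∃ c : ℝ, c < 0 ∧ 𝒯.grd p' = c • 𝒯.grd p ∧ ∀ x, 𝒯.fn p' x = c * 𝒯.fn p x := by
  obtain ⟨c, hc0, hg, hc⟩ := 𝒯.fn_proportional hd h.subset
  refine ⟨c, ?_, hg, hc⟩
  by_contra hneg
  have hcpos : 0 < c := lt_of_le_of_ne (not_lt.1 hneg) hc0.symm
  obtain ⟨x, hx0, -, hx, hx'⟩ := 𝒯.exists_common_relint hd h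
  have hev : ∀ᶠ t in 𝓝[>] (0 : ℝ), (∀ f, f ≠ p.2 → 0 < 𝒯.fn (p.1, f) (x + t • 𝒯.grd p)) ∧
      ∀ f, f ≠ p'.2 → 0 < 𝒯.fn (p'.1, f) (x + t • 𝒯.grd p) :=
    ((tendsto_add_smul x _).eventually ((𝒯.eventually_other_pos hx).and
      (𝒯.eventually_other_pos hx'))).filter_mono nhdsWithin_le_nhds
  obtain ⟨t, ⟨ht, ht'⟩, ht0⟩ := (hev.and self_mem_nhdsWithin).exists
  have hpos : 0 < 𝒯.fn p (x + t • 𝒯.grd p) := by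
    rw [fn_add_smul, hx0, zero_add]
    exact mul_pos ht0 (𝒯.inner_grd_self_pos hd p)
  have hpos' : 0 < 𝒯.fn p' (x + t • 𝒯.grd p) := by
    rw [hc]; exact mul_pos hcpos hpos
  obtain ⟨f, hf⟩ := 𝒯.exists_fn_eq_zero_of_mem hne (𝒯.mem_elem_of_other_pos hpos.le ht)
    (𝒯.mem_elem_of_other_pos hpos'.le ht')
  by_cases hfp : f = p.2
  · subst hfp; exact hpos.ne' hf
  · exact (ht f hfp).ne' hf

lemma normal_opposite (hd : 0 < d) {p p' : 𝒯.LFct} (hne : p.1 ≠ p'.1)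
    (h : 𝒯.fct p = 𝒯.fct p') : 𝒯.normal p' = -𝒯.normal p := by
  obtain ⟨c, hc, hg, -⟩ := 𝒯.fn_opposite hd hne h
  rw [normal_eq, normal_eq, hg, norm_smul, Real.norm_of_nonpos hc.le, smul_smul, ← neg_smul]
  congr 1
  have : ‖𝒯.grd p‖ ≠ 0 := norm_ne_zero_iff.2 (𝒯.grd_ne_zero hd p)
  have := hc.ne
  field_simp

/-- A facet shared by two elements is not a boundary facet. -/
lemma not_subset_frontier_of_shared (hd : 0 < d) (hΩo : IsOpen Ω) (hΩr : interior (closure Ω) = Ω)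
    {p p' : 𝒯.LFct} (hne : p.1 ≠ p'.1) (h : 𝒯.fct p = 𝒯.fct p') : ¬ 𝒯.fct p ⊆ frontier Ω := by
  intro hsub
  obtain ⟨c, hc, -, hfn⟩ := 𝒯.fn_opposite hd hne h
  obtain ⟨x, hx0, -, hx, hx'⟩ := 𝒯.exists_common_relint hd h
  have hxm : x ∈ 𝒯.fct p := (𝒯.mem_fct).2 ⟨𝒯.mem_elem_of_other_pos hx0.ge hx, hx0⟩
  have hxΩ : x ∈ Ω := by
    rw [← hΩr, mem_interior_iff_mem_nhds]
    filter_upwards [𝒯.eventually_other_pos hx, 𝒯.eventually_other_pos hx'] with y hy hy'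
    rcases le_total 0 (𝒯.fn p y) with h0 | h0
    · exact 𝒯.elem_subset_closure _ (𝒯.mem_elem_of_other_pos h0 hy)
    · refine 𝒯.elem_subset_closure _ (𝒯.mem_elem_of_other_pos ?_ hy')
      rw [hfn]
      exact mul_nonneg_of_nonpos_of_nonpos hc.le h0
  have := hsub hxm
  rw [hΩo.frontier_eq] at this
  exact this.2 hxΩ

/-- If a relative interior point of a facet lies in another element, then conformity forces the
two elements to share the facet. -/
lemma exists_shared_of_relint_mem (hd : 0 < d) {p : 𝒯.LFct} {j : Fin 𝒯.n} (hj : p.1 ≠ j) {x : E d}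
    (hx0 : 𝒯.fn p x = 0) (hx : ∀ f, f ≠ p.2 → 0 < 𝒯.fn (p.1, f) x) (hxj : x ∈ 𝒯.elem j) :
    ∃ f, 𝒯.fct p = 𝒯.fct (j, f) := by
  obtain ⟨S, S', ⟨f, hf⟩, ⟨f', hf'⟩, h, h'⟩ := 𝒯.conforming p.1 j hj
  have hxi : x ∈ 𝒯.elem p.1 := 𝒯.mem_elem_of_other_pos hx0.ge hx
  have hS : ∀ f ∈ S, f = p.2 := by
    intro f hf
    have hx1 : x ∈ ⋂ f ∈ S, 𝒯.shape.facet (𝒯.map p.1) f := by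
      rw [← h]
      exact ⟨hxi, hxj⟩
    have hz := ((𝒯.mem_fct (p := (p.1, f))).1 (mem_iInter₂.1 hx1 f hf)).2
    by_contra hne
    exact (hx f hne).ne' hz
  obtain rfl : S = {p.2} := by
    ext a
    refine ⟨fun ha => hS a ha, fun ha => ?_⟩
    rw [mem_singleton_iff] at ha
    rw [ha, ← hS f hf]
    exact hf
  have hcap : 𝒯.elem p.1 ∩ 𝒯.elem j = 𝒯.fct p := by
    rw [biInter_singleton] at h
    exact h
  have hsub : ∀ f ∈ S', 𝒯.fct p ⊆ 𝒯.fct (j, f) := by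
    intro a ha y hy
    rw [← hcap] at hy
    have : y ∈ ⋂ f ∈ S', 𝒯.shape.facet (𝒯.map j) f := by
      rw [← h']
      exact hy
    exact mem_iInter₂.1 this a ha
  have hS' : ∀ a ∈ S', a = f' := by
    intro a ha
    obtain ⟨c, hc0, -, hc⟩ := 𝒯.fn_proportional hd (hsub f' hf')
    obtain ⟨c', -, -, hc'⟩ := 𝒯.fn_proportional hd (hsub a ha)
    obtain ⟨y, hy0, hy⟩ := 𝒯.exists_relint hd (j, f')
    by_contra hne
    have hpy : 𝒯.fn p y = 0 := by
      have := hc y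
      rw [hy0] at this
      exact (mul_eq_zero.1 this.symm).resolve_left hc0
    have h2 := hc' y
    rw [hpy, mul_zero] at h2
    exact (hy a hne).ne' h2
  obtain rfl : S' = {f'} := by
    ext a
    exact ⟨fun ha => hS' a ha, fun ha => by rw [mem_singleton_iff] at ha; rw [ha]; exact hf'⟩
  refine ⟨f', ?_⟩
  rw [← hcap]
  rw [biInter_singleton] at h'
  exact h'

/-- A facet that belongs to a single element is a boundary facet. -/
lemma subset_frontier_of_not_shared (hd : 0 < d) (hΩo : IsOpen Ω) {p : 𝒯.LFct}
    (h : ∀ p' : 𝒯.LFct, p.1 ≠ p'.1 → 𝒯.fct p ≠ 𝒯.fct p') : 𝒯.fct p ⊆ frontier Ω := by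
  -- relative interior points suffice, as they are dense in the facet
  have key : ∀ x, 𝒯.fn p x = 0 → (∀ f, f ≠ p.2 → 0 < 𝒯.fn (p.1, f) x) → x ∈ frontier Ω := by
    intro x hx0 hx
    rw [hΩo.frontier_eq]
    refine ⟨𝒯.elem_subset_closure _ (𝒯.mem_elem_of_other_pos hx0.ge hx), fun hxΩ => ?_⟩
    have hout : ∀ j, j ≠ p.1 → x ∉ 𝒯.elem j := fun j hj hxj => by
      obtain ⟨f, hf⟩ := 𝒯.exists_shared_of_relint_mem hd hj.symm hx0 hx hxj
      exact h (j, f) hj.symm hf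
    have hev : ∀ᶠ y in 𝓝 x, ∀ j, j ≠ p.1 → y ∉ 𝒯.elem j := by
      rw [eventually_all]
      intro j
      by_cases hj : j = p.1
      · simp [hj]
      · filter_upwards [(𝒯.isCompact_elem j).isClosed.isOpen_compl.mem_nhds (hout j hj)]
          with y hy _ using hy
    -- close to `x`, the domain is covered by the element of `p` alone
    have hev2 : ∀ᶠ y in 𝓝 x, y ∈ 𝒯.elem p.1 := by
      filter_upwards [hev, hΩo.mem_nhds hxΩ] with y hy hyΩ
      have hyc : y ∈ ⋃ i, 𝒯.shape.elem (𝒯.map i) := by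
        rw [𝒯.cover]
        exact subset_closure hyΩ
      obtain ⟨i, hi⟩ := mem_iUnion.1 hyc
      by_cases hip : i = p.1
      · exact hip ▸ hi
      · exact absurd hi (hy i hip)
    -- but moving from `x` against the inward gradient leaves this element
    have hev3 : ∀ᶠ t in 𝓝[<] (0 : ℝ), x + t • 𝒯.grd p ∈ 𝒯.elem p.1 :=
      ((tendsto_add_smul x _).eventually hev2).filter_mono nhdsWithin_le_nhds
    obtain ⟨t, ht, ht0⟩ := (hev3.and self_mem_nhdsWithin).exists
    have h1 := (𝒯.mem_elem).1 ht p.2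
    rw [fn_add_smul, hx0, zero_add] at h1
    exact absurd (mul_neg_of_neg_of_pos ht0 (𝒯.inner_grd_self_pos hd p)) (not_lt.2 h1)
  intro y hy
  obtain ⟨hy1, hy0⟩ := (𝒯.mem_fct).1 hy
  obtain ⟨x, hx0, hx⟩ := 𝒯.exists_relint hd p
  refine isClosed_frontier.mem_of_tendsto
    ((tendsto_add_smul y (x - y)).mono_left (nhdsWithin_le_nhds (s := Ioi 0))) ?_
  have hlin : ∀ q (t : ℝ), 𝒯.fn q (y + t • (x - y)) = (1 - t) * 𝒯.fn q y + t * 𝒯.fn q x := by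
    intro q t
    rw [fn_add_smul, 𝒯.fn_eq_add q x y]; ring
  filter_upwards [Ioo_mem_nhdsGT (zero_lt_one' ℝ)] with t ht
  refine key _ (by rw [hlin, hx0, hy0]; ring) fun f hf => ?_
  rw [hlin]
  exact add_pos_of_nonneg_of_pos (mul_nonneg (by linarith [ht.2]) ((𝒯.mem_elem).1 hy1 f))
    (mul_pos ht.1 (hx f hf))

/-- At most two elements share a facet. -/
lemma shared_unique (hd : 0 < d) {p p' p'' : 𝒯.LFct} (h' : p.1 ≠ p'.1) (h'' : p.1 ≠ p''.1)
    (e' : 𝒯.fct p = 𝒯.fct p') (e'' : 𝒯.fct p = 𝒯.fct p'') : p' = p'' := by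
  by_cases hne : p'.1 = p''.1
  · obtain ⟨i, f⟩ := p'
    obtain ⟨j, f'⟩ := p''
    obtain rfl : i = j := hne
    rw [𝒯.fct_injective hd (e'.symm.trans e'').subset]
  · obtain ⟨c1, hc1, -, h1⟩ := 𝒯.fn_opposite hd h' e'
    obtain ⟨c2, hc2, -, h2⟩ := 𝒯.fn_opposite hd h'' e''
    obtain ⟨c3, hc3, -, h3⟩ := 𝒯.fn_opposite hd hne (e'.symm.trans e'')
    obtain ⟨x, hx⟩ := 𝒯.exists_fn_ne_zero p
    have h4 := h3 x
    rw [h1, h2, ← mul_assoc] at h4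
    have := mul_right_cancel₀ hx h4
    have := mul_pos_of_neg_of_neg hc3 hc1
    linarith

open scoped Classical in
/-- Summing over all facets of all elements amounts to summing both sides of the interior facets
and the boundary facets. -/
lemma sum_lfct (hd : 0 < d) (hΩo : IsOpen Ω) (hΩr : interior (closure Ω) = Ω) (I : 𝒯.LFct → ℝ) :
    ∑ p, I p = ∑ F ∈ 𝒯.intFcts, (I F.1 + I F.2) + ∑ p ∈ 𝒯.bdryFcts, I p := by
  have h1 : ∀ p, I p = (if 𝒯.fct p ⊆ frontier Ω then I p else 0) +
      ∑ p', if p.1 ≠ p'.1 ∧ 𝒯.fct p = 𝒯.fct p' then I p else 0 := by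
    intro p
    by_cases hp : 𝒯.fct p ⊆ frontier Ω
    · rw [if_pos hp, Finset.sum_eq_zero, add_zero]
      intro p' _
      exact if_neg fun h => 𝒯.not_subset_frontier_of_shared hd hΩo hΩr h.1 h.2 hp
    · obtain ⟨p', hp'⟩ : ∃ p' : 𝒯.LFct, p.1 ≠ p'.1 ∧ 𝒯.fct p = 𝒯.fct p' := by
        by_contra hno
        push Not at hno
        exact hp (𝒯.subset_frontier_of_not_shared hd hΩo hno)
      rw [if_neg hp, zero_add, Finset.sum_eq_single p', if_pos hp']
      · intro q _ hq
        exact if_neg fun h => hq (𝒯.shared_unique hd h.1 hp'.1 h.2 hp'.2)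
      · simp
  have h2 : ∀ p p' : 𝒯.LFct, (if p.1 ≠ p'.1 ∧ 𝒯.fct p = 𝒯.fct p' then I p else 0) =
      (if p.1 < p'.1 ∧ 𝒯.fct p = 𝒯.fct p' then I p else 0) +
      (if p'.1 < p.1 ∧ 𝒯.fct p' = 𝒯.fct p then I p else 0) := by
    intro p p'
    rcases lt_trichotomy p.1 p'.1 with h | h | h
    · simp [h, h.ne, h.not_gt]
    · simp [h]
    · simp [h, h.ne', h.not_gt, eq_comm]
  have h3 : ∑ F ∈ 𝒯.intFcts, (I F.1 + I F.2) =
      ∑ p, ∑ p', ((if p.1 < p'.1 ∧ 𝒯.fct p = 𝒯.fct p' then I p else 0) +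
        (if p'.1 < p.1 ∧ 𝒯.fct p' = 𝒯.fct p then I p else 0)) := by
    simp_rw [Finset.sum_add_distrib]
    rw [Finset.sum_comm (f := fun p p' : 𝒯.LFct =>
      if p'.1 < p.1 ∧ 𝒯.fct p' = 𝒯.fct p then I p else 0)]
    simp only [intFcts, Finset.sum_filter, ← Finset.univ_product_univ, Finset.sum_product]
  rw [Finset.sum_congr rfl fun p _ => h1 p, Finset.sum_add_distrib, h3]
  simp_rw [h2]
  rw [add_comm, bdryFcts, Finset.sum_filter]

end Mesh

/-! ### Discrete functions on elements and facets -/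

namespace Mesh

variable {d : ℕ} {Ω : Set (E d)} (𝒯 : Mesh d Ω)

lemma contDiff_shapeFn (a : 𝒯.Node) : ContDiff ℝ 1 (𝒯.shapeFn a) := by
  refine (𝒯.shape.contDiff_refBasis a.2).comp ?_
  have h : ((𝒯.map a.1).symm : E d → E d) = fun x => LinearMap.toContinuousLinearMap
      ((𝒯.map a.1).symm.linear : E d →ₗ[ℝ] E d) x + (𝒯.map a.1).symm 0 :=
    funext fun x => by simpa using (𝒯.map a.1).symm.map_vadd 0 x
  rw [h]
  exact (ContinuousLinearMap.contDiff _).add contDiff_const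

lemma contDiff_onElem (v : 𝒯.V) (i : Fin 𝒯.n) : ContDiff ℝ 1 (𝒯.onElem v i) :=
  ContDiff.sum fun k _ => contDiff_const.mul (𝒯.contDiff_shapeFn (i, k))

lemma continuous_onElem (v : 𝒯.V) (i : Fin 𝒯.n) : Continuous (𝒯.onElem v i) :=
  (𝒯.contDiff_onElem v i).continuous

lemma continuous_gradOn (v : 𝒯.V) (i : Fin 𝒯.n) : Continuous (𝒯.gradOn v i) :=
  (InnerProductSpace.toDual ℝ (E d)).symm.continuous.comp
    ((𝒯.contDiff_onElem v i).continuous_fderiv one_ne_zero)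

lemma continuous_jump (v : 𝒯.V) (F : 𝒯.LFct × 𝒯.LFct) : Continuous (𝒯.jump v F) :=
  ((𝒯.continuous_onElem v _).smul continuous_const).add
    ((𝒯.continuous_onElem v _).smul continuous_const)

lemma continuous_mean (v : 𝒯.V) (F : 𝒯.LFct × 𝒯.LFct) : Continuous (𝒯.mean v F) :=
  continuous_const.mul ((𝒯.continuous_onElem v _).add (𝒯.continuous_onElem v _))

lemma continuous_meanGrad (v : 𝒯.V) (F : 𝒯.LFct × 𝒯.LFct) : Continuous (𝒯.meanGrad v F) :=
  ((𝒯.continuous_gradOn v F.1.1).add (𝒯.continuous_gradOn v F.2.1)).const_smul (1 / 2 : ℝ)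

lemma continuous_bjump (v : 𝒯.V) (p : 𝒯.LFct) : Continuous (𝒯.bjump v p) :=
  (𝒯.continuous_onElem v _).smul continuous_const

lemma isLinearMap_onElem (i : Fin 𝒯.n) (x : E d) : IsLinearMap ℝ fun v => 𝒯.onElem v i x where
  map_add u v := by simp [onElem, add_mul, Finset.sum_add_distrib]
  map_smul r v := by simp [onElem, mul_assoc, Finset.mul_sum]

lemma isLinearMap_gradOn (i : Fin 𝒯.n) (x : E d) : IsLinearMap ℝ fun v => 𝒯.gradOn v i x where
  map_add u v := by
    have hu := (𝒯.contDiff_onElem u i).differentiable one_ne_zero x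
    have hv := (𝒯.contDiff_onElem v i).differentiable one_ne_zero x
    have : 𝒯.onElem (u + v) i = fun x => 𝒯.onElem u i x + 𝒯.onElem v i x :=
      funext fun x => (𝒯.isLinearMap_onElem i x).map_add u v
    rw [gradOn, this, gradient, fderiv_fun_add hu hv, map_add]
    rfl
  map_smul r v := by
    have hv := (𝒯.contDiff_onElem v i).differentiable one_ne_zero x
    have : 𝒯.onElem (r • v) i = fun x => r * 𝒯.onElem v i x :=
      funext fun x => (𝒯.isLinearMap_onElem i x).map_smul r v
    rw [gradOn, this, gradient, fderiv_const_mul hv, map_smulₛₗ]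
    simp [gradOn, gradient]

lemma isLinearMap_jump (F : 𝒯.LFct × 𝒯.LFct) (x : E d) :
    IsLinearMap ℝ fun v => 𝒯.jump v F x where
  map_add u v := by
    simp only [jump, (𝒯.isLinearMap_onElem _ x).map_add]; module
  map_smul r v := by
    simp only [jump, (𝒯.isLinearMap_onElem _ x).map_smul, smul_eq_mul]; module

lemma isLinearMap_mean (F : 𝒯.LFct × 𝒯.LFct) (x : E d) :
    IsLinearMap ℝ fun v => 𝒯.mean v F x where
  map_add u v := by
    simp only [mean, (𝒯.isLinearMap_onElem _ x).map_add]; ring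
  map_smul r v := by
    simp only [mean, (𝒯.isLinearMap_onElem _ x).map_smul, smul_eq_mul]; ring

lemma isLinearMap_meanGrad (F : 𝒯.LFct × 𝒯.LFct) (x : E d) :
    IsLinearMap ℝ fun v => 𝒯.meanGrad v F x where
  map_add u v := by
    simp only [meanGrad, (𝒯.isLinearMap_gradOn _ x).map_add]; module
  map_smul r v := by
    simp only [meanGrad, (𝒯.isLinearMap_gradOn _ x).map_smul]; module

lemma isLinearMap_bjump (p : 𝒯.LFct) (x : E d) : IsLinearMap ℝ fun v => 𝒯.bjump v p x where
  map_add u v := by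
    simp only [bjump, (𝒯.isLinearMap_onElem _ x).map_add]; module
  map_smul r v := by
    simp only [bjump, (𝒯.isLinearMap_onElem _ x).map_smul, smul_eq_mul]; module

lemma isLinearMap_lift : IsLinearMap ℝ 𝒯.lift where
  map_add z w := by
    funext a
    by_cases h : 𝒯.pos a ∈ frontier Ω <;> simp [lift, h]
  map_smul r z := by
    funext a
    by_cases h : 𝒯.pos a ∈ frontier Ω <;> simp [lift, h]

lemma isCompact_fct (p : 𝒯.LFct) : IsCompact (𝒯.fct p) := by
  have : 𝒯.fct p = 𝒯.elem p.1 ∩ 𝒯.fn p ⁻¹' {0} := by ext x; rw [mem_fct]; rfl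
  rw [this]
  exact (𝒯.isCompact_elem p.1).inter_right (isClosed_singleton.preimage (𝒯.continuous_fn p))

lemma fct_subset_elem (p : 𝒯.LFct) : 𝒯.fct p ⊆ 𝒯.elem p.1 := fun _ hx => ((𝒯.mem_fct).1 hx).1

lemma fct_subset_closure (p : 𝒯.LFct) : 𝒯.fct p ⊆ closure Ω :=
  (𝒯.fct_subset_elem p).trans (𝒯.elem_subset_closure _)

lemma hausdorff_fct_lt_top (hd : 0 < d) (p : 𝒯.LFct) :
    (μHE[d - 1] : Measure (E d)) (𝒯.fct p) < ⊤ := by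
  obtain ⟨k, rfl⟩ : ∃ k, d = k + 1 := ⟨d - 1, by omega⟩
  obtain ⟨q, n, U, -, -, hU⟩ := exists_facet_coords (fun f => 𝒯.grd (p.1, f))
    (fun f => 𝒯.cst (p.1, f)) p.2 (𝒯.grd_ne_zero hd _)
  exact hausdorff_lt_top (isometry_const_add q U) (fun x hx => hU x ((𝒯.mem_fct).1 hx).2)
    (𝒯.isCompact_fct p).isBounded

lemma integrableOn_fct (hd : 0 < d) (p : 𝒯.LFct) {f : E d → ℝ} (hf : ContinuousOn f (𝒯.fct p)) :
    IntegrableOn f (𝒯.fct p) (μHE[d - 1] : Measure (E d)) := by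
  obtain ⟨C, hC⟩ := (𝒯.isCompact_fct p).exists_bound_of_continuousOn hf
  have hm := (𝒯.isCompact_fct p).isClosed.measurableSet
  have : IsFiniteMeasure ((μHE[d - 1] : Measure (E d)).restrict (𝒯.fct p)) :=
    isFiniteMeasure_restrict.2 (𝒯.hausdorff_fct_lt_top hd p).ne
  exact Integrable.of_bound (hf.aestronglyMeasurable hm) C ((ae_restrict_iff' hm).2 (Eventually.of_forall hC))

lemma fctInt_congr (p : 𝒯.LFct) {f g : E d → ℝ} (h : ∀ x ∈ 𝒯.fct p, f x = g x) :
    𝒯.fctInt p f = 𝒯.fctInt p g :=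
  setIntegral_congr_fun (𝒯.isCompact_fct p).isClosed.measurableSet h

lemma fctInt_add (hd : 0 < d) (p : 𝒯.LFct) {f g : E d → ℝ} (hf : ContinuousOn f (𝒯.fct p))
    (hg : ContinuousOn g (𝒯.fct p)) :
    𝒯.fctInt p (fun x => f x + g x) = 𝒯.fctInt p f + 𝒯.fctInt p g :=
  integral_add (𝒯.integrableOn_fct hd p hf) (𝒯.integrableOn_fct hd p hg)

end Mesh

/-! ### Linearity of the forms -/

lemma isLinearMap_add {W : Type*} [AddCommGroup W] [Module ℝ W] {f g : W → ℝ}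
    (hf : IsLinearMap ℝ f) (hg : IsLinearMap ℝ g) : IsLinearMap ℝ fun u => f u + g u where
  map_add u v := by rw [hf.map_add, hg.map_add]; ring
  map_smul r v := by simp only [hf.map_smul, hg.map_smul, smul_eq_mul]; ring

lemma isLinearMap_neg {W : Type*} [AddCommGroup W] [Module ℝ W] {f : W → ℝ}
    (hf : IsLinearMap ℝ f) : IsLinearMap ℝ fun u => -f u where
  map_add u v := by rw [hf.map_add]; ring
  map_smul r v := by simp only [hf.map_smul, smul_eq_mul]; ring

lemma isLinearMap_finsetSum {W κ : Type*} [AddCommGroup W] [Module ℝ W] (s : Finset κ)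
    {f : κ → W → ℝ} (hf : ∀ i ∈ s, IsLinearMap ℝ (f i)) :
    IsLinearMap ℝ fun u => ∑ i ∈ s, f i u where
  map_add u v := by
    rw [← Finset.sum_add_distrib]
    exact Finset.sum_congr rfl fun i hi => (hf i hi).map_add u v
  map_smul r v := by
    rw [Finset.smul_sum]
    exact Finset.sum_congr rfl fun i hi => (hf i hi).map_smul r v

lemma isLinearMap_integral {W X : Type*} [AddCommGroup W] [Module ℝ W] [MeasurableSpace X]
    {m : Measure X} {Ψ : W → X → ℝ} (hΨ : ∀ x, IsLinearMap ℝ fun u => Ψ u x)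
    (hi : ∀ u, Integrable (Ψ u) m) : IsLinearMap ℝ fun u => ∫ x, Ψ u x ∂m where
  map_add u v := by
    rw [← integral_add (hi u) (hi v)]
    exact integral_congr_ae (Eventually.of_forall fun x => (hΨ x).map_add u v)
  map_smul r v := by
    rw [smul_eq_mul, ← integral_const_mul]
    exact integral_congr_ae (Eventually.of_forall fun x => (hΨ x).map_smul r v)

lemma isLinearMap_apply_eq_sum {κ : Type*} [Fintype κ] [DecidableEq κ] {f : (κ → ℝ) → ℝ}
    (hf : IsLinearMap ℝ f) (u : κ → ℝ) : f u = ∑ b, u b * f (Pi.single b 1) := by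
  have h := (hf.mk' f).pi_apply_eq_sum_univ u
  simp only [IsLinearMap.mk'_apply, smul_eq_mul] at h
  rw [h]
  refine Finset.sum_congr rfl fun b _ => ?_
  congr 2
  funext j
  simp [Pi.single_apply, eq_comm]

namespace Mesh

variable {d : ℕ} {Ω : Set (E d)} (𝒯 : Mesh d Ω)

lemma isLinearMap_fctInt {W : Type*} [AddCommGroup W] [Module ℝ W] (hd : 0 < d) (p : 𝒯.LFct)
    {Ψ : W → E d → ℝ} (hΨ : ∀ x, IsLinearMap ℝ fun u => Ψ u x)
    (hc : ∀ u, ContinuousOn (Ψ u) (𝒯.fct p)) : IsLinearMap ℝ fun u => 𝒯.fctInt p (Ψ u) :=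
  isLinearMap_integral hΨ fun u => 𝒯.integrableOn_fct hd p (hc u)

/-- The interior penalty form is linear in its first argument. -/
lemma isLinearMap_Kh (hd : 0 < d) (μ : ℝ) {β : E d → E d} (hβc : ContinuousOn β (closure Ω))
    (hF : Set (E d) → ℝ) (v : 𝒯.V) : IsLinearMap ℝ fun u => 𝒯.Kh μ β hF u v := by
  have hβe : ∀ i, ContinuousOn β (𝒯.elem i) := fun i => hβc.mono (𝒯.elem_subset_closure i)
  have hβf : ∀ p, ContinuousOn β (𝒯.fct p) := fun p => hβc.mono (𝒯.fct_subset_closure p)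
  have c1 := 𝒯.continuous_onElem
  have c2 := 𝒯.continuous_gradOn
  have c3 := 𝒯.continuous_jump
  have c4 := 𝒯.continuous_mean
  have c5 := 𝒯.continuous_meanGrad
  have c6 := 𝒯.continuous_bjump
  have l1 := 𝒯.isLinearMap_onElem
  have l2 := 𝒯.isLinearMap_gradOn
  have l3 := 𝒯.isLinearMap_jump
  have l4 := 𝒯.isLinearMap_mean
  have l5 := 𝒯.isLinearMap_meanGrad
  have l6 := 𝒯.isLinearMap_bjump
  unfold Kh
  refine isLinearMap_add (isLinearMap_add (isLinearMap_add (isLinearMap_add (isLinearMap_add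
    (isLinearMap_finsetSum _ fun i _ => ?_) (isLinearMap_finsetSum _ fun F _ => ?_))
    (isLinearMap_finsetSum _ fun p _ => ?_)) (isLinearMap_finsetSum _ fun F _ => ?_))
    (isLinearMap_finsetSum _ fun p _ => ?_)) (isLinearMap_finsetSum _ fun F _ => ?_)
  · refine isLinearMap_integral (fun x => ⟨fun u w => ?_, fun r u => ?_⟩) fun u => ?_
    · simp only [(l1 _ _).map_add, (l2 _ _).map_add, inner_add_left]; ring
    · simp only [(l1 _ _).map_smul, (l2 _ _).map_smul, real_inner_smul_left, smul_eq_mul]; ring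
    · have h1 := hβe i
      have h2 := c1 u i
      have h3 := c2 u i
      have h4 := c2 v i
      exact ContinuousOn.integrableOn_compact (𝒯.isCompact_elem i) (by fun_prop)
  · refine 𝒯.isLinearMap_fctInt hd F.1 (fun x => ⟨fun u w => ?_, fun r u => ?_⟩) fun u => ?_
    · simp only [(l3 _ _).map_add, (l5 _ _).map_add, inner_add_left]; ring
    · simp only [(l3 _ _).map_smul, (l5 _ _).map_smul, real_inner_smul_left, smul_eq_mul]; ring
    · have h1 := c3 u F
      have h2 := c3 v F
      have h3 := c5 u F
      have h4 := c5 v F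
      fun_prop
  · refine 𝒯.isLinearMap_fctInt hd p (fun x => ⟨fun u w => ?_, fun r u => ?_⟩) fun u => ?_
    · simp only [(l6 _ _).map_add, (l2 _ _).map_add, inner_add_left]; ring
    · simp only [(l6 _ _).map_smul, (l2 _ _).map_smul, real_inner_smul_left, smul_eq_mul]; ring
    · have h1 := c6 u p
      have h2 := c6 v p
      have h3 := c2 u p.1
      have h4 := c2 v p.1
      fun_prop
  · refine 𝒯.isLinearMap_fctInt hd F.1 (fun x => ⟨fun u w => ?_, fun r u => ?_⟩) fun u => ?_
    · simp only [(l4 _ _).map_add, real_inner_smul_left]; ring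
    · simp only [(l4 _ _).map_smul, real_inner_smul_left, smul_eq_mul]; ring
    · have h1 := c4 u F
      have h2 := c3 v F
      have h3 := hβf F.1
      fun_prop
  · refine 𝒯.isLinearMap_fctInt hd p (fun x => ⟨fun u w => ?_, fun r u => ?_⟩) fun u => ?_
    · simp only [(l1 _ _).map_add, real_inner_smul_left]; ring
    · simp only [(l1 _ _).map_smul, real_inner_smul_left, smul_eq_mul]; ring
    · have h1 := c1 u p.1
      have h2 := c6 v p
      have h3 := hβf p
      fun_prop
  · refine 𝒯.isLinearMap_fctInt hd F.1 (fun x => ⟨fun u w => ?_, fun r u => ?_⟩) fun u => ?_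
    · simp only [(l3 _ _).map_add, inner_add_left]; ring
    · simp only [(l3 _ _).map_smul, real_inner_smul_left, smul_eq_mul]; ring
    · have h1 := c3 u F
      have h2 := c3 v F
      have h3 := hβf F.1
      fun_prop

/-- The boundary form is linear in the boundary datum. -/
lemma isLinearMap_Bh (hd : 0 < d) (μ : ℝ) {β : E d → E d} (hβc : ContinuousOn β (closure Ω))
    (hF : Set (E d) → ℝ) (v : 𝒯.V) : IsLinearMap ℝ fun w => 𝒯.Bh μ β hF w v := by
  have hβf : ∀ p, ContinuousOn β (𝒯.fct p) := fun p => hβc.mono (𝒯.fct_subset_closure p)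
  have c1 := 𝒯.continuous_onElem
  have c2 := 𝒯.continuous_gradOn
  have l1 : ∀ i x, IsLinearMap ℝ fun w => 𝒯.onElem (𝒯.lift w) i x := fun i x =>
    ⟨fun w z => by rw [𝒯.isLinearMap_lift.map_add, (𝒯.isLinearMap_onElem i x).map_add],
      fun r w => by rw [𝒯.isLinearMap_lift.map_smul, (𝒯.isLinearMap_onElem i x).map_smul]⟩
  unfold Bh
  simp only [sub_eq_add_neg]
  refine isLinearMap_add (isLinearMap_add (isLinearMap_neg (isLinearMap_finsetSum _ fun p _ => ?_))
    (isLinearMap_neg (isLinearMap_finsetSum _ fun p _ => ?_)))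
    (isLinearMap_finsetSum _ fun p _ => ?_)
  all_goals
    refine 𝒯.isLinearMap_fctInt hd p (fun x => ⟨fun u w => ?_, fun r u => ?_⟩) fun u => ?_
    · simp only [(l1 _ _).map_add]; ring
    · simp only [(l1 _ _).map_smul, smul_eq_mul]; ring
    · have h1 := c1 (𝒯.lift u) p.1
      have h2 := c1 v p.1
      have h3 := c2 v p.1
      have h4 := hβf p
      fun_prop

end Mesh

/-! ### Consistency of the forms for constant functions -/

namespace Mesh

variable {d : ℕ} {Ω : Set (E d)} (𝒯 : Mesh d Ω)

/-- The divergence theorem on an element, for a divergence-free field multiplied by a discrete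
function. -/
lemma integral_elem_eq_sum_facets (hd : 0 < d) (hΩr : interior (closure Ω) = Ω) {β : E d → E d}
    (hβc : ContinuousOn β (closure Ω)) (hβ : ContDiffOn ℝ 1 β Ω)
    (hβdiv : ∀ x ∈ Ω, divergence β x = 0) (v : 𝒯.V) (i : Fin 𝒯.n) :
    ∫ x in 𝒯.elem i, ⟪β x, 𝒯.gradOn v i x⟫ =
      ∑ f, 𝒯.fctInt (i, f) fun x => ⟪β x, 𝒯.bjump v (i, f) x⟫ := by
  set g := fun f => 𝒯.grd (i, f) with hg
  set c := fun f => 𝒯.cst (i, f) with hc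
  have hK : 𝒯.elem i = polytope g c := 𝒯.elem_eq_polytope i
  have hb : Bornology.IsBounded (polytope g c) := hK ▸ (𝒯.isCompact_elem i).isBounded
  have hβe : ContinuousOn β (polytope g c) := hK ▸ hβc.mono (𝒯.elem_subset_closure i)
  have hint : polytopeInt g c ⊆ Ω := by
    have h1 : polytope g c ⊆ closure Ω := hK ▸ 𝒯.elem_subset_closure i
    exact (interior_maximal ((polytopeInt_subset g c).trans h1)
      (isOpen_polytopeInt g c)).trans hΩr.subset
  have hdist : ∀ f f', f' ≠ f → ∃ x, aff g c f x = 0 ∧ aff g c f' x ≠ 0 := by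
    intro f f' hf
    obtain ⟨x, hx0, hx⟩ := 𝒯.exists_relint hd (i, f)
    exact ⟨x, hx0, (hx f' hf).ne'⟩
  have hv := 𝒯.contDiff_onElem v i
  have h1 := 𝒯.continuous_onElem v i
  have h2 := 𝒯.continuous_gradOn v i
  have hdiv : ∀ x ∈ polytopeInt g c, divergence (fun x => 𝒯.onElem v i x • β x) x =
      ⟪β x, 𝒯.gradOn v i x⟫ := by
    intro x hx
    have hx' : polytopeInt g c ∈ 𝓝 x := (isOpen_polytopeInt g c).mem_nhds hx
    have hdβ : DifferentiableAt ℝ β x :=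
      ((hβ.mono hint).contDiffAt hx').differentiableAt one_ne_zero
    rw [divergence_smul (hv.differentiable one_ne_zero x).hasFDerivAt hdβ, hβdiv x (hint hx),
      mul_zero, zero_add, gradOn, gradient, real_inner_comm, InnerProductSpace.toDual_symm_apply]
  have key := integral_divergence_polytope hd (g := g) (c := c)
    (fun f => 𝒯.grd_ne_zero hd (i, f)) hb hdist (G := fun x => 𝒯.onElem v i x • β x)
    (by fun_prop) (hv.contDiffOn.smul (hβ.mono hint)) (D := fun x => ⟪β x, 𝒯.gradOn v i x⟫)
    (by fun_prop) hdiv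
  rw [hK, key, ← Finset.sum_neg_distrib]
  refine Finset.sum_congr rfl fun f _ => ?_
  have hF : {x ∈ polytope g c | aff g c f x = 0} = 𝒯.fct (i, f) := by
    ext x
    rw [mem_fct, hK]
    rfl
  rw [hF, fctInt, ← neg_mul, ← integral_const_mul]
  refine integral_congr_ae (Eventually.of_forall fun x => ?_)
  simp only [bjump, normal_eq, inner_smul_right, real_inner_comm (β x) (g f)]
  ring

lemma onElem_one (i : Fin 𝒯.n) (x : E d) : 𝒯.onElem (fun _ => 1) i x = 1 := by
  simp only [onElem, one_mul, shapeFn]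
  exact 𝒯.shape.sum_refBasis _

lemma gradOn_one (i : Fin 𝒯.n) (x : E d) : 𝒯.gradOn (fun _ => 1) i x = 0 := by
  have : 𝒯.onElem (fun _ => 1) i = fun _ => 1 := funext fun x => 𝒯.onElem_one i x
  rw [gradOn, this, gradient_fun_const]

lemma norm_normal (hd : 0 < d) (p : 𝒯.LFct) : ‖𝒯.normal p‖ = 1 := by
  have := norm_ne_zero_iff.2 (𝒯.grd_ne_zero hd p)
  rw [normal_eq, norm_smul, norm_neg, norm_inv, norm_norm, inv_mul_cancel₀ this]

lemma mem_intFcts {F : 𝒯.LFct × 𝒯.LFct} :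
    F ∈ 𝒯.intFcts ↔ F.1.1 < F.2.1 ∧ 𝒯.fct F.1 = 𝒯.fct F.2 := by
  simp [intFcts]

lemma mem_bdryFcts {p : 𝒯.LFct} : p ∈ 𝒯.bdryFcts ↔ 𝒯.fct p ⊆ frontier Ω := by
  simp [bdryFcts]

lemma jump_one (hd : 0 < d) {F : 𝒯.LFct × 𝒯.LFct} (hF : F ∈ 𝒯.intFcts) (x : E d) :
    𝒯.jump (fun _ => 1) F x = 0 := by
  obtain ⟨hlt, he⟩ := (𝒯.mem_intFcts).1 hF
  rw [jump, onElem_one, onElem_one, 𝒯.normal_opposite hd hlt.ne he]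
  simp

lemma pos_mem_elem (a : 𝒯.Node) : 𝒯.pos a ∈ 𝒯.elem a.1 :=
  ⟨_, 𝒯.shape.refVtx_mem a.2, rfl⟩

/-- A shape function vanishes on the facets of its element that do not contain its node. -/
lemma shapeFn_eq_zero {a : 𝒯.Node} {p : 𝒯.LFct} (hap : p.1 = a.1) (ha : 𝒯.pos a ∉ 𝒯.fct p)
    {x : E d} (hx : x ∈ 𝒯.fct p) : 𝒯.shapeFn a x = 0 := by
  obtain ⟨i, v⟩ := a
  obtain ⟨j, f⟩ := p
  obtain rfl : j = i := hap
  refine 𝒯.shape.refBasis_eq_zero (f := f) (fun h0 => ha ?_) ?_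
  · refine (𝒯.mem_fct).2 ⟨𝒯.pos_mem_elem (j, v), ?_⟩
    rw [← refFct_symm]
    simpa [pos] using h0
  · rw [𝒯.refFct_symm (j, f)]
    exact ((𝒯.mem_fct).1 hx).2

/-- The boundary datum `1` has the trace `1` on boundary facets. -/
lemma onElem_lift_one {p : 𝒯.LFct} (hp : p ∈ 𝒯.bdryFcts) {x : E d} (hx : x ∈ 𝒯.fct p) :
    𝒯.onElem (𝒯.lift fun _ => 1) p.1 x = 1 := by
  refine Eq.trans ?_ (𝒯.onElem_one p.1 x)
  refine Finset.sum_congr rfl fun k _ => ?_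
  by_cases h : 𝒯.pos (p.1, k) ∈ frontier Ω
  · simp [lift, h]
  · rw [𝒯.shapeFn_eq_zero (p := p) rfl (fun hm => h ((𝒯.mem_bdryFcts).1 hp hm)) hx]
    simp

/-- For the constant function `1`, the interior penalty form and the boundary form agree. -/
lemma Kh_one_eq_Bh_one (hd : 0 < d) (hΩo : IsOpen Ω) (hΩr : interior (closure Ω) = Ω) (μ : ℝ)
    {β : E d → E d} (hβc : ContinuousOn β (closure Ω)) (hβ : ContDiffOn ℝ 1 β Ω)
    (hβdiv : ∀ x ∈ Ω, divergence β x = 0) (hF : Set (E d) → ℝ) (v : 𝒯.V) :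
    𝒯.Kh μ β hF (fun _ => 1) v = 𝒯.Bh μ β hF (fun _ => 1) v := by
  classical
  have hβf : ∀ p, ContinuousOn β (𝒯.fct p) := fun p => hβc.mono (𝒯.fct_subset_closure p)
  set I : 𝒯.LFct → ℝ := fun p => 𝒯.fctInt p fun x => ⟪β x, 𝒯.bjump v p x⟫ with hI
  have hvol : (∑ i, ∫ x in 𝒯.elem i, (μ * ⟪𝒯.gradOn (fun _ => 1) i x, 𝒯.gradOn v i x⟫ -
      𝒯.onElem (fun _ => 1) i x * ⟪β x, 𝒯.gradOn v i x⟫)) = -∑ p, I p := by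
    rw [Fintype.sum_prod_type, ← Finset.sum_neg_distrib]
    refine Finset.sum_congr rfl fun i _ => ?_
    simp only [gradOn_one, onElem_one, inner_zero_left, mul_zero, zero_sub, one_mul]
    rw [integral_neg, 𝒯.integral_elem_eq_sum_facets hd hΩr hβc hβ hβdiv]
  have hint : (∑ F ∈ 𝒯.intFcts, 𝒯.fctInt F.1 fun x =>
      ⟪𝒯.mean (fun _ => 1) F x • β x, 𝒯.jump v F x⟫) = ∑ F ∈ 𝒯.intFcts, (I F.1 + I F.2) := by
    refine Finset.sum_congr rfl fun F hFm => ?_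
    have h2 : I F.2 = 𝒯.fctInt F.1 fun x => ⟪β x, 𝒯.bjump v F.2 x⟫ := by
      simp only [hI, fctInt, ((𝒯.mem_intFcts).1 hFm).2]
    have h3 := hβf F.1
    have h4 := 𝒯.continuous_bjump v F.1
    have h5 := 𝒯.continuous_bjump v F.2
    rw [h2, ← 𝒯.fctInt_add hd F.1 (by fun_prop) (by fun_prop)]
    refine 𝒯.fctInt_congr F.1 fun x _ => ?_
    have : 𝒯.mean (fun _ => 1) F x = 1 := by rw [mean, onElem_one, onElem_one]; norm_num
    rw [this, one_smul, ← inner_add_right]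
    rfl
  have hpen : (∑ F ∈ 𝒯.intFcts, 𝒯.fctInt F.1 fun x => μ *
      (-⟪𝒯.jump (fun _ => 1) F x, 𝒯.meanGrad v F x⟫
        - ⟪𝒯.meanGrad (fun _ => 1) F x, 𝒯.jump v F x⟫
        + cip * (hF (𝒯.fct F.1))⁻¹ * ⟪𝒯.jump (fun _ => 1) F x, 𝒯.jump v F x⟫)) = 0 := by
    refine Finset.sum_eq_zero fun F hFm => ?_
    simp [𝒯.jump_one hd hFm, meanGrad, gradOn_one, fctInt]
  have hupw : (∑ F ∈ 𝒯.intFcts, 𝒯.fctInt F.1 fun x =>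
      |⟪β x, 𝒯.normal F.1⟫| / 2 * ⟪𝒯.jump (fun _ => 1) F x, 𝒯.jump v F x⟫) = 0 := by
    refine Finset.sum_eq_zero fun F hFm => ?_
    simp [𝒯.jump_one hd hFm, fctInt]
  have hout : (∑ p ∈ 𝒯.outFcts β, 𝒯.fctInt p fun x =>
      ⟪𝒯.onElem (fun _ => 1) p.1 x • β x, 𝒯.bjump v p x⟫) = ∑ p ∈ 𝒯.outFcts β, I p := by
    simp [onElem_one, hI]
  have hin : (∑ p ∈ 𝒯.inFcts β, 𝒯.fctInt p fun x =>
      ⟪β x, 𝒯.normal p⟫ * 𝒯.onElem (𝒯.lift fun _ => 1) p.1 x * 𝒯.onElem v p.1 x) =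
      ∑ p ∈ 𝒯.inFcts β, I p := by
    refine Finset.sum_congr rfl fun p hp => 𝒯.fctInt_congr p fun x hx => ?_
    rw [𝒯.onElem_lift_one (Finset.mem_filter.1 hp).1 hx, bjump, inner_smul_right]
    ring
  have hbd : (∑ p ∈ 𝒯.bdryFcts, 𝒯.fctInt p fun x => μ *
      (-⟪𝒯.bjump (fun _ => 1) p x, 𝒯.gradOn v p.1 x⟫
        - ⟪𝒯.gradOn (fun _ => 1) p.1 x, 𝒯.bjump v p x⟫
        + cip * (hF (𝒯.fct p))⁻¹ * ⟪𝒯.bjump (fun _ => 1) p x, 𝒯.bjump v p x⟫)) =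
      -(∑ p ∈ 𝒯.bdryFcts, 𝒯.fctInt p fun x =>
        μ * 𝒯.onElem (𝒯.lift fun _ => 1) p.1 x * ⟪𝒯.gradOn v p.1 x, 𝒯.normal p⟫)
      + ∑ p ∈ 𝒯.bdryFcts, 𝒯.fctInt p fun x =>
        cip * μ * (hF (𝒯.fct p))⁻¹ * 𝒯.onElem (𝒯.lift fun _ => 1) p.1 x * 𝒯.onElem v p.1 x := by
    rw [← Finset.sum_neg_distrib, ← Finset.sum_add_distrib]
    refine Finset.sum_congr rfl fun p hp => ?_
    have h1 := 𝒯.continuous_onElem (𝒯.lift fun _ => 1) p.1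
    have h2 := 𝒯.continuous_onElem v p.1
    have h3 := 𝒯.continuous_gradOn v p.1
    have hneg : ∀ f : E d → ℝ, -𝒯.fctInt p f = 𝒯.fctInt p fun x => -f x := fun f =>
      (integral_neg _).symm
    rw [hneg, ← 𝒯.fctInt_add hd p (by fun_prop) (by fun_prop)]
    refine 𝒯.fctInt_congr p fun x hx => ?_
    have hn : ⟪𝒯.normal p, 𝒯.normal p⟫ = (1 : ℝ) := by
      rw [real_inner_self_eq_norm_sq, 𝒯.norm_normal hd]; norm_num
    rw [𝒯.onElem_lift_one hp hx, gradOn_one]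
    simp only [bjump, onElem_one, one_smul, inner_zero_right, inner_smul_right, hn,
      real_inner_comm (𝒯.normal p)]
    ring
  have hsplit : ∑ p ∈ 𝒯.bdryFcts, I p = ∑ p ∈ 𝒯.outFcts β, I p + ∑ p ∈ 𝒯.inFcts β, I p :=
    (Finset.sum_sdiff (Finset.filter_subset _ _)).symm
  have hsum := 𝒯.sum_lfct hd hΩo hΩr I
  unfold Kh Bh
  rw [hvol, hint, hpen, hupw, hout, hin, hbd]
  linarith

/-! ### Coupling of nodes -/

lemma onElem_φ_of_ne {a : 𝒯.Node} {i : Fin 𝒯.n} (h : i ≠ a.1) (x : E d) :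
    𝒯.onElem (𝒯.φ a) i x = 0 := by
  refine Finset.sum_eq_zero fun k _ => ?_
  have : (i, k) ≠ a := fun e => h (by rw [← e])
  simp [φ, this]

lemma onElem_φ_self (a : 𝒯.Node) (x : E d) : 𝒯.onElem (𝒯.φ a) a.1 x = 𝒯.shapeFn a x := by
  rw [onElem, Finset.sum_eq_single a.2]
  · simp [φ]
  · intro k _ hk
    have : (a.1, k) ≠ a := fun e => hk (by rw [← e])
    simp [φ, this]
  · simp

lemma gradOn_φ_of_ne {a : 𝒯.Node} {i : Fin 𝒯.n} (h : i ≠ a.1) (x : E d) :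
    𝒯.gradOn (𝒯.φ a) i x = 0 := by
  have : 𝒯.onElem (𝒯.φ a) i = fun _ => 0 := funext fun x => 𝒯.onElem_φ_of_ne h x
  rw [gradOn, this, gradient_fun_const]

/-- The trace of a shape function on a facet that does not contain its node vanishes. -/
lemma onElem_φ_fct {a : 𝒯.Node} {p : 𝒯.LFct} (ha : 𝒯.pos a ∉ 𝒯.fct p)
    {x : E d} (hx : x ∈ 𝒯.fct p) : 𝒯.onElem (𝒯.φ a) p.1 x = 0 := by
  by_cases h : p.1 = a.1
  · rw [h, onElem_φ_self, 𝒯.shapeFn_eq_zero h ha hx]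
  · exact 𝒯.onElem_φ_of_ne h x

lemma mem_nbrs {a b : 𝒯.Node} :
    b ∈ 𝒯.nbrs a ↔ ∃ i, 𝒯.pos a ∈ 𝒯.elem i ∧ 𝒯.pos b ∈ 𝒯.elem i := by
  simp only [nbrs, Finset.mem_filter, Finset.mem_univ, true_and]
  simp [patch, patchElems]

lemma mem_bnbrs {a : 𝒯.Node} {b : 𝒯.BNode} : b ∈ 𝒯.bnbrs a ↔ b.1 ∈ 𝒯.nbrs a := by
  simp [nbrs, bnbrs]

lemma self_mem_nbrs (a : 𝒯.Node) : a ∈ 𝒯.nbrs a :=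
  (𝒯.mem_nbrs).2 ⟨a.1, 𝒯.pos_mem_elem a, 𝒯.pos_mem_elem a⟩

lemma ne_of_notMem_nbrs {a b : 𝒯.Node} (h : b ∉ 𝒯.nbrs a) : b.1 ≠ a.1 := fun e =>
  h ((𝒯.mem_nbrs).2 ⟨a.1, 𝒯.pos_mem_elem a, e ▸ 𝒯.pos_mem_elem b⟩)

/-- Nodes that are not neighbours are not coupled: across a common facet of their elements neither
shape function has a nonzero trace, since a node on the facet belongs to both elements. -/
lemma Kh_eq_zero (μ : ℝ) (β : E d → E d) (hF : Set (E d) → ℝ) {a b : 𝒯.Node}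
    (h : b ∉ 𝒯.nbrs a) : 𝒯.Kh μ β hF (𝒯.φ b) (𝒯.φ a) = 0 := by
  have hne := 𝒯.ne_of_notMem_nbrs h
  have hcases : ∀ i : Fin 𝒯.n, i ≠ a.1 ∨ i ≠ b.1 := fun i => by
    by_contra hc
    push Not at hc
    exact hne (hc.2.symm.trans hc.1)
  have hint : ∀ F ∈ 𝒯.intFcts, ∀ x ∈ 𝒯.fct F.1,
      (𝒯.jump (𝒯.φ a) F x = 0 ∧ 𝒯.meanGrad (𝒯.φ a) F x = 0) ∨
      (𝒯.jump (𝒯.φ b) F x = 0 ∧ 𝒯.meanGrad (𝒯.φ b) F x = 0 ∧ 𝒯.mean (𝒯.φ b) F x = 0) ∨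
      (𝒯.jump (𝒯.φ a) F x = 0 ∧ 𝒯.jump (𝒯.φ b) F x = 0) := by
    intro F hFm x hx
    have he := ((𝒯.mem_intFcts).1 hFm).2
    by_cases ha : F.1.1 = a.1 ∨ F.2.1 = a.1
    · by_cases hb : F.1.1 = b.1 ∨ F.2.1 = b.1
      · have hboth : ∀ y ∈ 𝒯.fct F.1, y ∈ 𝒯.elem a.1 ∧ y ∈ 𝒯.elem b.1 := by
          intro y hy
          have h1 := 𝒯.fct_subset_elem _ hy
          have h2 := 𝒯.fct_subset_elem _ (he ▸ hy)
          rcases ha with ha | ha <;> rcases hb with hb | hb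
          · exact absurd (hb.symm.trans ha) hne
          · exact ⟨ha ▸ h1, hb ▸ h2⟩
          · exact ⟨ha ▸ h2, hb ▸ h1⟩
          · exact absurd (hb.symm.trans ha) hne
        have ha' : 𝒯.pos a ∉ 𝒯.fct F.1 := fun hm =>
          h ((𝒯.mem_nbrs).2 ⟨b.1, (hboth _ hm).2, 𝒯.pos_mem_elem b⟩)
        have hb' : 𝒯.pos b ∉ 𝒯.fct F.1 := fun hm =>
          h ((𝒯.mem_nbrs).2 ⟨a.1, 𝒯.pos_mem_elem a, (hboth _ hm).1⟩)
        right; right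
        constructor
        · rw [jump, 𝒯.onElem_φ_fct ha' hx, 𝒯.onElem_φ_fct (he ▸ ha') (he ▸ hx)]; simp
        · rw [jump, 𝒯.onElem_φ_fct hb' hx, 𝒯.onElem_φ_fct (he ▸ hb') (he ▸ hx)]; simp
      · push Not at hb
        right; left
        simp [jump, meanGrad, mean, 𝒯.onElem_φ_of_ne hb.1, 𝒯.onElem_φ_of_ne hb.2,
          𝒯.gradOn_φ_of_ne hb.1, 𝒯.gradOn_φ_of_ne hb.2]
    · push Not at ha
      left
      simp [jump, meanGrad, 𝒯.onElem_φ_of_ne ha.1, 𝒯.onElem_φ_of_ne ha.2,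
        𝒯.gradOn_φ_of_ne ha.1, 𝒯.gradOn_φ_of_ne ha.2]
  have hzero : ∀ p {f : E d → ℝ}, (∀ x ∈ 𝒯.fct p, f x = 0) → 𝒯.fctInt p f = 0 := fun p f hf => by
    rw [𝒯.fctInt_congr p (g := fun _ => 0) hf]; simp [fctInt]
  unfold Kh
  rw [Finset.sum_eq_zero, Finset.sum_eq_zero, Finset.sum_eq_zero, Finset.sum_eq_zero,
    Finset.sum_eq_zero, Finset.sum_eq_zero]
  · simp
  · intro F hFm
    refine hzero _ fun x hx => ?_
    rcases hint F hFm x hx with h | h | h <;> simp [h]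
  · intro p _
    refine hzero _ fun x hx => ?_
    rcases hcases p.1 with h | h <;> simp [bjump, 𝒯.onElem_φ_of_ne h]
  · intro F hFm
    refine hzero _ fun x hx => ?_
    rcases hint F hFm x hx with h | h | h <;> simp [h]
  · intro p _
    refine hzero _ fun x hx => ?_
    rcases hcases p.1 with h | h <;> simp [bjump, 𝒯.onElem_φ_of_ne h, 𝒯.gradOn_φ_of_ne h]
  · intro F hFm
    refine hzero _ fun x hx => ?_
    rcases hint F hFm x hx with h | h | h <;> simp [h]
  · intro i _
    rcases hcases i with h | h <;> simp [𝒯.onElem_φ_of_ne h, 𝒯.gradOn_φ_of_ne h]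

lemma lift_φB (b : 𝒯.BNode) : 𝒯.lift (𝒯.φB b) = 𝒯.φ b.1 := by
  funext a
  by_cases h : 𝒯.pos a ∈ frontier Ω
  · by_cases hab : a = b.1
    · subst hab
      simp [lift, φB, φ, h]
    · have : (⟨a, h⟩ : 𝒯.BNode) ≠ b := fun e => hab (by rw [← e])
      simp [lift, φB, φ, h, hab, this]
  · have : a ≠ b.1 := fun e => h (e ▸ b.2)
    simp [lift, φ, h, this]

lemma Bh_eq_zero (μ : ℝ) (β : E d → E d) (hF : Set (E d) → ℝ) {a : 𝒯.Node} {b : 𝒯.BNode}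
    (h : b ∉ 𝒯.bnbrs a) : 𝒯.Bh μ β hF (𝒯.φB b) (𝒯.φ a) = 0 := by
  have hne := 𝒯.ne_of_notMem_nbrs (fun hm => h ((𝒯.mem_bnbrs).2 hm))
  have hcases : ∀ i : Fin 𝒯.n, i ≠ a.1 ∨ i ≠ b.1.1 := fun i => by
    by_contra hc
    push Not at hc
    exact hne (hc.2.symm.trans hc.1)
  unfold Bh
  rw [lift_φB, Finset.sum_eq_zero, Finset.sum_eq_zero, Finset.sum_eq_zero]
  · simp
  all_goals
    intro p _
    rcases hcases p.1 with h | h <;> simp [𝒯.onElem_φ_of_ne h, 𝒯.gradOn_φ_of_ne h, fctInt]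

end Mesh

/-! ### The rows of the stabilized scheme -/

namespace Mesh

variable {d : ℕ} {Ω : Set (E d)} (𝒯 : Mesh d Ω)

lemma shapeFn_nonneg (a : 𝒯.Node) {x : E d} (hx : x ∈ 𝒯.elem a.1) : 0 ≤ 𝒯.shapeFn a x := by
  obtain ⟨y, hy, rfl⟩ := hx
  simpa [shapeFn] using 𝒯.shape.refBasis_nonneg hy a.2

lemma integral_φ_pos (hd : 0 < d) (a : 𝒯.Node) : 0 < 𝒯.integral (𝒯.φ a) := by
  have h1 : 𝒯.integral (𝒯.φ a) = ∫ x in 𝒯.elem a.1, 𝒯.shapeFn a x := by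
    rw [integral, Finset.sum_eq_single a.1]
    · simp [onElem_φ_self]
    · intro i _ hi
      simp [𝒯.onElem_φ_of_ne hi]
    · simp
  have hcont := (𝒯.contDiff_shapeFn a).continuous
  have hm := (𝒯.isCompact_elem a.1).isClosed.measurableSet
  rw [h1, setIntegral_pos_iff_support_of_nonneg_ae
    ((ae_restrict_iff' hm).2 (Eventually.of_forall fun x hx => 𝒯.shapeFn_nonneg a hx))
    (hcont.continuousOn.integrableOn_compact (𝒯.isCompact_elem a.1))]
  set P := polytopeInt (fun f => 𝒯.grd (a.1, f)) (fun f => 𝒯.cst (a.1, f)) with hP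
  have hsub : P ⊆ Function.support (𝒯.shapeFn a) ∩ 𝒯.elem a.1 := by
    intro x hx
    refine ⟨(𝒯.shape.refBasis_pos (fun f => ?_) a.2).ne', ?_⟩
    · rw [𝒯.refFct_symm (a.1, f)]
      exact hx f
    · rw [elem_eq_polytope]
      exact polytopeInt_subset _ _ hx
  have hne : P.Nonempty := by
    obtain ⟨f⟩ := 𝒯.shape.nonempty_fct hd
    obtain ⟨x, hx0, hx⟩ := 𝒯.exists_relint hd (a.1, f)
    have hev : ∀ᶠ t in 𝓝[>] (0 : ℝ), ∀ f', f' ≠ f →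
        0 < 𝒯.fn (a.1, f') (x + t • 𝒯.grd (a.1, f)) :=
      ((tendsto_add_smul x _).eventually (𝒯.eventually_other_pos hx)).filter_mono
        nhdsWithin_le_nhds
    obtain ⟨t, ht, ht0⟩ := (hev.and self_mem_nhdsWithin).exists
    refine ⟨x + t • 𝒯.grd (a.1, f), fun f' => ?_⟩
    by_cases hf : f' = f
    · subst hf
      change 0 < 𝒯.fn (a.1, f') (x + t • 𝒯.grd (a.1, f'))
      rw [fn_add_smul, hx0, zero_add]
      exact mul_pos ht0 (𝒯.inner_grd_self_pos hd _)
    · exact ht f' hf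
  exact ((isOpen_polytopeInt _ _).measure_pos volume hne).trans_le (measure_mono hsub)

lemma onElem_pos_self (v : 𝒯.V) (b : 𝒯.Node) : 𝒯.onElem v b.1 (𝒯.pos b) = v b := by
  rw [onElem, Finset.sum_eq_single b.2]
  · simp [shapeFn, pos, 𝒯.shape.refBasis_refVtx_self]
  · intro k _ hk
    simp [shapeFn, pos, 𝒯.shape.refBasis_refVtx_of_ne hk]
  · simp

lemma pos_mem_patch {a b : 𝒯.Node} (hb : b ∈ 𝒯.nbrs a) : 𝒯.pos b ∈ 𝒯.patch a := by
  simpa [nbrs] using hb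

lemma elem_subset_patch {a : 𝒯.Node} {i : Fin 𝒯.n} (hi : i ∈ 𝒯.patchElems a) :
    𝒯.elem i ⊆ 𝒯.patch a := subset_biUnion_of_mem (u := fun i => 𝒯.elem i) hi

/-- Boundary nodes in the support of `a` lie on the boundary of the support, because the support is
contained in the closure of the regular open set `Ω`. -/
lemma pos_mem_frontier_patch (hΩo : IsOpen Ω) (hΩr : interior (closure Ω) = Ω) {a b : 𝒯.Node}
    (hb : b ∈ 𝒯.nbrs a) (hbΩ : 𝒯.pos b ∈ frontier Ω) :
    𝒯.pos b ∈ frontier (𝒯.patch a) ∩ frontier Ω := by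
  refine ⟨⟨subset_closure (𝒯.pos_mem_patch hb), fun hint => ?_⟩, hbΩ⟩
  have hsub : 𝒯.patch a ⊆ closure Ω := iUnion₂_subset fun i _ => 𝒯.elem_subset_closure i
  have : 𝒯.pos b ∈ Ω := hΩr.subset (interior_mono hsub hint)
  rw [hΩo.frontier_eq] at hbΩ
  exact hbΩ.2 this

/-- The row of the interior penalty form at the node `a` only involves the neighbours of `a`. -/
lemma Kh_eq_sum (hd : 0 < d) (μ : ℝ) {β : E d → E d} (hβc : ContinuousOn β (closure Ω))
    (hF : Set (E d) → ℝ) (z : 𝒯.V) (a : 𝒯.Node) : 𝒯.Kh μ β hF z (𝒯.φ a) =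
    ∑ b ∈ 𝒯.nbrs a, z b * 𝒯.Kh μ β hF (𝒯.φ b) (𝒯.φ a) := by
  classical
  rw [Finset.sum_subset (Finset.subset_univ _) fun b _ hb => by
    rw [𝒯.Kh_eq_zero μ β hF hb, mul_zero]]
  exact (isLinearMap_apply_eq_sum (𝒯.isLinearMap_Kh hd μ hβc hF (𝒯.φ a)) z).trans
    (Finset.sum_congr rfl fun b _ => by unfold φ; convert! rfl)

lemma Bh_eq_sum (hd : 0 < d) (μ : ℝ) {β : E d → E d} (hβc : ContinuousOn β (closure Ω))
    (hF : Set (E d) → ℝ) (z : 𝒯.VB) (a : 𝒯.Node) : 𝒯.Bh μ β hF z (𝒯.φ a) =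
    ∑ b ∈ 𝒯.bnbrs a, z b * 𝒯.Bh μ β hF (𝒯.φB b) (𝒯.φ a) := by
  classical
  rw [Finset.sum_subset (Finset.subset_univ _) fun b _ hb => by
    rw [𝒯.Bh_eq_zero μ β hF hb, mul_zero]]
  exact (isLinearMap_apply_eq_sum (𝒯.isLinearMap_Bh hd μ hβc hF (𝒯.φ a)) z).trans
    (Finset.sum_congr rfl fun b _ => by unfold φB; convert! rfl)

section Rows

variable (μ : ℝ) (β : E d → E d) (hF : Set (E d) → ℝ) (Q : ℝ) (α : 𝒯.Detector) (u : 𝒯.V)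
  (w : 𝒯.VB)

lemma Kt_φ (z : 𝒯.V) (a : 𝒯.Node) : 𝒯.Kt μ β hF α u w z (𝒯.φ a) =
    𝒯.Kh μ β hF z (𝒯.φ a) + ∑ b ∈ 𝒯.nbrs a, 𝒯.nu μ β hF α u w a b * z b * 𝒯.ell a b := by
  rw [Kt, Finset.sum_eq_single a]
  · simp [φ]
  · intro c _ hc
    simp [φ, hc]
  · simp

lemma Bt_φ (z : 𝒯.VB) (a : 𝒯.Node) : 𝒯.Bt μ β hF α u w z (𝒯.φ a) =
    𝒯.Bh μ β hF z (𝒯.φ a) + ∑ b ∈ 𝒯.bnbrs a, 𝒯.nuB μ β hF α u w a b * z b := by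
  rw [Bt, Finset.sum_eq_single a]
  · simp [φ]
  · intro c _ hc
    simp [φ, hc]
  · simp

variable {μ β hF Q α u w}

/-- Where the detector equals `1` the mass matrix is lumped. -/
lemma Mt_φ {a : 𝒯.Node} (hα : α u w a = 1) (z : 𝒯.V) :
    𝒯.Mt Q α u w z (𝒯.φ a) = z a * 𝒯.integral (𝒯.φ a) := by
  rw [Mt, Finset.sum_eq_single a]
  · simp [φ, hα]
  · intro c _ hc
    simp [φ, hc]
  · simp

lemma Kt_φ_φ_of_mem {a b : 𝒯.Node} (hb : b ∈ 𝒯.nbrs a) : 𝒯.Kt μ β hF α u w (𝒯.φ b) (𝒯.φ a) =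
    𝒯.Kh μ β hF (𝒯.φ b) (𝒯.φ a) + 𝒯.nu μ β hF α u w a b * 𝒯.ell a b := by
  rw [Kt_φ, Finset.sum_eq_single_of_mem b hb]
  · simp [φ]
  · intro c _ hc
    simp [φ, hc]

lemma Kt_φ_φ_of_notMem {a b : 𝒯.Node} (hb : b ∉ 𝒯.nbrs a) :
    𝒯.Kt μ β hF α u w (𝒯.φ b) (𝒯.φ a) = 0 := by
  rw [Kt_φ, 𝒯.Kh_eq_zero μ β hF hb, zero_add]
  refine Finset.sum_eq_zero fun c hc => ?_
  have : c ≠ b := fun e => hb (e ▸ hc)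
  simp [φ, this]

lemma Bt_φB_φ_of_mem {a : 𝒯.Node} {b : 𝒯.BNode} (hb : b ∈ 𝒯.bnbrs a) :
    𝒯.Bt μ β hF α u w (𝒯.φB b) (𝒯.φ a) =
    𝒯.Bh μ β hF (𝒯.φB b) (𝒯.φ a) + 𝒯.nuB μ β hF α u w a b := by
  rw [Bt_φ, Finset.sum_eq_single_of_mem b hb]
  · simp [φB]
  · intro c _ hc
    simp [φB, hc]

lemma Bt_φB_φ_of_notMem {a : 𝒯.Node} {b : 𝒯.BNode} (hb : b ∉ 𝒯.bnbrs a) :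
    𝒯.Bt μ β hF α u w (𝒯.φB b) (𝒯.φ a) = 0 := by
  rw [Bt_φ, 𝒯.Bh_eq_zero μ β hF hb, zero_add]
  refine Finset.sum_eq_zero fun c hc => ?_
  have : c ≠ b := fun e => hb (e ▸ hc)
  simp [φB, this]

/-- The graph viscosity does not contribute to the row sums, apart from its boundary part. -/
lemma sum_nu_mul_ell (a : 𝒯.Node) : ∑ b ∈ 𝒯.nbrs a, 𝒯.nu μ β hF α u w a b * 𝒯.ell a b =
    ∑ b ∈ 𝒯.bnbrs a, 𝒯.nuB μ β hF α u w a b := by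
  classical
  rw [← Finset.add_sum_erase _ _ (𝒯.self_mem_nbrs a)]
  have h1 : ∑ b ∈ (𝒯.nbrs a).erase a, 𝒯.nu μ β hF α u w a b * 𝒯.ell a b =
      -∑ b ∈ (𝒯.nbrs a).erase a, 𝒯.nuOff μ β hF α u w a b := by
    rw [← Finset.sum_neg_distrib]
    refine Finset.sum_congr rfl fun b hb => ?_
    have hne := Finset.ne_of_mem_erase hb
    simp [nu, ell, hne, hne.symm]
  rw [h1]
  simp only [nu, ell, ne_eq, not_true_eq_false, if_false, if_true]
  ring

/-- The matrix conditions hold in every row in which the detector equals `1`: the graph viscosity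
then dominates the positive off-diagonal entries, and the row sums vanish because the forms agree
on constants. -/
lemma rowConditions_of_eq_one (hd : 0 < d) (hΩo : IsOpen Ω) (hΩr : interior (closure Ω) = Ω)
    (hβc : ContinuousOn β (closure Ω)) (hβ : ContDiffOn ℝ 1 β Ω)
    (hβdiv : ∀ x ∈ Ω, divergence β x = 0) {a : 𝒯.Node} (hα : α u w a = 1) :
    𝒯.RowConditions μ β hF Q α u w a := by
  classical
  refine ⟨⟨𝒯.integral_φ_pos hd a, fun b => ?_⟩, fun b hb => ?_, fun b => ?_, ?_⟩
  · rw [𝒯.Mt_φ hα]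
    by_cases h : a = b
    · subst h; simp [φ]
    · simp [φ, h]
  · by_cases hm : b ∈ 𝒯.nbrs a
    · rw [𝒯.Kt_φ_φ_of_mem hm]
      have h1 : 𝒯.Kh μ β hF (𝒯.φ b) (𝒯.φ a) ≤ 𝒯.nu μ β hF α u w a b := by
        rw [nu, if_pos hb, nuOff, hα, one_mul]
        exact (le_max_left _ _).trans (le_max_left _ _)
      have h2 : 𝒯.ell a b = -1 := by simp [ell, hb.symm]
      rw [h2]
      linarith
    · rw [𝒯.Kt_φ_φ_of_notMem hm]
  · by_cases hm : b ∈ 𝒯.bnbrs a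
    · rw [𝒯.Bt_φB_φ_of_mem hm, nuB, hα, one_mul]
      linarith [le_max_left (-𝒯.Bh μ β hF (𝒯.φB b) (𝒯.φ a)) 0]
    · rw [𝒯.Bt_φB_φ_of_notMem hm]
  · have h1 := 𝒯.Kh_eq_sum hd μ hβc hF (fun _ => 1) a
    have h2 := 𝒯.Bh_eq_sum hd μ hβc hF (fun _ => 1) a
    simp only [one_mul] at h1 h2
    rw [Finset.sum_congr rfl fun b hb => 𝒯.Kt_φ_φ_of_mem hb,
      Finset.sum_congr rfl fun b hb => 𝒯.Bt_φB_φ_of_mem hb, Finset.sum_add_distrib,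
      Finset.sum_add_distrib, sum_nu_mul_ell, ← h1, ← h2,
      𝒯.Kh_one_eq_Bh_one hd hΩo hΩr μ hβc hβ hβdiv hF]
    ring

/-- The equation of the scheme at a node where the detector equals `1`, written with the
differences to the nodal value. -/
lemma integral_mul_derivWithin (hd : 0 < d) (hβc : ContinuousOn β (closure Ω)) {T : ℝ}
    {ubar : ℝ → E d → ℝ} {u : ℝ → 𝒯.V}
    (hu : 𝒯.IsSolution μ β hF Q α (fun _ _ => 0) ubar T u) {t : ℝ} (ht : t ∈ Ioc 0 T)
    {a : 𝒯.Node} (hα : α (u t) (𝒯.interp (ubar t)) a = 1)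
    (hrow : 𝒯.RowConditions μ β hF Q α (u t) (𝒯.interp (ubar t)) a) :
    𝒯.integral (𝒯.φ a) * derivWithin (fun s => u s a) (Icc 0 T) t =
      (∑ b ∈ 𝒯.nbrs a, 𝒯.Kt μ β hF α (u t) (𝒯.interp (ubar t)) (𝒯.φ b) (𝒯.φ a) *
        (u t a - u t b)) +
      ∑ b ∈ 𝒯.bnbrs a, 𝒯.Bt μ β hF α (u t) (𝒯.interp (ubar t)) (𝒯.φB b) (𝒯.φ a) *
        (𝒯.interp (ubar t) b - u t a) := by
  have heq := (hu t ht).2 (𝒯.φ a)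
  set w := 𝒯.interp (ubar t) with hw
  have hG : 𝒯.Gh (fun _ => 0) (𝒯.φ a) = 0 := by simp [Gh]
  have hK : 𝒯.Kt μ β hF α (u t) w (u t) (𝒯.φ a) =
      ∑ b ∈ 𝒯.nbrs a, 𝒯.Kt μ β hF α (u t) w (𝒯.φ b) (𝒯.φ a) * u t b := by
    rw [Kt_φ, 𝒯.Kh_eq_sum hd μ hβc hF, ← Finset.sum_add_distrib]
    refine Finset.sum_congr rfl fun b hb => ?_
    rw [𝒯.Kt_φ_φ_of_mem hb]
    ring
  have hB : 𝒯.Bt μ β hF α (u t) w w (𝒯.φ a) =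
      ∑ b ∈ 𝒯.bnbrs a, 𝒯.Bt μ β hF α (u t) w (𝒯.φB b) (𝒯.φ a) * w b := by
    rw [Bt_φ, 𝒯.Bh_eq_sum hd μ hβc hF, ← Finset.sum_add_distrib]
    refine Finset.sum_congr rfl fun b hb => ?_
    rw [𝒯.Bt_φB_φ_of_mem hb]
    ring
  rw [𝒯.Mt_φ hα, hG, hK, hB] at heq
  simp only [mul_sub, Finset.sum_sub_distrib, ← Finset.sum_mul]
  linear_combination heq - u t a * hrow.2.2.2

/-- The maximum principle at a node where the detector equals `1`. -/
lemma derivWithin_nonpos (hd : 0 < d) (hΩo : IsOpen Ω) (hΩr : interior (closure Ω) = Ω)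
    (hβc : ContinuousOn β (closure Ω)) {T : ℝ} {ubar : ℝ → E d → ℝ} {u : ℝ → 𝒯.V}
    (hu : 𝒯.IsSolution μ β hF Q α (fun _ _ => 0) ubar T u) {t : ℝ} (ht : t ∈ Ioc 0 T)
    {a : 𝒯.Node} (hα : α (u t) (𝒯.interp (ubar t)) a = 1)
    (hrow : 𝒯.RowConditions μ β hF Q α (u t) (𝒯.interp (ubar t)) a)
    (hmax : 𝒯.IsDiscreteMax (u t) (ubar t) a) :
    derivWithin (fun s => u s a) (Icc 0 T) t ≤ 0 := by
  have h := 𝒯.integral_mul_derivWithin hd hβc hu ht hα hrow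
  refine nonpos_of_mul_nonpos_right (a := 𝒯.integral (𝒯.φ a)) ?_ hrow.1.1
  rw [h]
  refine add_nonpos (Finset.sum_nonpos fun b hb => ?_) (Finset.sum_nonpos fun b hb => ?_)
  · by_cases hba : b = a
    · rw [hba, sub_self, mul_zero]
    · have h1 := hmax.1 b.1 _ (𝒯.pos_mem_elem b) (𝒯.pos_mem_patch hb)
      rw [onElem_pos_self] at h1
      exact mul_nonpos_of_nonpos_of_nonneg (hrow.2.1 b hba) (sub_nonneg.2 h1)
  · have h1 := hmax.2 _ (𝒯.pos_mem_frontier_patch hΩo hΩr ((𝒯.mem_bnbrs).1 hb) b.2)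
    exact mul_nonpos_of_nonneg_of_nonpos (hrow.2.2.1 b) (sub_nonpos.2 h1)

/-- The minimum principle at a node where the detector equals `1`. -/
lemma derivWithin_nonneg (hd : 0 < d) (hΩo : IsOpen Ω) (hΩr : interior (closure Ω) = Ω)
    (hβc : ContinuousOn β (closure Ω)) {T : ℝ} {ubar : ℝ → E d → ℝ} {u : ℝ → 𝒯.V}
    (hu : 𝒯.IsSolution μ β hF Q α (fun _ _ => 0) ubar T u) {t : ℝ} (ht : t ∈ Ioc 0 T)
    {a : 𝒯.Node} (hα : α (u t) (𝒯.interp (ubar t)) a = 1)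
    (hrow : 𝒯.RowConditions μ β hF Q α (u t) (𝒯.interp (ubar t)) a)
    (hmin : 𝒯.IsDiscreteMin (u t) (ubar t) a) :
    0 ≤ derivWithin (fun s => u s a) (Icc 0 T) t := by
  have h := 𝒯.integral_mul_derivWithin hd hβc hu ht hα hrow
  refine nonneg_of_mul_nonneg_right (a := 𝒯.integral (𝒯.φ a)) ?_ hrow.1.1
  rw [h]
  refine add_nonneg (Finset.sum_nonneg fun b hb => ?_) (Finset.sum_nonneg fun b hb => ?_)
  · by_cases hba : b = a
    · rw [hba, sub_self, mul_zero]
    · have h1 := hmin.1 b.1 _ (𝒯.pos_mem_elem b) (𝒯.pos_mem_patch hb)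
      rw [onElem_pos_self] at h1
      exact mul_nonneg_of_nonpos_of_nonpos (hrow.2.1 b hba) (sub_nonpos.2 h1)
  · have h1 := hmin.2 _ (𝒯.pos_mem_frontier_patch hΩo hΩr ((𝒯.mem_bnbrs).1 hb) b.2)
    exact mul_nonneg (hrow.2.2.1 b) (sub_nonneg.2 h1)

end Rows

/-! ### The jump-based shock detector -/

section Detector

variable {hab : 𝒯.Node → 𝒯.Node → ℝ} {q : ℝ} {u : 𝒯.V} {w : 𝒯.VB}

lemma abs_div_add_div_le {x y s r : ℝ} (hs : 0 ≤ s) (hr : 0 ≤ r) :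
    |x / s + y / r| ≤ |x| / s + |y| / r := by
  refine (abs_add_le _ _).trans ?_
  rw [abs_div, abs_div, abs_of_nonneg hs, abs_of_nonneg hr]

lemma abs_gradJump_le (hpos : ∀ a b, 𝒯.pos a = 𝒯.pos b → 0 < hab a b) (a b : 𝒯.Node) :
    |𝒯.gradJump hab u w a b| ≤ 2 * 𝒯.gradMean hab u w a b := by
  unfold gradJump gradMean
  split_ifs with h1 h2
  · rw [abs_div, abs_of_pos (hpos a b h1)]
    linarith
  · have := abs_div_add_div_le (x := u b - u a) (y := 𝒯.extrap u w a b - u a)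
      (norm_nonneg (𝒯.r a b)) (norm_nonneg (𝒯.r a b))
    linarith
  · rw [Finset.mul_sum]
    refine (Finset.abs_sum_le_sum_abs _ _).trans (Finset.sum_le_sum fun i _ => ?_)
    have := abs_div_add_div_le (x := u b - u a) (y := 𝒯.onElem u i (𝒯.symPt a b) - u a)
      (norm_nonneg (𝒯.r a b)) (norm_nonneg (𝒯.symPt a b - 𝒯.pos a))
    linarith

lemma gradMean_nonneg (hpos : ∀ a b, 𝒯.pos a = 𝒯.pos b → 0 < hab a b) (a b : 𝒯.Node) :
    0 ≤ 𝒯.gradMean hab u w a b := by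
  linarith [(abs_nonneg _).trans (𝒯.abs_gradJump_le (u := u) (w := w) hpos a b)]

lemma shockDetector_mem_Icc (hpos : ∀ a b, 𝒯.pos a = 𝒯.pos b → 0 < hab a b) (hq : 0 < q)
    (a : 𝒯.Node) : 𝒯.shockDetector hab q u w a ∈ Icc (0 : ℝ) 1 := by
  unfold shockDetector
  split_ifs with h
  · have hden : 0 ≤ ∑ b ∈ 𝒯.nbrs a, 2 * 𝒯.gradMean hab u w a b :=
      Finset.sum_nonneg fun b _ => mul_nonneg zero_le_two (𝒯.gradMean_nonneg hpos a b)
    have h0 : 0 ≤ |∑ b ∈ 𝒯.nbrs a, 𝒯.gradJump hab u w a b| /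
        ∑ b ∈ 𝒯.nbrs a, 2 * 𝒯.gradMean hab u w a b := div_nonneg (abs_nonneg _) hden
    refine ⟨Real.rpow_nonneg h0 q, Real.rpow_le_one h0 (div_le_one_of_le₀ ?_ hden) hq.le⟩
    exact (Finset.abs_sum_le_sum_abs _ _).trans
      (Finset.sum_le_sum fun b _ => 𝒯.abs_gradJump_le hpos a b)
  · exact ⟨le_rfl, zero_le_one⟩

/-- If all the jumps are, up to a common sign, equal to twice the means, then the detector
equals `1` outside its degenerate branch. -/
lemma shockDetector_eq_one_of_sign {a : 𝒯.Node} (h : 𝒯.sumMean hab u w a ≠ 0)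
    (hpos : ∀ a b, 𝒯.pos a = 𝒯.pos b → 0 < hab a b) {σ : ℝ} (hσ : |σ| = 1)
    (hJ : ∀ b ∈ 𝒯.nbrs a, 𝒯.gradJump hab u w a b = σ * (2 * 𝒯.gradMean hab u w a b)) :
    𝒯.shockDetector hab q u w a = 1 := by
  rw [shockDetector, if_pos h, Finset.sum_congr rfl hJ, ← Finset.mul_sum, abs_mul, hσ, one_mul,
    abs_of_nonneg (Finset.sum_nonneg fun b _ =>
      mul_nonneg zero_le_two (𝒯.gradMean_nonneg hpos a b)), div_self, Real.one_rpow]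
  rw [← Finset.mul_sum]
  exact mul_ne_zero two_ne_zero h

/-- At an extremum all differences to the nodal value, including the extrapolated one, have the
same sign `σ`. -/
lemma gradJump_eq_of_sign {a b : 𝒯.Node} {σ : ℝ} (hσ : |σ| = 1) (h1 : 0 ≤ σ * (u b - u a))
    (h2 : 0 ≤ σ * (𝒯.bval u w a - u a))
    (h3 : ∀ i ∈ 𝒯.symElems a b, 0 ≤ σ * (𝒯.onElem u i (𝒯.symPt a b) - u a)) :
    𝒯.gradJump hab u w a b = σ * (2 * 𝒯.gradMean hab u w a b) := by
  have hσ2 : σ * σ = 1 := by rw [← abs_mul_abs_self, hσ, one_mul]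
  have habs : ∀ x : ℝ, 0 ≤ σ * x → x = σ * |x| := fun x hx => by
    have : |x| = σ * x := by rw [← abs_of_nonneg hx, abs_mul, hσ, one_mul]
    rw [this, ← mul_assoc, hσ2, one_mul]
  have h4 : 0 ≤ σ * (𝒯.extrap u w a b - u a) := by
    have hprod : 0 ≤ (𝒯.bval u w a - u a) * (u b - u a) := by
      have := mul_nonneg h2 h1
      have e : σ * (𝒯.bval u w a - u a) * (σ * (u b - u a)) =
          σ * σ * ((𝒯.bval u w a - u a) * (u b - u a)) := by ring
      rwa [e, hσ2, one_mul] at this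
    have hs : 0 ≤ Real.sign ((𝒯.bval u w a - u a) * (u b - u a)) := by
      rcases hprod.lt_or_eq with hp | hp
      · rw [Real.sign_of_pos hp]; exact zero_le_one
      · rw [← hp, Real.sign_zero]
    have e : σ * (𝒯.extrap u w a b - u a) = σ * (𝒯.bval u w a - u a) +
        σ * (u b - u a) * Real.sign ((𝒯.bval u w a - u a) * (u b - u a)) := by
      rw [extrap]; ring
    rw [e]
    exact add_nonneg h2 (mul_nonneg h1 hs)
  have e1 := habs _ h1
  unfold gradJump gradMean
  split_ifs with c1 c2
  · linear_combination (hab a b)⁻¹ * e1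
  · linear_combination ‖𝒯.r a b‖⁻¹ * e1 + ‖𝒯.r a b‖⁻¹ * habs _ h4
  · rw [Finset.mul_sum, Finset.mul_sum]
    refine Finset.sum_congr rfl fun i hi => ?_
    linear_combination ‖𝒯.r a b‖⁻¹ * e1 +
      ‖𝒯.symPt a b - 𝒯.pos a‖⁻¹ * habs _ (h3 i hi)

lemma mem_symElems {a b : 𝒯.Node} {i : Fin 𝒯.n} (hi : i ∈ 𝒯.symElems a b) :
    𝒯.symPt a b ∈ 𝒯.elem i ∧ 𝒯.symPt a b ∈ 𝒯.patch a := by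
  simp only [symElems, Finset.mem_filter] at hi
  exact ⟨hi.2, 𝒯.elem_subset_patch hi.1 hi.2⟩

/-- Outside its degenerate branch, the jump-based detector equals `1` at discrete extrema. -/
lemma shockDetector_eq_one (hΩo : IsOpen Ω) (hΩr : interior (closure Ω) = Ω)
    (hpos : ∀ a b, 𝒯.pos a = 𝒯.pos b → 0 < hab a b) {ubar : E d → ℝ} {a : 𝒯.Node}
    (hext : 𝒯.IsDiscreteExtremum u ubar a) (h : 𝒯.sumMean hab u (𝒯.interp ubar) a ≠ 0) :
    𝒯.shockDetector hab q u (𝒯.interp ubar) a = 1 := by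
  rcases hext with hmax | hmin
  · refine 𝒯.shockDetector_eq_one_of_sign h hpos (σ := -1) (by simp) fun b hb =>
      𝒯.gradJump_eq_of_sign (by simp) ?_ ?_ fun i hi => ?_
    · have := hmax.1 b.1 _ (𝒯.pos_mem_elem b) (𝒯.pos_mem_patch hb)
      rw [onElem_pos_self] at this
      linarith
    · by_cases ha : 𝒯.pos a ∈ frontier Ω
      · have := hmax.2 _ (𝒯.pos_mem_frontier_patch hΩo hΩr (𝒯.self_mem_nbrs a) ha)
        simp only [bval, dif_pos ha, interp]
        linarith
      · simp [bval, ha]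
    · obtain ⟨h1, h2⟩ := 𝒯.mem_symElems hi
      linarith [hmax.1 i _ h1 h2]
  · refine 𝒯.shockDetector_eq_one_of_sign h hpos (σ := 1) (by simp) fun b hb =>
      𝒯.gradJump_eq_of_sign (by simp) ?_ ?_ fun i hi => ?_
    · have := hmin.1 b.1 _ (𝒯.pos_mem_elem b) (𝒯.pos_mem_patch hb)
      rw [onElem_pos_self] at this
      linarith
    · by_cases ha : 𝒯.pos a ∈ frontier Ω
      · have := hmin.2 _ (𝒯.pos_mem_frontier_patch hΩo hΩr (𝒯.self_mem_nbrs a) ha)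
        simp only [bval, dif_pos ha, interp]
        linarith
      · simp [bval, ha]
    · obtain ⟨h1, h2⟩ := 𝒯.mem_symElems hi
      linarith [hmin.1 i _ h1 h2]

end Detector

end Mesh

end DGLED

theorem mainTheorem2 {d : ℕ} (hd : 0 < d) (Ω : Set (DGLED.E d)) (hΩo : IsOpen Ω)
    (hΩr : interior (closure Ω) = Ω) (𝒯 : DGLED.Mesh d Ω)
    (μ : ℝ) (hμ : 0 ≤ μ)
    (β : DGLED.E d → DGLED.E d) (hβc : ContinuousOn β (closure Ω)) (hβ : ContDiffOn ℝ 1 β Ω)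
    (hβdiv : ∀ x ∈ Ω, DGLED.divergence β x = 0)
    (hF : Set (DGLED.E d) → ℝ) (hFpos : ∀ p, 0 < hF (𝒯.fct p))
    (Q : ℝ) (hQ : 0 < Q) :
    (∀ α : 𝒯.Detector, 𝒯.HasShockDetectorProperty α →
      (∀ u ubar a, 𝒯.IsDiscreteExtremum u ubar a →
        𝒯.RowConditions μ β hF Q α u (𝒯.interp ubar) a) ∧
      𝒯.IsLED μ β hF Q α) ∧
    (∀ (hab : 𝒯.Node → 𝒯.Node → ℝ) (_ : ∀ a b, 𝒯.pos a = 𝒯.pos b → 0 < hab a b)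
        (q : ℝ) (_ : 0 < q),
      (∀ u w a, 𝒯.shockDetector hab q u w a ∈ Set.Icc (0 : ℝ) 1) ∧
      (∀ u ubar a, 𝒯.IsDiscreteExtremum u ubar a → 𝒯.sumMean hab u (𝒯.interp ubar) a ≠ 0 →
        𝒯.shockDetector hab q u (𝒯.interp ubar) a = 1 ∧
        𝒯.RowConditions μ β hF Q (𝒯.shockDetector hab q) u (𝒯.interp ubar) a) ∧
      𝒯.IsLEDOn (fun u w a => 𝒯.sumMean hab u w a ≠ 0) μ β hF Q
        (𝒯.shockDetector hab q)) := by
  have hrow : ∀ (α : 𝒯.Detector) u w a, α u w a = 1 → 𝒯.RowConditions μ β hF Q α u w a :=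
    fun α u w a hα => 𝒯.rowConditions_of_eq_one hd hΩo hΩr hβc hβ hβdiv hα
  have hled : ∀ (α : 𝒯.Detector) (P : 𝒯.V → 𝒯.VB → 𝒯.Node → Prop),
      (∀ u ubar a, P u (𝒯.interp ubar) a → 𝒯.IsDiscreteExtremum u ubar a →
        α u (𝒯.interp ubar) a = 1) → 𝒯.IsLEDOn P μ β hF Q α := by
    intro α P hα T ubar u hu t ht a hP
    refine ⟨fun hmax => ?_, fun hmin => ?_⟩
    · have h1 := hα _ _ a hP (Or.inl hmax)
      exact 𝒯.derivWithin_nonpos hd hΩo hΩr hβc hu ht h1 (hrow _ _ _ _ h1) hmax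
    · have h1 := hα _ _ a hP (Or.inr hmin)
      exact 𝒯.derivWithin_nonneg hd hΩo hΩr hβc hu ht h1 (hrow _ _ _ _ h1) hmin
  refine ⟨fun α hα => ⟨fun u ubar a hext => hrow _ _ _ _ (hα.2 u ubar a hext),
    hled α _ fun u ubar a _ hext => hα.2 u ubar a hext⟩, fun hab hpos q hq => ⟨fun u w a =>
      𝒯.shockDetector_mem_Icc hpos hq a, fun u ubar a hext hne => ?_,
      hled _ _ fun u ubar a hne hext => 𝒯.shockDetector_eq_one hΩo hΩr hpos hext hne⟩⟩
  have h1 := 𝒯.shockDetector_eq_one (q := q) hΩo hΩr hpos hext hne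
  exact ⟨h1, hrow _ _ _ _ h1⟩
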